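/- **Setting.** Let $K\subseteq\mathbb R^d$ be convex with $\|x-y\|_2\le D$ for all $x,y\in K$ and $r\mathcal B_d\subseteq K$, where $r>0$, $D\ge 1$ and $\mathcal B_d$ is the closed Euclidean unit ball. In round $t=1,\dots,T$ the player plays $x_t\in K$, and then an adversary, who may know $x_1,\dots,x_t$, reveals a loss $f_t:\mathbb R^d\to\mathbb R$ that is convex and $G$-Lipschitz ($G\ge1$) on $\mathbb R^d$ and non-negative on $K$, together with a choice of subgradients, written $\nabla f_t$. The player accesses $K$ only through a membership oracle ("is $x\in K$?"), apart from two given starting points $\hat x,\hat y\in K$ and the numbers $d,r,D,G$. Let $\gamma(x)=\inf\{c\ge1: x/c\in K\}$. **Base algorithm** with horizon $H$ and step size $\eta$: start with the pair $(x,y)=(\hat x,\hat y)$; in each round predict $x$; then, given the loss $f$, compute a (randomized) estimate $s$ of a subgradient of $\gamma$ at $y$, put $y\leftarrow y-\eta(\nabla f(y)+3GD\,s)$, compute an approximation $c$ of $\gamma(y)$ at the new $y$, and put $x\leftarrow y/c$. The subroutines, with $\delta=1/H^2$, are required to satisfy, for every $y$: always $c\ge1$, $|c-\gamma(y)|\le\delta$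 and $y/c\in K$; and $\gamma(u)\ge\gamma(y)+\langle\mathbb E[s],u-y\rangle-\delta(1+\|u-y\|_2)$ for all $u\in\mathbb R^d$, and $\mathbb E\|s\|_2^2\le 2/r^2$. **Meta-algorithm (EFLH)** with parameter $\epsilon>0$ and horizon $T$. For $k\ge1$ with $2^{(1+\epsilon)^k}/2\le T$ let $l_k=\lfloor 2^{(1+\epsilon)^k}/2\rfloor+1$ and $\rho_k=\min\{\tfrac12,\sqrt{\log T/l_k}\}$. For each such $k$ and each round $j$ with $l_k\mid j-1$ an expert $(j,k)$ is started in round $j$ with weight $w_j^{(j,k)}=\rho_k$; it is an instance of the base algorithm with horizon $4l_k$ and $\eta=\frac{r}{2\sqrt{l_k}\,G}$, and it is active in the rounds $j,\dots,j+4l_k-1$. In round $t$ the player plays the average of the predictions $x_t^{(j,k)}$ of the active experts, weighted proportionally to $w_t^{(j,k)}$ (the origin if there is no expert), and then sets $w_{t+1}^{(j,k)}=w_t^{(j,k)}\bigl(1+\rho_k\frac{f_t(x_t)-f_t(x_t^{(j,k)})}{GD}\bigr)$ for each active expert. **Theorem.** There is an absolute constant $C>0$ such that for all $d$, $r>0$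 and $D\ge1$ there are a constant $B$ and randomized membership-oracle subroutines as above, which depend only on $d,r,D$ and (the subroutines) on the horizon $H$ of the instance that calls them and on $y$, such that the following holds for all $K,G$ as above, all $T\ge3$, all $\epsilon>0$, all starting points $\hat x,\hat y\in K$ and all adversaries as above. The subroutines meet the requirements above, and the meta-algorithm that uses them 1. always plays $x_t\in K$; 2. makes in each round, for all outcomes of its random choices, at most $B\,\dfrac{\log T\cdot\log\log T}{\min\{\epsilon,1\}}$ membership calls; 3. satisfies for all $1\le s\le t\le T$ $$\mathbb E\Bigl[\sum_{i=s}^t f_i(x_i)-\inf_{x\in K}\sum_{i=s}^t f_i(x)\Bigr]\le C\,\frac{D^2G\sqrt{\log T}\,\max\{1,t-s\}^{\frac12+\epsilon}}{r};$$ 4. if $\epsilon=1/\log T$, satisfies for all $1\le s\le t\le T$ $$\mathbb E\Bigl[\sum_{i=s}^t f_i(x_i)-\inf_{x\in K}\sum_{i=s}^t f_i(x)\Bigr]\le C\,\frac{D^2G\sqrt{\log T}\,\sqrt{\max\{1,t-s\}}}{r}.$$ -/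

import Mathlib

namespace ProjFree

/-! ### Randomized computations with a membership oracle -/

/-- Randomized computations over `E` with result in `α` whose only access to the domain is through
yes/no membership queries. Arithmetic is free, `rand n k` draws a uniform element of
`Fin (n + 1)`. -/
inductive OracleComp (E : Type) (α : Type) : Type where
  | pure (a : α) : OracleComp E α
  | query (x : E) (k : Bool → OracleComp E α) : OracleComp E α
  | rand (n : ℕ) (k : Fin (n + 1) → OracleComp E α) : OracleComp E α

namespace OracleComp

variable {E α β : Type}

/-- Run `m`, then continue with its result. -/
def bind (m : OracleComp E α) (f : α → OracleComp E β) : OracleComp E β :=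
  match m with
  | pure a => f a
  | query x k => query x fun b => (k b).bind f
  | rand n k => rand n fun i => (k i).bind f

/-- Run the computation `f` on all entries of a list, in order. -/
def traverse (f : α → OracleComp E β) : List α → OracleComp E (List β)
  | [] => pure []
  | a :: l => (f a).bind fun b => (traverse f l).bind fun bs => pure (b :: bs)

/-- The expectation of `F` of the result, when the queries are answered by `O`. -/
noncomputable def expect (O : E → Bool) (m : OracleComp E α) (F : α → ℝ) : ℝ :=
  match m with
  | pure a => F a
  | query x k => (k (O x)).expect O F
  | rand n k => (∑ i, (k i).expect O F) / (n + 1 : ℝ)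

/-- The set of results that have positive probability, when the queries are answered by `O`. -/
def support (O : E → Bool) (m : OracleComp E α) : Set α :=
  match m with
  | pure a => {a}
  | query x k => (k (O x)).support O
  | rand _ k => ⋃ i, (k i).support O

/-- The largest number of queries over all random choices, when the queries are answered
by `O`. -/
def maxCalls (O : E → Bool) (m : OracleComp E α) : ℕ :=
  match m with
  | pure _ => 0
  | query x k => (k (O x)).maxCalls O + 1
  | rand _ k => Finset.univ.sup fun i => (k i).maxCalls O

end OracleComp

open Classical in
/-- The membership oracle of `K`. -/
noncomputable def memOracle {E : Type} (K : Set E) (x : E) : Bool := decide (x ∈ K)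

/-! ### The Minkowski regularization and its approximation -/

section Base

variable {E : Type} [NormedAddCommGroup E] [InnerProductSpace ℝ E]

/-- The Minkowski regularization `γ(x) = inf {c ≥ 1 : x / c ∈ K}`. -/
noncomputable def gauge1 (K : Set E) (x : E) : ℝ :=
  sInf {c : ℝ | 1 ≤ c ∧ c⁻¹ • x ∈ K}

/-- Procedures that approximate `γ(y)` and a subgradient of `γ` at `y`; the first argument is the
time horizon, which determines the precision. -/
structure Subroutines (E : Type) where
  value : ℕ → E → OracleComp E ℝ
  subgrad : ℕ → E → OracleComp E E

/-- With the oracle of `K` the procedures for horizon `H` are `δ`-approximations: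
every output `c` of the first one is within `δ` of `γ(y)` and scales `y` into `K`; the output `s`
of the second one is in expectation a subgradient of `γ` at `y` up to `δ` and has second moment at
most `2 / r ^ 2`. -/
structure Subroutines.IsApprox (sub : Subroutines E) (K : Set E) (r : ℝ) (H : ℕ) (δ : ℝ) :
    Prop where
  value_spec : ∀ y : E, ∀ c ∈ (sub.value H y).support (memOracle K),
    1 ≤ c ∧ c⁻¹ • y ∈ K ∧ |c - gauge1 K y| ≤ δ
  subgrad_spec : ∀ y u : E,
    gauge1 K y + (sub.subgrad H y).expect (memOracle K) (fun s => inner ℝ s (u - y))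
      - δ * (1 + ‖u - y‖) ≤ gauge1 K u
  subgrad_sq : ∀ y : E,
    (sub.subgrad H y).expect (memOracle K) (fun s => ‖s‖ ^ 2) ≤ 2 / r ^ 2

/-! ### Losses -/

/-- A loss function together with a choice of its (sub)gradients. -/
structure Loss (E : Type) where
  val : E → ℝ
  grad : E → E

/-- The loss is convex and `G`-Lipschitz on the whole space and non-negative on `K`,
and `grad` selects subgradients. -/
structure Loss.IsAdmissible (f : Loss E) (K : Set E) (G : ℝ) : Prop where
  convex : ConvexOn ℝ Set.univ f.val
  lipschitz : ∀ x y : E, |f.val x - f.val y| ≤ G * ‖x - y‖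
  nonneg : ∀ x ∈ K, 0 ≤ f.val x
  subgradient : ∀ y u : E, f.val y + inner ℝ (f.grad y) (u - y) ≤ f.val u

/-! ### The base algorithm -/

/-- One update of the base algorithm with horizon `H` and step size `η`. The base algorithm keeps a
pair `(x, y)`, plays `x`, and after observing the loss `f` it makes a gradient step at `y` for
`f + 3 G D (γ - 1)` and scales the new `y` back to the domain. -/
noncomputable def baseStep (sub : Subroutines E) (H : ℕ) (η G D : ℝ) (f : Loss E) (y : E) :
    OracleComp E (E × E) :=
  (sub.subgrad H y).bind fun s =>
    let y' := y - η • (f.grad y + (3 * G * D) • s)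
    (sub.value H y').bind fun c => .pure (c⁻¹ • y', y')

/-! ### The meta-algorithm -/

/-- The numbers `l_k = ⌊2 ^ ((1 + ε) ^ k) / 2⌋ + 1`. -/
noncomputable def len (ε : ℝ) (k : ℕ) : ℕ := ⌊(2 : ℝ) ^ ((1 + ε) ^ k) / 2⌋₊ + 1

open Classical in
/-- The levels `k ≥ 1` with `2 ^ ((1 + ε) ^ k) / 2 ≤ T`, in increasing order. The upper end of the
range only makes the list finite, see `mem_levels`. -/
noncomputable def levels (ε : ℝ) (T : ℕ) : List ℕ :=
  (List.range (⌈2 * (T : ℝ) / ε⌉₊ + 1)).filter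
    fun k => decide (1 ≤ k ∧ (2 : ℝ) ^ ((1 + ε) ^ k) / 2 ≤ T)

theorem mem_levels {ε : ℝ} (hε : 0 < ε) (T k : ℕ) :
    k ∈ levels ε T ↔ 1 ≤ k ∧ (2 : ℝ) ^ ((1 + ε) ^ k) / 2 ≤ T := by
  simp only [levels, List.mem_filter, List.mem_range, decide_eq_true_eq, and_iff_right_iff_imp]
  rintro ⟨-, hk⟩
  have h1 : 1 + (k : ℝ) * ε ≤ (1 + ε) ^ k := one_add_mul_le_pow (by linarith) k
  have h2 : (1 + ε) ^ k + 1 ≤ (2 : ℝ) ^ ((1 + ε) ^ k) := by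
    have h := one_add_mul_self_le_rpow_one_add (s := 1) (by norm_num)
      (p := (1 + ε) ^ k) (one_le_pow₀ (by linarith))
    norm_num at h
    linarith
  have h3 : (k : ℝ) ≤ 2 * (T : ℝ) / ε := by
    rw [le_div_iff₀ hε]
    linarith
  exact Nat.lt_succ_of_le (by exact_mod_cast h3.trans (Nat.le_ceil _))

/-- The learning rate `min {1/2, √(log T / l_k)}` of level `k`. -/
noncomputable def rate (ε : ℝ) (T k : ℕ) : ℝ :=
  min (1 / 2) (√(Real.log T / len ε k))

/-- The record of an expert `(birth, lvl)`, an instance of the base algorithm started in round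
`birth` with lifespan and horizon `4 l_k`, `k = lvl`: its current pair `(x, y)` and weight `w`. -/
structure Expert (E : Type) where
  birth : ℕ
  lvl : ℕ
  x : E
  y : E
  w : ℝ

/-- The inputs of the algorithm: exponent `ε`, radius `r`, diameter bound `D`, Lipschitz constant
`G`, horizon `T`, and the initial pair `(x₁, y₁)` of the base algorithm. -/
structure Params (E : Type) where
  ε : ℝ
  r : ℝ
  D : ℝ
  G : ℝ
  T : ℕ
  x₁ : E
  y₁ : E

open Classical in
/-- The experts that are started in round `j`: one for each level `k` with `l_k ∣ j - 1`. -/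
noncomputable def spawn (p : Params E) (j : ℕ) : List (Expert E) :=
  ((levels p.ε p.T).filter fun k => decide (len p.ε k ∣ j - 1)).map
    fun k => ⟨j, k, p.x₁, p.y₁, rate p.ε p.T k⟩

/-- The state before a round: the active experts, and the points played so far in order. -/
structure State (E : Type) where
  experts : List (Expert E)
  plays : List E

/-- The state before round `1`. -/
noncomputable def initState (p : Params E) : State E := ⟨spawn p 1, []⟩

/-- The weighted average of the predictions of the active experts. -/
noncomputable def playPoint (es : List (Expert E)) : E :=
  (es.map fun e => (e.w / (es.map fun e' => e'.w).sum) • e.x).sum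

/-- The update of one active expert when `x` was played and the loss `f` was observed: a step of
the base algorithm with horizon `4 l_k` and step size `r / (2 √l_k G)`, and a multiplicative
update of the weight with the losses scaled by `1 / (G D)`. -/
noncomputable def updateExpert (sub : Subroutines E) (p : Params E) (x : E) (f : Loss E)
    (e : Expert E) : OracleComp E (Expert E) :=
  (baseStep sub (4 * len p.ε e.lvl) (p.r / (2 * √(len p.ε e.lvl) * p.G)) p.G p.D f e.y).bind
    fun z => .pure
      { e with
        x := z.1
        y := z.2
        w := e.w * (1 + rate p.ε p.T e.lvl * ((f.val x - f.val e.x) / (p.G * p.D))) }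

/-- An adversary: it sees the points `[x_1, …, x_t]` played up to the current round `t`
and answers with the loss of round `t`. -/
abbrev Adversary (E : Type) := List E → Loss E

open Classical in
/-- Round `t`: play, observe the loss, update the active experts, remove those whose lifespan is
over and start the experts of round `t + 1`. -/
noncomputable def round (sub : Subroutines E) (p : Params E) (adv : Adversary E) (t : ℕ)
    (σ : State E) : OracleComp E (State E) :=
  let x := playPoint σ.experts
  let plays := σ.plays ++ [x]
  (OracleComp.traverse (updateExpert sub p x (adv plays)) σ.experts).bind fun es => .pure
    { experts := (es.filter fun e => decide (t + 1 < e.birth + 4 * len p.ε e.lvl))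
        ++ spawn p (t + 1)
      plays := plays }

/-- The first `n` rounds of the algorithm against the adversary. -/
noncomputable def run (sub : Subroutines E) (p : Params E) (adv : Adversary E) :
    ℕ → OracleComp E (State E)
  | 0 => .pure (initState p)
  | n + 1 => (run sub p adv n).bind (round sub p adv (n + 1))

/-- The regret `∑_{i=s}^t f_i(x_i) - inf_{x ∈ K} ∑_{i=s}^t f_i(x)` of the played points
`[x_1, x_2, …]`, where `f_i` is the answer of the adversary to `[x_1, …, x_i]`. -/
noncomputable def regret (K : Set E) (adv : Adversary E) (plays : List E) (s t : ℕ) : ℝ :=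
  ∑ i ∈ Finset.Icc s t, (adv (plays.take i)).val (plays.getD (i - 1) 0)
    - ⨅ x : K, ∑ i ∈ Finset.Icc s t, (adv (plays.take i)).val x

/-- The expected regret of the algorithm on the rounds `s, …, t`. -/
noncomputable def expectedRegret (sub : Subroutines E) (p : Params E) (adv : Adversary E)
    (K : Set E) (s t : ℕ) : ℝ :=
  (run sub p adv p.T).expect (memOracle K) fun σ => regret K adv σ.plays s t

end Base

end ProjFree

namespace ProjFree

namespace OracleComp

variable {E α β : Type} {O : E → Bool}

/-! ### Expectations, supports and query counts -/

/-! The base algorithm is unconstrained stochastic gradient descent on `f + 3GD(γ - 1)`. The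
function `γ` is convex, `1/r`-Lipschitz and equal to 1 on `K`, and scaling `y` back to `x = y/c`
costs at most `GD(c - 1)` because `f` is Lipschitz. So, up to small errors, the regularized regret
of the iterates `y` dominates the regret of the predictions `x` (`loss_x_le`,
`regularized_loss_sub_le`).

Values of `γ` come from bisection, subgradients from forward differences at a random grid point
above `y`. A forward difference lies between the corresponding subgradient coordinates at two
neighbouring grid points, so its error telescopes along every grid line and is small on average
(`sum_slope_sub_le`, `gridEstimate_spec`). A precision polynomial in `1/H` costs only `O(1 + log H)`
queries, for fixed `d`, `r`, `D` (`gridSubroutines_isGood`).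

The adversary adapts, so the best comparator `u` depends on the random choices, and an expectation
bound for each fixed `u` would not suffice. The deviations of the steps from their conditional means
are martingale differences. In the telescoping identity of gradient descent they are paired with
`y_i - u = (y_i - y_a) + (y_a - u)`. The first pairing has mean zero, since `y_i` is known before
the noise of that round; the second is at most half the squared norm of the summed noise plus
`D²/2`, for all `u` at once, and orthogonality bounds that norm (`sum_inner_le_of_descent`,
`expect_inner_noise`, `expect_norm_sum_noise_sq_le`). An expert of length `l` thus has expected
regret `O(√l GD²/r)` (`expect_expert_regret_le`).

For the meta-algorithm, convexity of the losses implies that the sum of `w/ρ` over the active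
experts grows only through births (`potential_round`), while the logarithm of a weight records the
advantage of its expert (`sum_loss_sub_le_log`). Using a single expert would cost the logarithm of
`T` times the number of levels, and that number is not bounded in terms of `T` as `ε` tends to 0.
But then a fraction of at least `T⁻⁵` of the levels shares one integer length
(`length_levels_le_card_sameLen`), and averaging over these leaves `O(log T)`
(`sum_sum_loss_sub_le`).

An interval of length `m` is treated with a level whose length is at most `m/2` while the next
length exceeds `m/2`. From the first multiple of the length on, lifetimes of experts cover the
interval; the rest has length at most `m/2` and is handled by induction (`expect_regret_le`). The
call bound follows from having at most four active experts per level and `O(log log T / min(ε, 1))`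
levels (`length_experts_le`, `length_levels_mul_le`). -/

theorem expect_bind (m : OracleComp E α) (f : α → OracleComp E β) (F : β → ℝ) :
    (m.bind f).expect O F = m.expect O fun a => (f a).expect O F := by
  induction m with
  | pure a => rfl
  | query x k ih => simp only [bind, expect, ih]
  | rand n k ih => simp only [bind, expect, ih]

theorem mem_support_bind {m : OracleComp E α} {f : α → OracleComp E β} {b : β} :
    b ∈ (m.bind f).support O ↔ ∃ a ∈ m.support O, b ∈ (f a).support O := by
  induction m with
  | pure a => simp [bind, support]
  | query x k ih => simp only [bind, support, ih]
  | rand n k ih =>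
    simp only [bind, support, Set.mem_iUnion, ih]
    constructor
    · rintro ⟨i, a, ha, hb⟩
      exact ⟨a, ⟨i, ha⟩, hb⟩
    · rintro ⟨a, ⟨i, ha⟩, hb⟩
      exact ⟨i, a, ha, hb⟩

@[simp] theorem mem_support_pure {a b : α} :
    b ∈ (pure a : OracleComp E α).support O ↔ b = a := Iff.rfl

@[simp] theorem expect_pure (a : α) (F : α → ℝ) :
    (pure a : OracleComp E α).expect O F = F a := rfl

theorem expect_mono {m : OracleComp E α} {F F' : α → ℝ}
    (h : ∀ a ∈ m.support O, F a ≤ F' a) : m.expect O F ≤ m.expect O F' := by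
  induction m with
  | pure a => exact h a rfl
  | query x k ih => exact ih _ h
  | rand n k ih =>
    simp only [expect]
    gcongr with i
    exact ih i fun a ha => h a (Set.mem_iUnion.2 ⟨i, ha⟩)

theorem expect_congr {m : OracleComp E α} {F F' : α → ℝ}
    (h : ∀ a ∈ m.support O, F a = F' a) : m.expect O F = m.expect O F' :=
  le_antisymm (expect_mono fun a ha => (h a ha).le) (expect_mono fun a ha => (h a ha).ge)

@[simp] theorem expect_const (m : OracleComp E α) (c : ℝ) : m.expect O (fun _ => c) = c := by
  induction m with
  | pure a => rfl
  | query x k ih => exact ih _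
  | rand n k ih =>
    simp only [expect, ih, Finset.sum_const, Finset.card_univ, Fintype.card_fin, nsmul_eq_mul]
    push_cast
    field_simp

theorem expect_add (m : OracleComp E α) (F F' : α → ℝ) :
    m.expect O (fun a => F a + F' a) = m.expect O F + m.expect O F' := by
  induction m with
  | pure a => rfl
  | query x k ih => exact ih _
  | rand n k ih => simp only [expect, ih, Finset.sum_add_distrib, add_div]

theorem expect_const_mul (m : OracleComp E α) (c : ℝ) (F : α → ℝ) :
    m.expect O (fun a => c * F a) = c * m.expect O F := by
  induction m with
  | pure a => rfl
  | query x k ih => exact ih _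
  | rand n k ih => simp only [expect, ih, ← Finset.mul_sum, mul_div_assoc]

theorem expect_sub (m : OracleComp E α) (F F' : α → ℝ) :
    m.expect O (fun a => F a - F' a) = m.expect O F - m.expect O F' := by
  have h := expect_const_mul (O := O) m (-1) F'
  have h' := expect_add (O := O) m F fun a => -1 * F' a
  simp only [neg_mul, one_mul, ← sub_eq_add_neg] at h h'
  rw [h', h, sub_eq_add_neg]

theorem expect_sum {ι : Type*} (m : OracleComp E α) (s : Finset ι) (F : ι → α → ℝ) :
    m.expect O (fun a => ∑ i ∈ s, F i a) = ∑ i ∈ s, m.expect O (F i) := by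
  classical
  induction s using Finset.induction_on with
  | empty => simp
  | insert i s hi ih => simp only [Finset.sum_insert hi, expect_add, ih]

theorem expect_le_const {m : OracleComp E α} {F : α → ℝ} {c : ℝ}
    (h : ∀ a ∈ m.support O, F a ≤ c) : m.expect O F ≤ c :=
  (expect_mono h).trans_eq (expect_const m c)

theorem maxCalls_bind_le {m : OracleComp E α} {f : α → OracleComp E β} {a b : ℕ}
    (hm : m.maxCalls O ≤ a) (hf : ∀ x ∈ m.support O, (f x).maxCalls O ≤ b) :
    (m.bind f).maxCalls O ≤ a + b := by
  induction m generalizing a with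
  | pure x => exact (hf x rfl).trans (Nat.le_add_left _ _)
  | query x k ih =>
    simp only [maxCalls] at hm
    have := ih (O x) (a := a - 1) (by omega) hf
    simp only [bind, maxCalls]
    omega
  | rand n k ih =>
    simp only [maxCalls, bind, Finset.sup_le_iff] at hm ⊢
    exact fun i _ => ih i (hm i (Finset.mem_univ i))
      fun x hx => hf x (Set.mem_iUnion.2 ⟨i, hx⟩)

/-! ### Traversals -/

theorem forall₂_of_mem_support_traverse {f : α → OracleComp E β} {l : List α} {bs : List β}
    (h : bs ∈ (traverse f l).support O) :
    List.Forall₂ (fun a b => b ∈ (f a).support O) l bs := by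
  induction l generalizing bs with
  | nil =>
    obtain rfl : bs = [] := h
    exact .nil
  | cons a l ih =>
    simp only [traverse, mem_support_bind, mem_support_pure] at h
    obtain ⟨b, hb, bs', hbs', rfl⟩ := h
    exact .cons hb (ih hbs')

theorem maxCalls_traverse_le {f : α → OracleComp E β} {l : List α} {c : ℕ}
    (h : ∀ a ∈ l, (f a).maxCalls O ≤ c) : (traverse f l).maxCalls O ≤ l.length * c := by
  induction l with
  | nil => simp [traverse, maxCalls]
  | cons a l ih =>
    have h1 := ih fun b hb => h b (List.mem_cons_of_mem _ hb)
    have h2 := maxCalls_bind_le (O := O) (m := f a)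
      (f := fun b => (traverse f l).bind fun bs => pure (b :: bs))
      (h a List.mem_cons_self) (b := l.length * c) fun b _ =>
        (maxCalls_bind_le (b := 0) h1 fun _ _ => le_rfl).trans (by simp)
    simp only [traverse, List.length_cons]
    calc _ ≤ _ := h2
      _ = _ := by ring

/-- The law of the first entry with a given key, if the computations preserve keys. -/
theorem expect_traverse_find? {κ : Type} [DecidableEq κ] {f : α → OracleComp E α} {key : α → κ}
    (hkey : ∀ a, ∀ b ∈ (f a).support O, key b = key a) (l : List α) (i : κ)
    (F : Option α → ℝ) :
    (traverse f l).expect O (fun bs => F (bs.find? fun b => decide (key b = i))) =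
      match l.find? fun b => decide (key b = i) with
      | none => F none
      | some a => (f a).expect O fun b => F (some b) := by
  induction l with
  | nil => rfl
  | cons a l ih =>
    simp only [traverse, expect_bind, expect_pure, List.find?_cons]
    by_cases ha : key a = i
    · simp only [ha, decide_true]
      exact expect_congr fun b hb => by simp [hkey a b hb, ha]
    · simp only [ha, decide_false]
      rw [← ih]
      rw [expect_congr (F' := fun _ => (traverse f l).expect O
        (fun bs => F (bs.find? fun b => decide (key b = i))))]
      · simp
      · intro b hb
        simp [hkey a b hb, ha]

/-! ### Deterministic computations -/

/-- The computation makes no use of randomness: it returns `a` with certainty. -/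
def Returns (O : E → Bool) (m : OracleComp E α) (a : α) : Prop :=
  m.support O = {a} ∧ ∀ F : α → ℝ, m.expect O F = F a

theorem Returns.pure (a : α) : Returns O (OracleComp.pure a : OracleComp E α) a :=
  ⟨rfl, fun _ => rfl⟩

theorem Returns.bind {m : OracleComp E α} {f : α → OracleComp E β} {a : α} {b : β}
    (hm : Returns O m a) (hf : Returns O (f a) b) : Returns O (m.bind f) b := by
  refine ⟨?_, fun F => ?_⟩
  · ext x
    rw [mem_support_bind, hm.1]
    simp [hf.1]
  · rw [expect_bind, hm.2, hf.2]

theorem Returns.traverse {f : α → OracleComp E β} {g : α → β} (h : ∀ a, Returns O (f a) (g a))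
    (l : List α) : Returns O (OracleComp.traverse f l) (l.map g) := by
  induction l with
  | nil => exact Returns.pure _
  | cons a l ih => exact (h a).bind (ih.bind (Returns.pure _))

end OracleComp

end ProjFree

namespace ProjFree

/-! ### The Minkowski regularization -/

section Gauge

variable {E : Type} [NormedAddCommGroup E] [InnerProductSpace ℝ E] {K : Set E} {r : ℝ}

theorem inv_smul_mem_of_le (hK : Convex ℝ K) (h0 : (0 : E) ∈ K) {x : E} {c c' : ℝ} (hc : 0 < c)
    (hcc : c ≤ c') (hx : c⁻¹ • x ∈ K) : c'⁻¹ • x ∈ K := by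
  have h := hK.smul_mem_of_zero_mem h0 hx (t := c / c')
    ⟨div_nonneg hc.le (hc.le.trans hcc), (div_le_one (hc.trans_le hcc)).2 hcc⟩
  rwa [smul_smul, div_mul_eq_mul_div, mul_inv_cancel₀ hc.ne', one_div] at h

theorem inv_smul_mem_of_norm_le (hball : Metric.closedBall 0 r ⊆ K) {x : E} {c : ℝ}
    (hc : 0 < c) (hx : ‖x‖ ≤ c * r) : c⁻¹ • x ∈ K := by
  apply hball
  rw [mem_closedBall_zero_iff, norm_smul, norm_inv, Real.norm_of_nonneg hc.le,
    inv_mul_le_iff₀ hc]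
  exact hx

theorem gauge1_set_nonempty (hr : 0 < r) (hball : Metric.closedBall 0 r ⊆ K) (x : E) :
    {c : ℝ | 1 ≤ c ∧ c⁻¹ • x ∈ K}.Nonempty := by
  refine ⟨max 1 (‖x‖ / r), le_max_left _ _, inv_smul_mem_of_norm_le hball (by positivity) ?_⟩
  rw [← div_le_iff₀ hr]
  exact le_max_right _ _

theorem bddBelow_gauge1_set (x : E) : BddBelow {c : ℝ | 1 ≤ c ∧ c⁻¹ • x ∈ K} :=
  ⟨1, fun _ hc => hc.1⟩

theorem gauge1_le {x : E} {c : ℝ} (hc : 1 ≤ c) (hx : c⁻¹ • x ∈ K) : gauge1 K x ≤ c :=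
  csInf_le (bddBelow_gauge1_set x) ⟨hc, hx⟩

theorem one_le_gauge1 (hr : 0 < r) (hball : Metric.closedBall 0 r ⊆ K) (x : E) :
    1 ≤ gauge1 K x :=
  le_csInf (gauge1_set_nonempty hr hball x) fun _ hc => hc.1

theorem le_gauge1 (hK : Convex ℝ K) (hr : 0 < r) (hball : Metric.closedBall 0 r ⊆ K) {x : E}
    {c : ℝ} (hx : c⁻¹ • x ∉ K) : c ≤ gauge1 K x := by
  refine le_csInf (gauge1_set_nonempty hr hball x) fun c' hc' => ?_
  by_contra! h
  exact hx (inv_smul_mem_of_le hK (hball (by simp [hr.le])) (by linarith [hc'.1]) h.le hc'.2)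

theorem gauge1_of_mem (hr : 0 < r) (hball : Metric.closedBall 0 r ⊆ K) {x : E} (hx : x ∈ K) :
    gauge1 K x = 1 :=
  le_antisymm (gauge1_le le_rfl (by simpa)) (one_le_gauge1 hr hball x)

theorem exists_lt_of_gauge1_lt (hr : 0 < r) (hball : Metric.closedBall 0 r ⊆ K) {x : E} {a : ℝ}
    (h : gauge1 K x < a) : ∃ c, 1 ≤ c ∧ c < a ∧ c⁻¹ • x ∈ K := by
  obtain ⟨c, ⟨h1, h2⟩, h3⟩ := exists_lt_of_csInf_lt (gauge1_set_nonempty hr hball x) h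
  exact ⟨c, h1, h3, h2⟩

/-- The point is the convex combination of `c⁻¹ • x` and `c'⁻¹ • y` with weights proportional to `c`
and `c'`. Convexity and the Lipschitz bound of the regularization rest on it, and so does the
membership of weighted averages in `K`. -/
theorem combo_inv_smul_mem (hK : Convex ℝ K) {x y : E} {c c' : ℝ} (hc : 0 < c) (hc' : 0 < c')
    (hx : c⁻¹ • x ∈ K) (hy : c'⁻¹ • y ∈ K) : (c + c')⁻¹ • (x + y) ∈ K := by
  have h := hK hx hy (a := c / (c + c')) (b := c' / (c + c')) (by positivity) (by positivity)
    (by field_simp)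
  rw [smul_smul, smul_smul] at h
  convert h using 1
  rw [smul_add]
  congr 2 <;> field_simp

theorem convexOn_gauge1 (hK : Convex ℝ K) (hr : 0 < r) (hball : Metric.closedBall 0 r ⊆ K) :
    ConvexOn ℝ Set.univ (gauge1 K) := by
  rw [convexOn_iff_forall_pos]
  -- `K` need not be closed, so the infimum may not be attained; hence the slack `e`.
  refine ⟨convex_univ, fun x _ y _ a b ha hb hab => le_of_forall_pos_le_add fun e he => ?_⟩
  obtain ⟨c, h1, h2, h3⟩ := exists_lt_of_gauge1_lt hr hball (lt_add_of_pos_right (gauge1 K x) he)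
  obtain ⟨c', h1', h2', h3'⟩ :=
    exists_lt_of_gauge1_lt hr hball (lt_add_of_pos_right (gauge1 K y) he)
  have hc : 0 < c := by linarith
  have hc' : 0 < c' := by linarith
  have hmem := combo_inv_smul_mem hK (mul_pos ha hc) (mul_pos hb hc') (x := a • x) (y := b • y)
    (by rwa [smul_smul, mul_inv_rev, mul_assoc, inv_mul_cancel₀ ha.ne', mul_one])
    (by rwa [smul_smul, mul_inv_rev, mul_assoc, inv_mul_cancel₀ hb.ne', mul_one])
  refine (gauge1_le (by nlinarith) hmem).trans ?_
  simp only [smul_eq_mul]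
  have e1 : a * c ≤ a * (gauge1 K x + e) := by gcongr
  have e2 : b * c' ≤ b * (gauge1 K y + e) := by gcongr
  have e3 : a * e + b * e = e := by rw [← add_mul, hab, one_mul]
  linarith

theorem gauge1_add_le (hK : Convex ℝ K) (hr : 0 < r) (hball : Metric.closedBall 0 r ⊆ K)
    (x v : E) : gauge1 K (x + v) ≤ gauge1 K x + ‖v‖ / r := by
  refine le_of_forall_pos_le_add fun e he => ?_
  rcases eq_or_ne v 0 with rfl | hv
  · simpa using he.le
  obtain ⟨c, h1, h2, h3⟩ := exists_lt_of_gauge1_lt hr hball (lt_add_of_pos_right (gauge1 K x) he)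
  have hv' : 0 < ‖v‖ / r := by positivity
  have hmem := combo_inv_smul_mem hK (by linarith : 0 < c) hv' h3
    (inv_smul_mem_of_norm_le hball hv' (by field_simp; rfl))
  exact (gauge1_le (by linarith) hmem).trans (by linarith)

theorem abs_gauge1_sub_le (hK : Convex ℝ K) (hr : 0 < r) (hball : Metric.closedBall 0 r ⊆ K)
    (x y : E) : |gauge1 K x - gauge1 K y| ≤ 1 / r * ‖x - y‖ := by
  have h1 := gauge1_add_le hK hr hball y (x - y)
  have h2 := gauge1_add_le hK hr hball x (y - x)
  rw [add_sub_cancel] at h1 h2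
  rw [norm_sub_rev] at h2
  rw [abs_le, one_div, inv_mul_eq_div]
  constructor <;> linarith

end Gauge

/-! ### Subgradients of convex functions -/

section Subgradient

variable {E : Type} [NormedAddCommGroup E] [InnerProductSpace ℝ E]

/-- Hahn–Banach separates `(x, f x)` from the strict epigraph, which is open by continuity. The
separating functional has a negative vertical coefficient, and dividing by it turns the horizontal
part into a slope. -/
theorem exists_subgradient [CompleteSpace E] {f : E → ℝ} (hf : ConvexOn ℝ Set.univ f)
    (hc : Continuous f) (x : E) : ∃ v : E, ∀ u, f x + inner ℝ v (u - x) ≤ f u := by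
  have hconv : Convex ℝ {p : E × ℝ | p.1 ∈ Set.univ ∧ f p.1 < p.2} := hf.convex_strict_epigraph
  have hopen : IsOpen {p : E × ℝ | p.1 ∈ Set.univ ∧ f p.1 < p.2} := by
    simp only [Set.mem_univ, true_and]
    exact isOpen_lt (hc.comp continuous_fst) continuous_snd
  obtain ⟨ℓ, hℓ⟩ := geometric_hahn_banach_open_point (x := (x, f x)) hconv hopen (by simp)
  have hsplit : ∀ (u : E) (t : ℝ), ℓ (u, t) = ℓ (u, 0) + t * ℓ (0, 1) := by
    intro u t
    have : ((u, t) : E × ℝ) = (u, 0) + t • ((0 : E), (1 : ℝ)) := by simp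
    rw [this, map_add, map_smul, smul_eq_mul]
  have hlt : ∀ (u : E) (t : ℝ), f u < t →
      ℓ (u, 0) + t * ℓ (0, 1) < ℓ (x, 0) + f x * ℓ (0, 1) := by
    intro u t ht
    have := hℓ (u, t) (by simpa using ht)
    rwa [hsplit u t, hsplit x (f x)] at this
  have hneg : ℓ (0, 1) < 0 := by
    have := hlt x (f x + 1) (by linarith)
    linarith
  have hle : ∀ u, ℓ (u, 0) + f u * ℓ (0, 1) ≤ ℓ (x, 0) + f x * ℓ (0, 1) := by
    intro u
    refine le_of_forall_pos_le_add fun e he => ?_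
    have h1 := hlt u (f u + e / (-ℓ (0, 1))) (by
      have : 0 < e / (-ℓ (0, 1)) := div_pos he (by linarith)
      linarith)
    have h2 : e / (-ℓ (0, 1)) * ℓ (0, 1) = -e := by
      rw [div_neg, neg_mul, div_mul_cancel₀ _ hneg.ne]
    linarith
  let L : E →L[ℝ] ℝ := (-(ℓ (0, 1))⁻¹) • ℓ.comp (ContinuousLinearMap.inl ℝ E ℝ)
  refine ⟨(InnerProductSpace.toDual ℝ E).symm L, fun u => ?_⟩
  rw [InnerProductSpace.toDual_symm_apply]
  have hL : L (u - x) = (-(ℓ (0, 1))⁻¹) * (ℓ (u, 0) - ℓ (x, 0)) := by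
    simp [L, ← map_sub]
  rw [hL]
  have h1 := hle u
  have h2 : (-(ℓ (0, 1))⁻¹) * (ℓ (u, 0) - ℓ (x, 0)) ≤ (-(ℓ (0, 1))⁻¹) *
      ((f x - f u) * ℓ (0, 1)) :=
    mul_le_mul_of_nonneg_left (by linarith) (by
      have := inv_neg''.2 hneg
      linarith)
  have h3 : (-(ℓ (0, 1))⁻¹) * ((f x - f u) * ℓ (0, 1)) = f u - f x := by
    rw [mul_comm, mul_assoc, mul_neg, mul_inv_cancel₀ hneg.ne]
    ring
  linarith

theorem norm_le_of_subgradient {f : E → ℝ} {L : ℝ} (hL0 : 0 ≤ L)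
    (hL : ∀ x y, |f x - f y| ≤ L * ‖x - y‖) {x v : E}
    (hv : ∀ u, f x + inner ℝ v (u - x) ≤ f u) : ‖v‖ ≤ L := by
  rcases eq_or_ne v 0 with rfl | h0
  · simpa
  have h1 := hv (x + v)
  have h2 := (le_abs_self _).trans (hL (x + v) x)
  rw [add_sub_cancel_left, real_inner_self_eq_norm_sq] at h1
  rw [add_sub_cancel_left] at h2
  have h3 : 0 < ‖v‖ := norm_pos_iff.2 h0
  nlinarith

end Subgradient

/-! ### Averages over a grid -/

section Grid

variable {d : ℕ}

/-- Exchanging `z i` with `t` is an involution on pairs `(z, t)`, and it turns the summand into one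
that ignores `t`. -/
theorem sum_sum_update {β : Type*} [Fintype β] (g : (Fin d → β) → ℝ) (i : Fin d) :
    ∑ z : Fin d → β, ∑ t : β, g (Function.update z i t) =
      Fintype.card β * ∑ z : Fin d → β, g z := by
  classical
  have hinv : Function.Involutive fun p : (Fin d → β) × β => (Function.update p.1 i p.2, p.1 i) := by
    rintro ⟨z, t⟩
    simp
  have h := Equiv.sum_comp (hinv.toPerm _) fun p : (Fin d → β) × β => g p.1
  rw [Fintype.sum_prod_type, Fintype.sum_prod_type] at h
  simp only [Function.Involutive.coe_toPerm] at h
  rw [h, Finset.mul_sum]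
  simp

/-- Telescoping in the coordinate `i`. -/
theorem sum_update_succ_sub_le {N : ℕ} {L : ℝ} {φ : (Fin d → ℕ) → ℝ} (hφ : ∀ z, |φ z| ≤ L)
    (i : Fin d) :
    N * ∑ z : Fin d → Fin N, (φ (Function.update (fun j => (z j : ℕ)) i (z i + 1)) -
      φ fun j => z j) ≤ 2 * L * N ^ d := by
  have h := sum_sum_update (fun z : Fin d → Fin N =>
    φ (Function.update (fun j => (z j : ℕ)) i (z i + 1)) - φ fun j => z j) i
  rw [Fintype.card_fin] at h
  rw [← h]
  have hcoe : ∀ (z : Fin d → Fin N) (t : Fin N), (fun j => ((Function.update z i t j : Fin N) : ℕ)) =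
      Function.update (fun j => (z j : ℕ)) i t := by
    intro z t
    ext j
    by_cases hj : j = i
    · subst hj
      simp
    · simp [hj]
  calc _ = ∑ z : Fin d → Fin N, (φ (Function.update (fun j => (z j : ℕ)) i N) -
        φ (Function.update (fun j => (z j : ℕ)) i 0)) := by
        refine Finset.sum_congr rfl fun z _ => ?_
        simp only [hcoe, Function.update_self, Function.update_idem]
        rw [Fin.sum_univ_eq_sum_range fun t =>
          φ (Function.update (fun j => (z j : ℕ)) i (t + 1)) -
            φ (Function.update (fun j => (z j : ℕ)) i t),
          Finset.sum_range_sub fun t => φ (Function.update (fun j => (z j : ℕ)) i t)]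
    _ ≤ ∑ z : Fin d → Fin N, 2 * L := by
        refine Finset.sum_le_sum fun z _ => ?_
        have h1 := abs_le.1 (hφ (Function.update (fun j => (z j : ℕ)) i N))
        have h2 := abs_le.1 (hφ (Function.update (fun j => (z j : ℕ)) i 0))
        linarith
    _ = _ := by
        simp
        ring

/-- The grid point with index `z` above `y`, with mesh `q`. -/
noncomputable def gridPoint (y : EuclideanSpace ℝ (Fin d)) (q : ℝ) (z : Fin d → ℕ) :
    EuclideanSpace ℝ (Fin d) :=
  y + q • WithLp.toLp 2 fun j => (z j : ℝ)

theorem gridPoint_update_succ (y : EuclideanSpace ℝ (Fin d)) (q : ℝ) (z : Fin d → ℕ)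
    (i : Fin d) :
    gridPoint y q (Function.update z i (z i + 1)) =
      gridPoint y q z + q • EuclideanSpace.single i 1 := by
  ext j
  by_cases hj : j = i
  · subst hj
    simp [gridPoint]
    ring
  · simp [gridPoint, hj]

theorem norm_le_sum_abs (x : EuclideanSpace ℝ (Fin d)) : ‖x‖ ≤ ∑ i, |x i| := by
  rw [EuclideanSpace.norm_eq, Real.sqrt_le_left (Finset.sum_nonneg fun i _ => abs_nonneg _)]
  calc ∑ i, ‖x i‖ ^ 2 = ∑ i, |x i| * |x i| := by simp [sq]
    _ ≤ ∑ i, |x i| * ∑ j, |x j| := by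
        gcongr with i
        exact Finset.single_le_sum (f := fun j => |x j|) (fun j _ => abs_nonneg _)
          (Finset.mem_univ i)
    _ = _ := by rw [← Finset.sum_mul, sq]

theorem norm_gridPoint_sub_le (y : EuclideanSpace ℝ (Fin d)) {q : ℝ} (hq : 0 ≤ q) {N : ℕ}
    (z : Fin d → Fin N) : ‖gridPoint y q (fun j => z j) - y‖ ≤ q * (d * N) := by
  rw [gridPoint, add_sub_cancel_left, norm_smul, Real.norm_of_nonneg hq]
  gcongr
  refine (norm_le_sum_abs _).trans ?_
  calc ∑ i, |(WithLp.toLp 2 fun j => ((z j : ℕ) : ℝ) : EuclideanSpace ℝ (Fin d)) i|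
      ≤ ∑ i : Fin d, (N : ℝ) := by
        refine Finset.sum_le_sum fun i _ => ?_
        simp [(z i).2.le]
    _ = _ := by simp

variable {f : EuclideanSpace ℝ (Fin d) → ℝ} {v : EuclideanSpace ℝ (Fin d) → EuclideanSpace ℝ (Fin d)}
  {L q : ℝ}

/-- These are the subgradient inequalities at the two ends of the segment. Trapping the slope
between subgradient coordinates at neighbouring grid points is what makes the error telescope. -/
theorem subgradient_coord_le_slope (hq : 0 < q)
    (hv : ∀ x u, f x + inner ℝ (v x) (u - x) ≤ f u) (x : EuclideanSpace ℝ (Fin d)) (i : Fin d) :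
    v x i ≤ (f (x + q • EuclideanSpace.single i 1) - f x) / q ∧
      (f (x + q • EuclideanSpace.single i 1) - f x) / q ≤
        v (x + q • EuclideanSpace.single i 1) i := by
  have h1 := hv x (x + q • EuclideanSpace.single i 1)
  have h2 := hv (x + q • EuclideanSpace.single i 1) x
  rw [add_sub_cancel_left, real_inner_smul_right, EuclideanSpace.inner_single_right] at h1
  rw [sub_add_cancel_left, inner_neg_right, real_inner_smul_right,
    EuclideanSpace.inner_single_right] at h2
  simp at h1 h2
  rw [le_div_iff₀ hq, div_le_iff₀ hq]
  constructor <;> linarith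

theorem abs_coord_le (hL : ∀ x, ‖v x‖ ≤ L) (x : EuclideanSpace ℝ (Fin d)) (i : Fin d) :
    |v x i| ≤ L :=
  (PiLp.norm_apply_le (v x) i).trans (hL x)

theorem abs_slope_le (hq : 0 < q) (hv : ∀ x u, f x + inner ℝ (v x) (u - x) ≤ f u)
    (hL : ∀ x, ‖v x‖ ≤ L) (x : EuclideanSpace ℝ (Fin d)) (i : Fin d) :
    |(f (x + q • EuclideanSpace.single i 1) - f x) / q| ≤ L := by
  obtain ⟨h1, h2⟩ := subgradient_coord_le_slope hq hv x i
  have h3 := abs_le.1 (abs_coord_le hL x i)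
  have h4 := abs_le.1 (abs_coord_le hL (x + q • EuclideanSpace.single i 1) i)
  exact abs_le.2 ⟨by linarith, by linarith⟩

/-- On average over the grid, forward differences are close to subgradients. -/
theorem sum_slope_sub_le (hq : 0 < q) (hv : ∀ x u, f x + inner ℝ (v x) (u - x) ≤ f u)
    (hL : ∀ x, ‖v x‖ ≤ L) (y : EuclideanSpace ℝ (Fin d)) (N : ℕ) (i : Fin d) :
    N * ∑ z : Fin d → Fin N,
      ((f (gridPoint y q (fun j => z j) + q • EuclideanSpace.single i 1) -
        f (gridPoint y q fun j => z j)) / q - v (gridPoint y q fun j => z j) i) ≤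
      2 * L * N ^ d := by
  refine le_trans ?_ (sum_update_succ_sub_le (φ := fun z => v (gridPoint y q z) i)
    (fun z => abs_coord_le hL _ i) i)
  gcongr with z
  simp only [gridPoint_update_succ y q (fun j => ((z j : Fin N) : ℕ))]
  exact (subgradient_coord_le_slope hq hv _ i).2

end Grid

end ProjFree

namespace ProjFree

/-! ### From coordinatewise grid averages to bias and second moment. -/

section Grid

variable {d : ℕ} {f : EuclideanSpace ℝ (Fin d) → ℝ}
  {v : EuclideanSpace ℝ (Fin d) → EuclideanSpace ℝ (Fin d)} {L q κ : ℝ}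

/-- The absolute values cost nothing beyond `κ`: an exact slope is never below the subgradient
coordinate at its base point, so the sum of signed errors controls the sum of absolute ones. -/
theorem sum_abs_sub_subgradient_le (hq : 0 < q)
    (hv : ∀ x u, f x + inner ℝ (v x) (u - x) ≤ f u) (hL : ∀ x, ‖v x‖ ≤ L)
    (y : EuclideanSpace ℝ (Fin d)) {N : ℕ} (hN : 0 < N)
    {s : (Fin d → Fin N) → EuclideanSpace ℝ (Fin d)}
    (hs : ∀ z i, |s z i - (f (gridPoint y q (fun j => z j) + q • EuclideanSpace.single i 1) -
        f (gridPoint y q fun j => z j)) / q| ≤ κ) (i : Fin d) :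
    ∑ z : Fin d → Fin N, |s z i - v (gridPoint y q fun j => z j) i| ≤
      (2 * L / N + κ) * N ^ d := by
  have hN' : (0 : ℝ) < N := by exact_mod_cast hN
  calc _ ≤ ∑ z : Fin d → Fin N, (κ +
      ((f (gridPoint y q (fun j => z j) + q • EuclideanSpace.single i 1) -
        f (gridPoint y q fun j => z j)) / q - v (gridPoint y q fun j => z j) i)) := by
        refine Finset.sum_le_sum fun z _ => ?_
        have h1 := abs_le.1 (hs z i)
        have h2 := (subgradient_coord_le_slope hq hv (gridPoint y q fun j => z j) i).1
        refine abs_le.2 ⟨by linarith, by linarith⟩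
    _ = κ * N ^ d + ∑ z : Fin d → Fin N,
      ((f (gridPoint y q (fun j => z j) + q • EuclideanSpace.single i 1) -
        f (gridPoint y q fun j => z j)) / q - v (gridPoint y q fun j => z j) i) := by
        rw [Finset.sum_add_distrib]
        simp [mul_comm]
    _ ≤ κ * N ^ d + 2 * L / N * N ^ d := by
        gcongr
        have h := sum_slope_sub_le hq hv hL y N i
        rw [div_mul_eq_mul_div, le_div_iff₀ hN']
        linarith
    _ = _ := by ring

/-- Each estimate is compared with a true subgradient at its grid point `X`. Moving the base point
from `X` back to `y` costs `L‖X - y‖` twice, once in the linear term and once in the function value;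
the remaining error is bounded by its `ℓ¹` norm, which is small on average. -/
theorem grid_average_inner_le (hL0 : 0 ≤ L) (hq : 0 < q)
    (hv : ∀ x u, f x + inner ℝ (v x) (u - x) ≤ f u) (hL : ∀ x, ‖v x‖ ≤ L)
    (y : EuclideanSpace ℝ (Fin d)) {N : ℕ} (hN : 0 < N)
    {s : (Fin d → Fin N) → EuclideanSpace ℝ (Fin d)}
    (hs : ∀ z i, |s z i - (f (gridPoint y q (fun j => z j) + q • EuclideanSpace.single i 1) -
        f (gridPoint y q fun j => z j)) / q| ≤ κ) (u : EuclideanSpace ℝ (Fin d)) :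
    (∑ z, inner ℝ (s z) (u - y)) / N ^ d ≤
      f u - f y + 2 * L * (q * (d * N)) + d * (2 * L / N + κ) * ‖u - y‖ := by
  have hN' : (0 : ℝ) < N ^ d := by positivity
  have hpt : ∀ z : Fin d → Fin N, inner ℝ (s z) (u - y) ≤
      (f u - f y + 2 * L * (q * (d * N))) +
        (∑ i, |s z i - v (gridPoint y q fun j => z j) i|) * ‖u - y‖ := by
    intro z
    set X := gridPoint y q fun j => (z j : ℕ) with hX
    have hXy : ‖X - y‖ ≤ q * (d * N) := norm_gridPoint_sub_le y hq.le z
    have h1 : inner ℝ (s z - v X) (u - y) ≤ (∑ i, |s z i - v X i|) * ‖u - y‖ :=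
      (real_inner_le_norm _ _).trans
        (mul_le_mul_of_nonneg_right (norm_le_sum_abs _) (norm_nonneg _))
    have h2 : inner ℝ (v X) (X - y) ≤ L * (q * (d * N)) :=
      (real_inner_le_norm _ _).trans (mul_le_mul (hL X) hXy (norm_nonneg _) hL0)
    have h3 : -inner ℝ (v y) (X - y) ≤ L * (q * (d * N)) := by
      rw [← inner_neg_left]
      refine (real_inner_le_norm _ _).trans (mul_le_mul ?_ hXy (norm_nonneg _) hL0)
      rw [norm_neg]
      exact hL y
    have h4 := hv X u
    have h5 := hv y X
    have h6 : inner ℝ (v X) (u - y) = inner ℝ (v X) (u - X) + inner ℝ (v X) (X - y) := by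
      rw [← inner_add_right, sub_add_sub_cancel]
    rw [inner_sub_left] at h1
    linarith
  rw [div_le_iff₀ hN']
  calc _ ≤ ∑ z : Fin d → Fin N, ((f u - f y + 2 * L * (q * (d * N))) +
        (∑ i, |s z i - v (gridPoint y q fun j => z j) i|) * ‖u - y‖) :=
        Finset.sum_le_sum fun z _ => hpt z
    _ = (f u - f y + 2 * L * (q * (d * N))) * N ^ d +
        (∑ i, ∑ z : Fin d → Fin N, |s z i - v (gridPoint y q fun j => z j) i|) * ‖u - y‖ := by
        rw [Finset.sum_add_distrib, ← Finset.sum_mul, Finset.sum_comm, Finset.sum_const,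
          Finset.card_univ, Fintype.card_pi_const, Fintype.card_fin, nsmul_eq_mul]
        push_cast
        ring
    _ ≤ (f u - f y + 2 * L * (q * (d * N))) * N ^ d +
        (∑ _i : Fin d, (2 * L / N + κ) * N ^ d) * ‖u - y‖ := by
        gcongr with i
        exact sum_abs_sub_subgradient_le hq hv hL y hN hs i
    _ = _ := by
        simp
        ring

/-- By `a² - b² = (a - b)(a + b)` the excess over the squared norm of a true subgradient is linear
in the coordinate errors, so a bound on their mean absolute value is enough. -/
theorem grid_average_norm_sq_le (hL0 : 0 ≤ L) (hκ : 0 ≤ κ) (hq : 0 < q)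
    (hv : ∀ x u, f x + inner ℝ (v x) (u - x) ≤ f u) (hL : ∀ x, ‖v x‖ ≤ L)
    (y : EuclideanSpace ℝ (Fin d)) {N : ℕ} (hN : 0 < N)
    {s : (Fin d → Fin N) → EuclideanSpace ℝ (Fin d)}
    (hs : ∀ z i, |s z i - (f (gridPoint y q (fun j => z j) + q • EuclideanSpace.single i 1) -
        f (gridPoint y q fun j => z j)) / q| ≤ κ) :
    (∑ z, ‖s z‖ ^ 2) / N ^ d ≤ L ^ 2 + d * ((2 * L / N + κ) * (2 * L + κ)) := by
  have hN' : (0 : ℝ) < N ^ d := by positivity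
  have hpt : ∀ z : Fin d → Fin N, ‖s z‖ ^ 2 ≤
      L ^ 2 + (∑ i, |s z i - v (gridPoint y q fun j => z j) i|) * (2 * L + κ) := by
    intro z
    set X := gridPoint y q fun j => (z j : ℕ) with hX
    have h1 : ‖v X‖ ^ 2 ≤ L ^ 2 := by gcongr; exact hL X
    rw [EuclideanSpace.norm_sq_eq] at h1 ⊢
    refine le_trans ?_ (add_le_add_left h1 _)
    rw [Finset.sum_mul, ← Finset.sum_add_distrib]
    refine Finset.sum_le_sum fun i _ => ?_
    have h2 : |s z i + v X i| ≤ 2 * L + κ := by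
      have h3 := abs_le.1 (hs z i)
      have h4 := abs_le.1 (abs_slope_le hq hv hL X i)
      have h5 := abs_le.1 (abs_coord_le hL X i)
      refine abs_le.2 ⟨by linarith, by linarith⟩
    have h6 : (s z i) ^ 2 - (v X i) ^ 2 ≤ |s z i - v X i| * (2 * L + κ) := by
      calc (s z i) ^ 2 - (v X i) ^ 2 = (s z i - v X i) * (s z i + v X i) := by ring
        _ ≤ |(s z i - v X i) * (s z i + v X i)| := le_abs_self _
        _ = |s z i - v X i| * |s z i + v X i| := abs_mul _ _
        _ ≤ _ := by gcongr
    simp only [Real.norm_eq_abs, sq_abs]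
    linarith
  rw [div_le_iff₀ hN']
  calc _ ≤ ∑ z : Fin d → Fin N, (L ^ 2 +
        (∑ i, |s z i - v (gridPoint y q fun j => z j) i|) * (2 * L + κ)) :=
        Finset.sum_le_sum fun z _ => hpt z
    _ = L ^ 2 * N ^ d +
        (∑ i, ∑ z : Fin d → Fin N, |s z i - v (gridPoint y q fun j => z j) i|) *
          (2 * L + κ) := by
        rw [Finset.sum_add_distrib, ← Finset.sum_mul, Finset.sum_comm]
        simp [mul_comm]
    _ ≤ L ^ 2 * N ^ d + (∑ _i : Fin d, (2 * L / N + κ) * N ^ d) * (2 * L + κ) := by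
        gcongr with i
        exact sum_abs_sub_subgradient_le hq hv hL y hN hs i
    _ = _ := by
        simp
        ring

end Grid

/-! ### Bisection -/

section Bisect

variable {E : Type} [NormedAddCommGroup E] [InnerProductSpace ℝ E]

/-- Bisection for `γ(y)`, which lies between `a` and `b`, with `n` queries. -/
noncomputable def bisect (y : E) : ℕ → ℝ → ℝ → OracleComp E ℝ
  | 0, _, b => .pure b
  | n + 1, a, b => .query (((a + b) / 2)⁻¹ • y) fun ans =>
      if ans then bisect y n a ((a + b) / 2) else bisect y n ((a + b) / 2) b

theorem maxCalls_bisect (O : E → Bool) (y : E) (n : ℕ) (a b : ℝ) :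
    (bisect y n a b).maxCalls O = n := by
  induction n generalizing a b with
  | zero => rfl
  | succ n ih =>
    simp only [bisect, OracleComp.maxCalls]
    split <;> rw [ih]

variable {K : Set E} {r : ℝ}

/-- The invariant is that `a` is a lower bound for `γ(y)` and that `b` scales `y` into `K`.
Returning the right end makes the result feasible, not just accurate. -/
theorem bisect_returns (hK : Convex ℝ K) (hr : 0 < r) (hball : Metric.closedBall 0 r ⊆ K) (y : E)
    (n : ℕ) (a b : ℝ) (ha1 : 1 ≤ a) (hab : a ≤ b) (ha : a ≤ gauge1 K y) (hb : b⁻¹ • y ∈ K) :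
    ∃ c, (bisect y n a b).Returns (memOracle K) c ∧ 1 ≤ c ∧ c⁻¹ • y ∈ K ∧
      |c - gauge1 K y| ≤ (b - a) / 2 ^ n := by
  induction n generalizing a b with
  | zero =>
    refine ⟨b, .pure b, ha1.trans hab, hb, ?_⟩
    have := gauge1_le (ha1.trans hab) hb
    rw [abs_of_nonneg (by linarith)]
    simp only [pow_zero, div_one]
    linarith
  | succ n ih =>
    by_cases h : ((a + b) / 2)⁻¹ • y ∈ K
    · obtain ⟨c, hc, h1, h2, h3⟩ := ih a ((a + b) / 2) ha1 (by linarith) ha h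
      refine ⟨c, ?_, h1, h2, h3.trans_eq (by rw [pow_succ]; field_simp; ring)⟩
      simpa only [OracleComp.Returns, bisect, OracleComp.support, OracleComp.expect, memOracle, h,
        decide_true, decide_false, if_true, Bool.false_eq_true, if_false] using hc
    · obtain ⟨c, hc, h1, h2, h3⟩ := ih ((a + b) / 2) b (by linarith) (by linarith)
        (le_gauge1 hK hr hball h) hb
      refine ⟨c, ?_, h1, h2, h3.trans_eq (by rw [pow_succ]; field_simp; ring)⟩
      simpa only [OracleComp.Returns, bisect, OracleComp.support, OracleComp.expect, memOracle, h,
        decide_true, decide_false, if_true, Bool.false_eq_true, if_false] using hc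

/-- The number of bisection steps for the precision `δ`. -/
noncomputable def bisectSteps {E : Type} [NormedAddCommGroup E] (r δ : ℝ) (y : E) : ℕ := Nat.clog 2 ⌈‖y‖ / (r * δ)⌉₊

/-- Approximation of `γ(y)` up to `δ`. -/
noncomputable def approxGauge (r δ : ℝ) (y : E) : OracleComp E ℝ :=
  bisect y (bisectSteps r δ y) 1 (max 1 (‖y‖ / r))

theorem approxGauge_returns (hK : Convex ℝ K) (hr : 0 < r) (hball : Metric.closedBall 0 r ⊆ K)
    {δ : ℝ} (hδ : 0 < δ) (y : E) :
    ∃ c, (approxGauge r δ y).Returns (memOracle K) c ∧ 1 ≤ c ∧ c⁻¹ • y ∈ K ∧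
      |c - gauge1 K y| ≤ δ := by
  obtain ⟨c, hc, h1, h2, h3⟩ := bisect_returns hK hr hball y (bisectSteps r δ y) 1
    (max 1 (‖y‖ / r)) le_rfl (le_max_left _ _) (one_le_gauge1 hr hball y)
    (inv_smul_mem_of_norm_le hball (by positivity)
      (by rw [← div_le_iff₀ hr]; exact le_max_right _ _))
  refine ⟨c, hc, h1, h2, h3.trans ?_⟩
  rw [div_le_iff₀ (by positivity)]
  -- The initial interval has length at most `‖y‖ / r`, so this many halvings reach `δ`.
  have h4 : ‖y‖ / (r * δ) ≤ 2 ^ bisectSteps r δ y := by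
    refine (Nat.le_ceil _).trans ?_
    exact_mod_cast Nat.le_pow_clog one_lt_two ⌈‖y‖ / (r * δ)⌉₊
  rw [div_le_iff₀ (by positivity)] at h4
  have h5 : ‖y‖ / r ≤ δ * 2 ^ bisectSteps r δ y := by
    rw [div_le_iff₀ hr]
    linarith
  have h6 : (0 : ℝ) ≤ δ * 2 ^ bisectSteps r δ y := by positivity
  rcases max_cases 1 (‖y‖ / r) with h | h <;> rw [h.1] <;> linarith

theorem maxCalls_approxGauge (O : E → Bool) (r δ : ℝ) (y : E) :
    (approxGauge r δ y).maxCalls O = bisectSteps r δ y :=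
  maxCalls_bisect O y _ _ _

end Bisect

theorem bisectSteps_le {E : Type} [NormedAddCommGroup E] {r δ X : ℝ} (hX : 1 ≤ X) {y : E}
    (hy : ‖y‖ / (r * δ) ≤ X) : (bisectSteps r δ y : ℝ) ≤ 2 * Real.log X + 2 := by
  have h1 : bisectSteps r δ y ≤ Nat.clog 2 ⌈X⌉₊ := Nat.clog_mono_right 2 (Nat.ceil_mono hy)
  refine (Nat.cast_le.2 h1).trans ?_
  by_cases hX2 : ⌈X⌉₊ ≤ 1
  · rw [Nat.clog_of_right_le_one hX2]
    have := Real.log_nonneg hX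
    push_cast
    linarith
  push Not at hX2
  have h2 : 2 ^ (Nat.clog 2 ⌈X⌉₊).pred < ⌈X⌉₊ := Nat.pow_pred_clog_lt_self one_lt_two hX2
  have h3 : (2 : ℝ) ^ (Nat.clog 2 ⌈X⌉₊).pred < X := by
    by_contra! hcon
    have : ⌈X⌉₊ ≤ 2 ^ (Nat.clog 2 ⌈X⌉₊).pred := Nat.ceil_le.2 (by exact_mod_cast hcon)
    omega
  have h4 := Real.log_le_log (by positivity) h3.le
  rw [Real.log_pow] at h4
  have h5 : (Nat.clog 2 ⌈X⌉₊ : ℝ) ≤ ((Nat.clog 2 ⌈X⌉₊).pred : ℝ) + 1 := by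
    rw [Nat.pred_eq_sub_one]
    exact_mod_cast (by omega : Nat.clog 2 ⌈X⌉₊ ≤ Nat.clog 2 ⌈X⌉₊ - 1 + 1)
  have h6 : ((Nat.clog 2 ⌈X⌉₊).pred : ℝ) * (1 / 2) ≤ (Nat.clog 2 ⌈X⌉₊).pred * Real.log 2 := by
    gcongr
    linarith [Real.log_two_gt_d9]
  linarith

end ProjFree

namespace ProjFree

/-! ### The randomized gradient estimate -/

section Estimate

variable {d : ℕ}

/-- Indices of grid points as outcomes of a single uniform draw. -/
noncomputable def gridIndex (d M : ℕ) : Fin ((M + 1) ^ d - 1 + 1) ≃ (Fin d → Fin (M + 1)) :=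
  (finCongr (Nat.sub_add_cancel (Nat.one_le_pow d (M + 1) M.succ_pos))).trans
    finFunctionFinEquiv.symm

/-- Forward differences of the approximate regularization at `x`. -/
noncomputable def forwardDiff (r δ q : ℝ) (x : EuclideanSpace ℝ (Fin d)) :
    OracleComp (EuclideanSpace ℝ (Fin d)) (EuclideanSpace ℝ (Fin d)) :=
  (approxGauge r δ x).bind fun c =>
    (OracleComp.traverse (fun i => approxGauge r δ (x + q • EuclideanSpace.single i 1))
      (List.finRange d)).bind fun cs =>
        .pure (WithLp.toLp 2 fun i => (cs.getD i 0 - c) / q)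

/-- Forward differences at a random grid point above `y`. -/
noncomputable def gridEstimate (r δ q : ℝ) (M : ℕ) (y : EuclideanSpace ℝ (Fin d)) :
    OracleComp (EuclideanSpace ℝ (Fin d)) (EuclideanSpace ℝ (Fin d)) :=
  .rand ((M + 1) ^ d - 1) fun i => forwardDiff r δ q (gridPoint y q fun j => gridIndex d M i j)

variable {K : Set (EuclideanSpace ℝ (Fin d))} {r : ℝ}

theorem forwardDiff_returns (hK : Convex ℝ K) (hr : 0 < r) (hball : Metric.closedBall 0 r ⊆ K)
    {δ q : ℝ} (hδ : 0 < δ) (hq : 0 < q) (x : EuclideanSpace ℝ (Fin d)) :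
    ∃ s : EuclideanSpace ℝ (Fin d), (forwardDiff r δ q x).Returns (memOracle K) s ∧
      ∀ i, |s i - (gauge1 K (x + q • EuclideanSpace.single i 1) - gauge1 K x) / q| ≤
        2 * δ / q := by
  choose g hg _ _ hg3 using approxGauge_returns hK hr hball hδ
  refine ⟨WithLp.toLp 2 fun i => (g (x + q • EuclideanSpace.single i 1) - g x) / q,
    (hg x).bind (.bind (.traverse (fun i => hg _) _) ?_), fun i => ?_⟩
  · convert OracleComp.Returns.pure _ using 4 with i
    simp
  · have h1 := abs_le.1 (hg3 (x + q • EuclideanSpace.single i 1))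
    have h2 := abs_le.1 (hg3 x)
    simp only
    rw [← sub_div, abs_div, abs_of_pos hq]
    gcongr
    rw [abs_le]
    constructor <;> linarith

theorem maxCalls_forwardDiff_le {O : EuclideanSpace ℝ (Fin d) → Bool} {δ q : ℝ}
    {x : EuclideanSpace ℝ (Fin d)} {c : ℕ} (h0 : bisectSteps r δ x ≤ c)
    (h : ∀ i : Fin d, bisectSteps r δ (x + q • EuclideanSpace.single i 1) ≤ c) :
    (forwardDiff r δ q x).maxCalls O ≤ (d + 1) * c := by
  have h1 := OracleComp.maxCalls_traverse_le (O := O) (l := List.finRange d) (c := c)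
    (f := fun i => approxGauge r δ (x + q • EuclideanSpace.single i 1))
    fun i _ => (maxCalls_approxGauge O _ _ _).trans_le (h i)
  rw [List.length_finRange] at h1
  refine (OracleComp.maxCalls_bind_le (a := c) (b := d * c)
    ((maxCalls_approxGauge O _ _ _).trans_le h0) fun b _ => ?_).trans_eq (by ring)
  exact OracleComp.maxCalls_bind_le (b := 0) h1 fun _ _ => le_rfl

/-- The properties of the gradient estimate, in terms of the error `κ` of a forward difference. -/
theorem gridEstimate_spec (hK : Convex ℝ K) (hr : 0 < r) (hball : Metric.closedBall 0 r ⊆ K)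
    {δ q κ : ℝ} (hδ : 0 < δ) (hq : 0 < q) (hκ : 2 * δ / q = κ) (M : ℕ)
    (y : EuclideanSpace ℝ (Fin d)) :
    (∀ u, (gridEstimate r δ q M y).expect (memOracle K) (fun s => inner ℝ s (u - y)) ≤
      gauge1 K u - gauge1 K y + 2 * (1 / r) * (q * (d * (M + 1 : ℕ))) +
        d * (2 * (1 / r) / (M + 1 : ℕ) + κ) * ‖u - y‖) ∧
    (gridEstimate r δ q M y).expect (memOracle K) (fun s => ‖s‖ ^ 2) ≤
      (1 / r) ^ 2 + d * ((2 * (1 / r) / (M + 1 : ℕ) + κ) * (2 * (1 / r) + κ)) ∧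
    ∀ s ∈ (gridEstimate r δ q M y).support (memOracle K), ‖s‖ ≤ d * (1 / r + κ) := by
  have hL0 : 0 ≤ 1 / r := by positivity
  have hlip := abs_gauge1_sub_le hK hr hball
  have hcont : Continuous (gauge1 K) := by
    refine (LipschitzWith.of_dist_le_mul (K := ⟨1 / r, hL0⟩) fun x y => ?_).continuous
    rw [Real.dist_eq, dist_eq_norm]
    exact hlip x y
  choose v hv using exists_subgradient (convexOn_gauge1 hK hr hball) hcont
  have hL : ∀ x, ‖v x‖ ≤ 1 / r := fun x => norm_le_of_subgradient hL0 hlip (hv x)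
  choose s hs hsκ using forwardDiff_returns hK hr hball hδ hq
  have hκ0 : 0 ≤ κ := by rw [← hκ]; positivity
  simp only [hκ] at hsκ
  -- Forward differences by bisection are deterministic; the grid point is the only random choice,
  -- so the expectation is the plain grid average.
  have hexp : ∀ F, (gridEstimate r δ q M y).expect (memOracle K) F =
      (∑ z : Fin d → Fin (M + 1), F (s (gridPoint y q fun j => z j))) / (M + 1 : ℕ) ^ d := by
    intro F
    simp only [gridEstimate, OracleComp.expect, (hs _).2]
    rw [Equiv.sum_comp (gridIndex d M) fun z => F (s (gridPoint y q fun j => z j))]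
    congr 1
    have : (M + 1) ^ d - 1 + 1 = (M + 1) ^ d :=
      Nat.sub_add_cancel (Nat.one_le_pow d (M + 1) M.succ_pos)
    exact_mod_cast this
  have hs' : ∀ (z : Fin d → Fin (M + 1)) (i : Fin d), |s (gridPoint y q fun j => z j) i -
      (gauge1 K (gridPoint y q (fun j => z j) + q • EuclideanSpace.single i 1) -
        gauge1 K (gridPoint y q fun j => z j)) / q| ≤ κ := fun z i => hsκ _ i
  refine ⟨fun u => ?_, ?_, fun t ht => ?_⟩
  · rw [hexp]
    exact grid_average_inner_le hL0 hq hv hL y M.succ_pos hs' u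
  · rw [hexp]
    exact grid_average_norm_sq_le hL0 hκ0 hq hv hL y M.succ_pos hs'
  · simp only [gridEstimate, OracleComp.support, (hs _).1, Set.mem_iUnion,
      Set.mem_singleton_iff] at ht
    obtain ⟨i, rfl⟩ := ht
    refine (norm_le_sum_abs _).trans ?_
    calc _ ≤ ∑ _i : Fin d, (1 / r + κ) := by
          refine Finset.sum_le_sum fun j _ => ?_
          have h1 := abs_le.1 (hsκ (gridPoint y q fun j => gridIndex d M i j) j)
          have h2 := abs_le.1 (abs_slope_le hq hv hL (gridPoint y q fun j => gridIndex d M i j) j)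
          rw [abs_le]
          constructor <;> linarith
      _ = _ := by simp [mul_add]

theorem maxCalls_gridEstimate_le {O : EuclideanSpace ℝ (Fin d) → Bool} {δ q X : ℝ} {M : ℕ}
    (hr : 0 < r) (hδ : 0 < δ) (hq : 0 < q) (hX : 1 ≤ X) {y : EuclideanSpace ℝ (Fin d)}
    (hy : (‖y‖ + q * (d * (M + 1 : ℕ)) + q) / (r * δ) ≤ X) :
    ((gridEstimate r δ q M y).maxCalls O : ℝ) ≤ (d + 1) * (2 * Real.log X + 2) := by
  have hcalls : (gridEstimate r δ q M y).maxCalls O ≤ (d + 1) * ⌊2 * Real.log X + 2⌋₊ := by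
    simp only [gridEstimate, OracleComp.maxCalls, Finset.sup_le_iff]
    intro i _
    have hn := norm_gridPoint_sub_le y hq.le (gridIndex d M i)
    have hn' : ‖gridPoint y q fun j => gridIndex d M i j‖ ≤ ‖y‖ + q * (d * (M + 1 : ℕ)) := by
      have := norm_le_norm_add_norm_sub' (gridPoint y q fun j => gridIndex d M i j) y
      linarith
    refine maxCalls_forwardDiff_le (Nat.le_floor (bisectSteps_le hX (le_trans ?_ hy)))
      fun i => Nat.le_floor (bisectSteps_le hX (le_trans ?_ hy))
    · gcongr
      linarith
    · gcongr
      refine (norm_add_le _ _).trans ?_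
      rw [norm_smul, Real.norm_of_nonneg hq.le, PiLp.norm_single]
      simp only [norm_one, mul_one]
      linarith
  calc ((gridEstimate r δ q M y).maxCalls O : ℝ)
      ≤ ((d + 1) * ⌊2 * Real.log X + 2⌋₊ : ℕ) := by exact_mod_cast hcalls
    _ ≤ _ := by
      push_cast
      gcongr
      exact Nat.floor_le (by have := Real.log_nonneg hX; linarith)

end Estimate

/-! ### The subroutines -/

/-- The properties of the subroutines with horizon `H` on which the analysis is based. The number
`A` bounds the speed of the base algorithm. -/
structure Subroutines.IsGood {E : Type} [NormedAddCommGroup E] [InnerProductSpace ℝ E]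
    (sub : Subroutines E) (K : Set E) (r D A B : ℝ) (H : ℕ) : Prop where
  approx : sub.IsApprox K r H (1 / (H : ℝ) ^ 2)
  subgrad_spec : ∀ y u : E,
    gauge1 K y + (sub.subgrad H y).expect (memOracle K) (fun s => inner ℝ s (u - y))
      - 1 / ((H : ℝ) ^ 2 * (1 + A)) * (1 + ‖u - y‖) ≤ gauge1 K u
  norm_le : ∀ y, ∀ s ∈ (sub.subgrad H y).support (memOracle K), r * (1 + 3 * D * ‖s‖) ≤ A
  calls_value : ∀ y, ‖y‖ ≤ 2 * A * H →
    ((sub.value H y).maxCalls (memOracle K) : ℝ) ≤ B * (1 + Real.log H)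
  calls_subgrad : ∀ y, ‖y‖ ≤ 2 * A * H →
    ((sub.subgrad H y).maxCalls (memOracle K) : ℝ) ≤ B * (1 + Real.log H)

/-- The size of the grid for the precision `θ`. -/
noncomputable def gridSize (d : ℕ) (r θ : ℝ) : ℕ := ⌈8 * (d + 1) * (1 + 1 / r) / θ⌉₊

/-- The mesh of the grid for the precision `θ`. -/
noncomputable def gridMesh (d : ℕ) (r θ : ℝ) : ℝ :=
  θ / (4 * (d + 1) * (1 + 1 / r) * (gridSize d r θ + 1 : ℕ))

/-- The error of forward differences for the precision `θ`. -/
noncomputable def diffError (d : ℕ) (r θ : ℝ) : ℝ := θ / (8 * (d + 1) * (1 + r))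

/-- The precision of function values for the precision `θ` of gradients. -/
noncomputable def valueError (d : ℕ) (r θ : ℝ) : ℝ := diffError d r θ * gridMesh d r θ / 2

/-- Bisection, and forward differences at random grid points, with horizon-dependent
precision. -/
noncomputable def gridSubroutines (d : ℕ) (r A : ℝ) : Subroutines (EuclideanSpace ℝ (Fin d)) where
  value H y := approxGauge r (valueError d r (1 / ((H : ℝ) ^ 2 * (1 + A)))) y
  subgrad H y := gridEstimate r (valueError d r (1 / ((H : ℝ) ^ 2 * (1 + A))))
    (gridMesh d r (1 / ((H : ℝ) ^ 2 * (1 + A)))) (gridSize d r (1 / ((H : ℝ) ^ 2 * (1 + A)))) y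

/-! ### The errors resulting from the chosen grid size, mesh and tolerances. -/

section Parameters

variable {d : ℕ} {r θ : ℝ}

theorem gridMesh_pos (hr : 0 < r) (hθ : 0 < θ) : 0 < gridMesh d r θ := by
  unfold gridMesh
  positivity

theorem diffError_pos (hr : 0 < r) (hθ : 0 < θ) : 0 < diffError d r θ := by
  unfold diffError
  positivity

theorem valueError_pos (hr : 0 < r) (hθ : 0 < θ) : 0 < valueError d r θ := by
  have := gridMesh_pos (d := d) hr hθ
  have := diffError_pos (d := d) hr hθ
  unfold valueError
  positivity

theorem le_gridSize (hθ : 0 < θ) :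
    8 * (d + 1) * (1 + 1 / r) ≤ θ * (gridSize d r θ + 1 : ℕ) := by
  have h := Nat.le_ceil (8 * (d + 1) * (1 + 1 / r) / θ)
  rw [div_le_iff₀ hθ] at h
  push_cast
  unfold gridSize
  linarith

theorem gridMesh_mul_le (hr : 0 < r) (hθ : 0 < θ) :
    2 * (1 / r) * (gridMesh d r θ * (d * (gridSize d r θ + 1 : ℕ))) ≤ θ / 2 := by
  unfold gridMesh
  have h1 : 2 * (1 / r) * (θ / (4 * (d + 1) * (1 + 1 / r) * (gridSize d r θ + 1 : ℕ)) *
      (d * (gridSize d r θ + 1 : ℕ))) = θ / 2 * ((1 / r) / (1 + 1 / r)) * (d / (d + 1)) := by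
    field_simp
    ring
  have h2 : (1 / r) / (1 + 1 / r) ≤ 1 := by
    rw [div_le_one (by positivity)]
    linarith
  have h3 : (d : ℝ) / (d + 1) ≤ 1 := by
    rw [div_le_one (by positivity)]
    linarith
  rw [h1]
  calc _ ≤ θ / 2 * 1 * 1 := by gcongr
    _ = _ := by ring

theorem gradError_le (hr : 0 < r) (hθ : 0 < θ) :
    (d + 1) * (2 * (1 / r) / (gridSize d r θ + 1 : ℕ) + diffError d r θ) ≤ θ / 2 := by
  have h1 : 2 * (1 / r) / (gridSize d r θ + 1 : ℕ) ≤ θ / (4 * (d + 1)) := by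
    rw [div_le_div_iff₀ (by positivity) (by positivity)]
    have := le_gridSize (d := d) (r := r) hθ
    have h2 : (0 : ℝ) ≤ 8 * (d + 1) := by positivity
    linarith
  have h2 : diffError d r θ ≤ θ / (8 * (d + 1)) := by
    unfold diffError
    have : (0 : ℝ) < 8 * (d + 1) := by positivity
    exact div_le_div_of_nonneg_left hθ.le this (by nlinarith)
  have h3 : ((d : ℝ) + 1) * (θ / (4 * (d + 1)) + θ / (8 * (d + 1))) = 3 * θ / 8 := by
    field_simp
    norm_num
  calc _ ≤ ((d : ℝ) + 1) * (θ / (4 * (d + 1)) + θ / (8 * (d + 1))) := by gcongr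
    _ ≤ _ := by rw [h3]; linarith

/-- The same quantity measured against `1/r` instead of `θ`: the bias has to be small relative to
the precision, whereas the second moment and the norm have to be compared with the Lipschitz
constant of the regularization. -/
theorem gradError_le' (hr : 0 < r) (hθ : 0 < θ) (hθ1 : θ ≤ 1) :
    (d + 1) * (2 * (1 / r) / (gridSize d r θ + 1 : ℕ) + diffError d r θ) ≤
      3 / 8 * (1 / r) := by
  have h1 : 2 * (1 / r) / (gridSize d r θ + 1 : ℕ) ≤ (1 / r) / (4 * (d + 1)) := by
    rw [div_le_div_iff₀ (by positivity) (by positivity)]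
    have h0 := le_gridSize (d := d) (r := r) hθ
    have h2 : θ * (gridSize d r θ + 1 : ℕ) ≤ 1 * (gridSize d r θ + 1 : ℕ) := by gcongr
    have h3 : (0 : ℝ) ≤ 8 * (d + 1) * (1 / r) := by positivity
    have h4 : (8 * (d + 1) : ℝ) ≤ (gridSize d r θ + 1 : ℕ) := by linarith
    calc 2 * (1 / r) * (4 * ((d : ℝ) + 1)) = 1 / r * (8 * (d + 1)) := by ring
      _ ≤ _ := by gcongr
  have h2 : diffError d r θ ≤ (1 / r) / (8 * (d + 1)) := by
    unfold diffError
    rw [div_div, div_le_div_iff₀ (by positivity) (by positivity)]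
    have : (0 : ℝ) < 8 * (d + 1) := by positivity
    calc θ * (r * (8 * (d + 1))) ≤ 1 * (r * (8 * (d + 1))) := by gcongr
      _ ≤ _ := by nlinarith
  have h3 : ((d : ℝ) + 1) * ((1 / r) / (4 * (d + 1)) + (1 / r) / (8 * (d + 1))) =
      3 / 8 * (1 / r) := by
    field_simp
    norm_num
  calc _ ≤ ((d : ℝ) + 1) * ((1 / r) / (4 * (d + 1)) + (1 / r) / (8 * (d + 1))) := by gcongr
    _ = _ := h3

theorem diffError_le (hr : 0 < r) (hθ : 0 < θ) (hθ1 : θ ≤ 1) :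
    diffError d r θ ≤ 3 / 8 * (1 / r) := by
  refine le_trans ?_ (gradError_le' (d := d) hr hθ hθ1)
  have h1 := (diffError_pos (d := d) hr hθ).le
  have h2 : 0 ≤ 2 * (1 / r) / (gridSize d r θ + 1 : ℕ) := by positivity
  have h3 : (0 : ℝ) ≤ d := by positivity
  nlinarith

/-- The required accuracy is only polynomial in `θ`, so the number of bisection steps is logarithmic
in `1/θ`. -/
theorem inv_valueError_le (hr : 0 < r) (hθ : 0 < θ) (hθ1 : θ ≤ 1) :
    1 / (r * valueError d r θ) ≤
      640 * (d + 1) ^ 3 * (1 + r) * (1 + 1 / r) ^ 2 / r * (1 / θ) ^ 3 := by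
  have h1 : ((gridSize d r θ + 1 : ℕ) : ℝ) ≤ 10 * (d + 1) * (1 + 1 / r) / θ := by
    have h := Nat.ceil_lt_add_one (a := 8 * (d + 1) * (1 + 1 / r) / θ) (by positivity)
    have h2 : 2 ≤ 2 * (d + 1) * (1 + 1 / r) / θ := by
      rw [le_div_iff₀ hθ]
      have : (0 : ℝ) ≤ 1 / r := by positivity
      have : (0 : ℝ) ≤ d := by positivity
      nlinarith
    have h3 : 10 * (d + 1) * (1 + 1 / r) / θ =
      8 * (d + 1) * (1 + 1 / r) / θ + 2 * (d + 1) * (1 + 1 / r) / θ := by ring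
    rw [h3]
    push_cast
    unfold gridSize
    linarith
  have h2 : 1 / (r * valueError d r θ) = 64 * (d + 1) ^ 2 * (1 + r) * (1 + 1 / r) / r *
      (1 / θ) ^ 2 * (gridSize d r θ + 1 : ℕ) := by
    unfold valueError diffError gridMesh
    field_simp
    ring
  rw [h2]
  calc _ ≤ 64 * (d + 1) ^ 2 * (1 + r) * (1 + 1 / r) / r *
      (1 / θ) ^ 2 * (10 * (d + 1) * (1 + 1 / r) / θ) := by gcongr
    _ = _ := by
      field_simp
      ring

theorem gridMesh_mul_add_le (hr : 0 < r) (hθ : 0 < θ) :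
    gridMesh d r θ * (d * (gridSize d r θ + 1 : ℕ)) + gridMesh d r θ ≤ θ := by
  have hq := gridMesh_pos (d := d) hr hθ
  have h1 : gridMesh d r θ * ((d + 1) * (gridSize d r θ + 1 : ℕ)) = θ / (4 * (1 + 1 / r)) := by
    unfold gridMesh
    field_simp
  have h2 : θ / (4 * (1 + 1 / r)) ≤ θ := by
    apply div_le_self hθ.le
    have : 0 < 1 / r := by positivity
    linarith
  have h3 : (0 : ℝ) ≤ gridSize d r θ := by positivity
  refine le_trans ?_ (h1.trans_le h2)
  push_cast
  nlinarith

theorem valueError_le (hr : 0 < r) (hθ : 0 < θ) (hθ1 : θ ≤ 1) : valueError d r θ ≤ θ := by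
  have h1 := gridMesh_mul_add_le (d := d) hr hθ
  have h2 : 0 ≤ gridMesh d r θ * (d * (gridSize d r θ + 1 : ℕ)) := by
    have := gridMesh_pos (d := d) hr hθ
    positivity
  have h3 : diffError d r θ ≤ 1 := by
    unfold diffError
    rw [div_le_one (by positivity)]
    have : (0 : ℝ) ≤ d := by positivity
    nlinarith
  have h4 := gridMesh_pos (d := d) hr hθ
  have h5 := diffError_pos (d := d) hr hθ
  unfold valueError
  nlinarith

end Parameters

/-- All requirements are met with the single precision `θ = 1/(H²(1 + A))`. The extra factor `1 + A`
compensates for iterates that stray up to order `AH` from `K`. The condition on `A` comes from the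
norm bound `2d/r` for the estimates, which gives `r(1 + 3D‖s‖) ≤ r + 6dD`. -/
theorem gridSubroutines_isGood (d : ℕ) {r D A : ℝ} (hr : 0 < r) (hD : 0 ≤ D)
    (hA : r + 6 * d * D ≤ A) : ∃ B : ℝ, 0 ≤ B ∧ ∀ K : Set (EuclideanSpace ℝ (Fin d)),
      Convex ℝ K → Metric.closedBall 0 r ⊆ K → ∀ H : ℕ, 1 ≤ H →
        (gridSubroutines d r A).IsGood K r D A B H := by
  have hA0 : 0 < A := lt_of_lt_of_le (by positivity) hA
  set B₀ : ℝ := 640 * (d + 1) ^ 3 * (1 + r) * (1 + 1 / r) ^ 2 / r with hB₀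
  have hB₀' : 0 < B₀ := by positivity
  set B₁ : ℝ := 1 + (2 * A + 1) * (B₀ * (1 + A) ^ 3) with hB₁
  have hB₁' : 1 ≤ B₁ := by
    have : 0 < (2 * A + 1) * (B₀ * (1 + A) ^ 3) := by positivity
    linarith
  have hlogB := Real.log_nonneg hB₁'
  refine ⟨(d + 1) * (2 * Real.log B₁ + 16), by positivity, fun K hK hball H hH => ?_⟩
  have hH' : (1 : ℝ) ≤ H := by exact_mod_cast hH
  have hlogH := Real.log_nonneg hH'
  obtain ⟨θ, hθdef⟩ : ∃ θ, θ = 1 / ((H : ℝ) ^ 2 * (1 + A)) := ⟨_, rfl⟩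
  have hθ : 0 < θ := by rw [hθdef]; positivity
  have hθH : θ ≤ 1 / (H : ℝ) ^ 2 := by
    rw [hθdef]
    apply one_div_le_one_div_of_le (by positivity)
    have : (0 : ℝ) < (H : ℝ) ^ 2 := by positivity
    nlinarith
  have hθ1 : θ ≤ 1 := by
    refine hθH.trans ?_
    rw [div_le_one (by positivity)]
    exact one_le_pow₀ hH'
  have hδ := valueError_pos (d := d) hr hθ
  have hδθ := valueError_le (d := d) hr hθ hθ1
  have hq := gridMesh_pos (d := d) hr hθ
  have hκ0 := diffError_pos (d := d) hr hθ
  have hκ : 2 * valueError d r θ / gridMesh d r θ = diffError d r θ := by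
    unfold valueError
    field_simp
  have hspec := fun y =>
    gridEstimate_spec hK hr hball hδ hq hκ (gridSize d r θ) (y := y)
  have hgrad1 := gradError_le (d := d) hr hθ
  have hgrad2 := gradError_le' (d := d) hr hθ hθ1
  have hκr := diffError_le (d := d) hr hθ hθ1
  have hmesh := gridMesh_mul_le (d := d) hr hθ
  have hmesh2 := gridMesh_mul_add_le (d := d) hr hθ
  set τ := 2 * (1 / r) / (gridSize d r θ + 1 : ℕ) + diffError d r θ with hτ
  have hτ0 : 0 < τ := by positivity
  have hsub : ∀ y u, gauge1 K y + ((gridSubroutines d r A).subgrad H y).expect (memOracle K)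
      (fun s => inner ℝ s (u - y)) - θ * (1 + ‖u - y‖) ≤ gauge1 K u := by
    intro y u
    have h1 := (hspec y).1 u
    have h2 : d * τ * ‖u - y‖ ≤ θ / 2 * ‖u - y‖ := by
      gcongr
      linarith
    have h3 := mul_nonneg hθ.le (norm_nonneg (u - y))
    simp only [gridSubroutines, ← hθdef]
    linarith
  have hX : ∀ y : EuclideanSpace ℝ (Fin d), ‖y‖ ≤ 2 * A * H →
      (‖y‖ + gridMesh d r θ * (d * (gridSize d r θ + 1 : ℕ)) + gridMesh d r θ) /
        (r * valueError d r θ) ≤ B₁ * (H : ℝ) ^ 7 := by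
    intro y hy
    have h1 := inv_valueError_le (d := d) hr hθ hθ1
    rw [← hB₀] at h1
    have h2 : 1 / θ = (H : ℝ) ^ 2 * (1 + A) := by rw [hθdef, one_div_one_div]
    rw [h2] at h1
    have h3 : ‖y‖ + gridMesh d r θ * (d * (gridSize d r θ + 1 : ℕ)) + gridMesh d r θ ≤
        (2 * A + 1) * H := by linarith
    -- One factor `H` comes from the norm bound, six from the cube of `1/θ = H²(1 + A)`.
    calc _ ≤ (2 * A + 1) * H * (1 / (r * valueError d r θ)) := by
          rw [← mul_one_div]
          gcongr
      _ ≤ (2 * A + 1) * H * (B₀ * ((H : ℝ) ^ 2 * (1 + A)) ^ 3) := by gcongr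
      _ = (2 * A + 1) * (B₀ * (1 + A) ^ 3) * (H : ℝ) ^ 7 := by ring
      _ ≤ _ := by
          gcongr
          linarith
  have hX1 : 1 ≤ B₁ * (H : ℝ) ^ 7 := one_le_mul_of_one_le_of_one_le hB₁' (one_le_pow₀ hH')
  have hlogX : Real.log (B₁ * (H : ℝ) ^ 7) = Real.log B₁ + 7 * Real.log H := by
    rw [Real.log_mul (by positivity) (by positivity), Real.log_pow]
    norm_num
  have hfin : 2 * Real.log (B₁ * (H : ℝ) ^ 7) + 2 ≤
      (2 * Real.log B₁ + 16) * (1 + Real.log H) := by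
    rw [hlogX]
    have := mul_nonneg hlogB hlogH
    linarith
  refine ⟨⟨fun y c hc => ?_, fun y u => ?_, fun y => ?_⟩, fun y u => ?_, fun y s hs => ?_,
    fun y hy => ?_, fun y hy => ?_⟩
  · simp only [gridSubroutines, ← hθdef] at hc
    obtain ⟨c', hc', h1, h2, h3⟩ := approxGauge_returns hK hr hball hδ y
    rw [hc'.1, Set.mem_singleton_iff] at hc
    subst hc
    exact ⟨h1, h2, h3.trans (hδθ.trans hθH)⟩
  · have h1 := hsub y u
    have h2 : θ * (1 + ‖u - y‖) ≤ 1 / (H : ℝ) ^ 2 * (1 + ‖u - y‖) := by gcongr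
    linarith
  · refine (by simpa only [gridSubroutines, ← hθdef] using (hspec y).2.1 :
      _ ≤ (1 / r) ^ 2 + d * (τ * (2 * (1 / r) + diffError d r θ))).trans ?_
    have h1 : d * τ ≤ 3 / 8 * (1 / r) := by linarith
    -- The excess is at most `3/8 · 19/8 = 57/64 < 1` times `1/r²`, so the second moment stays below
    -- `2/r²`.
    have h2 : (d : ℝ) * (τ * (2 * (1 / r) + diffError d r θ)) ≤
        3 / 8 * (1 / r) * (2 * (1 / r) + 3 / 8 * (1 / r)) := by
      rw [← mul_assoc]
      gcongr
    have h3 : 2 / r ^ 2 = (1 / r) ^ 2 + (1 / r) ^ 2 := by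
      field_simp
      norm_num
    have h4 := sq_nonneg (1 / r)
    rw [h3]
    linarith
  · rw [← hθdef]
    exact hsub y u
  · have h1 := (hspec y).2.2 s (by simpa only [gridSubroutines, ← hθdef] using hs)
    have h2 : ‖s‖ ≤ d * (2 / r) := by
      refine h1.trans ?_
      gcongr
      have : 2 / r = 1 / r + 1 / r := by ring
      have : 0 < 1 / r := by positivity
      linarith
    refine le_trans ?_ hA
    calc r * (1 + 3 * D * ‖s‖) ≤ r * (1 + 3 * D * (d * (2 / r))) := by gcongr
      _ = _ := by
        field_simp
        ring
  · have h1 : ‖y‖ / (r * valueError d r θ) ≤ B₁ * (H : ℝ) ^ 7 := by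
      refine le_trans ?_ (hX y hy)
      gcongr
      have : 0 ≤ gridMesh d r θ * (d * (gridSize d r θ + 1 : ℕ)) := by positivity
      linarith
    simp only [gridSubroutines, ← hθdef, maxCalls_approxGauge]
    refine (bisectSteps_le hX1 h1).trans (hfin.trans ?_)
    have h2 : (0 : ℝ) ≤ (2 * Real.log B₁ + 16) * (1 + Real.log H) := by positivity
    rw [mul_assoc]
    exact le_mul_of_one_le_left h2 (by linarith [d.cast_nonneg (α := ℝ)])
  · simp only [gridSubroutines, ← hθdef]
    refine (maxCalls_gridEstimate_le hr hδ hq hX1 (hX y hy)).trans ?_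
    rw [mul_assoc]
    gcongr

end ProjFree

namespace ProjFree

open OracleComp

/-! ### Lists -/

theorem exists_find?_of_forall₂ {α κ : Type} [DecidableEq κ] {R : α → α → Prop} {key : α → κ}
    (hkey : ∀ a b, R a b → key b = key a) {i : κ} {l bs : List α} (h : List.Forall₂ R l bs) {a : α}
    (ha : l.find? (fun b => decide (key b = i)) = some a) :
    ∃ b, bs.find? (fun b => decide (key b = i)) = some b ∧ R a b := by
  induction h with
  | nil => simp at ha
  | @cons a' b' _ _ hab _ ih =>
    by_cases h1 : key a' = i
    · simp only [List.find?_cons, h1, decide_true, Option.some.injEq] at ha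
      subst ha
      exact ⟨b', by simp [hkey _ _ hab, h1], hab⟩
    · simp only [List.find?_cons, h1, decide_false] at ha
      obtain ⟨b, hb, hR⟩ := ih ha
      exact ⟨b, by simp [hkey _ _ hab, h1, hb], hR⟩

theorem exists_left_of_forall₂ {α β : Type} {R : α → β → Prop} {l : List α} {bs : List β}
    (h : List.Forall₂ R l bs) {b : β} (hb : b ∈ bs) : ∃ a ∈ l, R a b := by
  induction h with
  | nil => simp at hb
  | cons hab _ ih =>
    rcases List.mem_cons.1 hb with rfl | hb
    · exact ⟨_, List.mem_cons_self, hab⟩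
    · obtain ⟨a, ha, hR⟩ := ih hb
      exact ⟨a, List.mem_cons_of_mem _ ha, hR⟩

theorem map_eq_map_of_forall₂ {α β γ : Type} {R : α → β → Prop} {f : α → γ} {g : β → γ}
    (hfg : ∀ a b, R a b → g b = f a) {l : List α} {bs : List β} (h : List.Forall₂ R l bs) :
    bs.map g = l.map f := by
  induction h with
  | nil => rfl
  | cons hab _ ih => rw [List.map_cons, List.map_cons, hfg _ _ hab, ih]

/-- First entries with distinct keys are distinct entries of the list, and the other entries
contribute nonnegative terms. It bounds the weights of selected experts by the full potential. -/
theorem sum_find?_le {α κ : Type} [DecidableEq κ] {key : α → κ} {g : α → ℝ} (a₀ : α)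
    {l : List α} (hg : ∀ a ∈ l, 0 ≤ g a) (S : Finset κ)
    (hS : ∀ i ∈ S, (l.find? fun b => decide (key b = i)).isSome) :
    ∑ i ∈ S, g ((l.find? fun b => decide (key b = i)).getD a₀) ≤ (l.map g).sum := by
  induction l generalizing S with
  | nil =>
    have : S = ∅ := Finset.eq_empty_of_forall_notMem fun i hi => by simpa using hS i hi
    simp [this]
  | cons a l ih =>
    have hg' : ∀ b ∈ l, 0 ≤ g b := fun b hb => hg b (List.mem_cons_of_mem _ hb)
    have hne : ∀ i ∈ S.erase (key a), ((a :: l).find? fun b => decide (key b = i)) =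
        l.find? fun b => decide (key b = i) := by
      intro i hi
      simp [(Finset.ne_of_mem_erase hi).symm]
    have h1 := ih hg' (S.erase (key a)) fun i hi => by
      rw [← hne i hi]
      exact hS i (Finset.mem_of_mem_erase hi)
    rw [List.map_cons, List.sum_cons]
    have h2 : ∑ i ∈ S.erase (key a), g (((a :: l).find? fun b => decide (key b = i)).getD a₀) ≤
        (l.map g).sum := by
      rw [Finset.sum_congr rfl fun i hi => by rw [hne i hi]]
      exact h1
    have h3 := hg a List.mem_cons_self
    by_cases ha : key a ∈ S
    · rw [← Finset.add_sum_erase _ _ ha]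
      simp only [List.find?_cons, decide_true, Option.getD_some] at h2 ⊢
      linarith
    · rw [Finset.erase_eq_of_notMem ha] at h2
      linarith

/-! ### The sequence of states -/

section Trace

variable {E : Type} [NormedAddCommGroup E] [InnerProductSpace ℝ E] {sub : Subroutines E}
  {p : Params E} {adv : Adversary E} {O : E → Bool}

/-- The algorithm with a record of the states after all rounds so far. -/
noncomputable def trace (sub : Subroutines E) (p : Params E) (adv : Adversary E) :
    ℕ → OracleComp E (ℕ → State E)
  | 0 => .pure fun _ => initState p
  | n + 1 => (trace sub p adv n).bind fun h =>
      (round sub p adv (n + 1) (h n)).bind fun σ => .pure (Function.update h (n + 1) σ)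

theorem expect_run (n : ℕ) (F : State E → ℝ) :
    (run sub p adv n).expect O F = (trace sub p adv n).expect O fun h => F (h n) := by
  induction n generalizing F with
  | zero => rfl
  | succ n ih => simp only [run, trace, expect_bind, ih, expect_pure, Function.update_self]

theorem exists_trace_of_mem_support_run {n : ℕ} {σ : State E}
    (hσ : σ ∈ (run sub p adv n).support O) : ∃ h ∈ (trace sub p adv n).support O, h n = σ := by
  induction n generalizing σ with
  | zero => exact ⟨fun _ => initState p, rfl, (mem_support_pure.1 hσ).symm⟩
  | succ n ih =>
    simp only [run, mem_support_bind] at hσ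
    obtain ⟨τ, hτ, hσ⟩ := hσ
    obtain ⟨h, hh, rfl⟩ := ih hτ
    refine ⟨Function.update h (n + 1) σ, ?_, by simp⟩
    simp only [trace, mem_support_bind, mem_support_pure]
    exact ⟨h, hh, σ, hσ, rfl⟩

theorem trace_zero_of_mem_support {n : ℕ} {h : ℕ → State E}
    (hh : h ∈ (trace sub p adv n).support O) : h 0 = initState p := by
  induction n generalizing h with
  | zero => rw [mem_support_pure.1 hh]
  | succ n ih =>
    simp only [trace, mem_support_bind, mem_support_pure] at hh
    obtain ⟨g, hg, σ, -, rfl⟩ := hh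
    simp [ih hg]

theorem trace_succ_of_mem_support {n : ℕ} {h : ℕ → State E}
    (hh : h ∈ (trace sub p adv n).support O) {i : ℕ} (hi : i < n) :
    h (i + 1) ∈ (round sub p adv (i + 1) (h i)).support O := by
  induction n generalizing h with
  | zero => omega
  | succ n ih =>
    simp only [trace, mem_support_bind, mem_support_pure] at hh
    obtain ⟨g, hg, σ, hσ, rfl⟩ := hh
    rcases Nat.lt_succ_iff_lt_or_eq.1 hi with hi' | rfl
    · rw [Function.update_of_ne (by omega), Function.update_of_ne (by omega)]
      exact ih hg hi'
    · rw [Function.update_self, Function.update_of_ne (by omega)]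
      exact hσ

/-- A functional that ignores all states after round `m` does not notice the later rounds. Together
with the conditioning lemma below it plays the role of a filtration. -/
theorem expect_trace_of_le {m n : ℕ} (hmn : m ≤ n) {F : (ℕ → State E) → ℝ}
    (hF : ∀ h j σ, m < j → F (Function.update h j σ) = F h) :
    (trace sub p adv n).expect O F = (trace sub p adv m).expect O F := by
  induction n, hmn using Nat.le_induction with
  | base => rfl
  | succ n hn ih =>
    simp only [trace, expect_bind, expect_pure]
    rw [← ih]
    refine expect_congr fun h _ => ?_
    simp only [hF h (n + 1) _ (by omega), expect_const]

/-- Conditioning on the first `i` rounds. -/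
theorem expect_trace_succ {i n : ℕ} (hi : i < n) {Φ : (ℕ → State E) → State E → ℝ}
    (hΦ : ∀ h j τ σ, i < j → Φ (Function.update h j τ) σ = Φ h σ) :
    (trace sub p adv n).expect O (fun h => Φ h (h (i + 1))) =
      (trace sub p adv n).expect O fun h =>
        (round sub p adv (i + 1) (h i)).expect O (Φ h) := by
  rw [expect_trace_of_le (m := i + 1) hi, expect_trace_of_le (m := i) (n := n) hi.le]
  · simp only [trace, expect_bind, expect_pure, Function.update_self]
    exact expect_congr fun h _ => expect_congr fun σ _ => hΦ h _ _ _ (Nat.lt_succ_self i)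
  · intro h j σ hj
    rw [Function.update_of_ne (by omega)]
    congr 1
    ext τ
    exact hΦ h j σ τ hj
  · intro h j σ hj
    rw [Function.update_of_ne (by omega)]
    exact hΦ h j σ _ (by omega)

end Trace

/-! ### Single experts -/

/-- The identity of an expert. -/
def Expert.key {E : Type} (e : Expert E) : ℕ × ℕ := (e.birth, e.lvl)

/-- Newborn experts are appended behind the survivors, so they cannot hide the record of an expert
that stays active. -/
theorem find?_filter_append {E : Type} {es l : List (Expert E)} {q : Expert E → Bool} {κ : ℕ × ℕ}
    {e : Expert E} (hq : ∀ e, e.key = κ → q e = true)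
    (he : es.find? (fun e => decide (e.key = κ)) = some e) :
    (es.filter q ++ l).find? (fun e => decide (e.key = κ)) = some e := by
  rw [List.find?_append, List.find?_filter]
  have : (fun e : Expert E => decide (q e = true ∧ decide (e.key = κ) = true)) =
      fun e => decide (e.key = κ) := by
    ext e
    by_cases h : e.key = κ
    · simp [h, hq e h]
    · simp [h]
  rw [this, he]
  rfl

theorem alive_of_key_eq {E : Type} {ε : ℝ} {t : ℕ} {κ : ℕ × ℕ} (hκ : t + 1 < κ.1 + 4 * len ε κ.2)
    (e : Expert E) (he : e.key = κ) : t + 1 < e.birth + 4 * len ε e.lvl := by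
  subst he
  exact hκ

section Experts

variable {E : Type} [NormedAddCommGroup E] [InnerProductSpace ℝ E] {sub : Subroutines E}
  {p : Params E} {adv : Adversary E} {O : E → Bool}

/-- The record of the expert with identity `κ`. -/
noncomputable def State.find? (σ : State E) (κ : ℕ × ℕ) : Option (Expert E) :=
  σ.experts.find? fun e => decide (e.key = κ)

/-- The record of the expert with identity `κ`, with a junk value if it is not active. -/
noncomputable def State.expert (σ : State E) (κ : ℕ × ℕ) : Expert E :=
  (σ.find? κ).getD ⟨0, 0, 0, 0, 0⟩

/-- The loss of the round that follows the state `σ`. -/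
noncomputable def State.loss (adv : Adversary E) (σ : State E) : Loss E :=
  adv (σ.plays ++ [playPoint σ.experts])

/-- The step size of an expert at level `k`. -/
noncomputable def stepSize (p : Params E) (k : ℕ) : ℝ := p.r / (2 * √(len p.ε k) * p.G)

/-- The point to which an expert moves from `y` if `s` is the estimated subgradient. -/
noncomputable def nextPoint (p : Params E) (k : ℕ) (f : Loss E) (y s : E) : E :=
  y - stepSize p k • (f.grad y + (3 * p.G * p.D) • s)

/-- The weight factor of an expert. -/
noncomputable def weightFactor (p : Params E) (k : ℕ) (f : Loss E) (x x' : E) : ℝ :=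
  1 + rate p.ε p.T k * ((f.val x - f.val x') / (p.G * p.D))

theorem mem_support_updateExpert {x : E} {f : Loss E} {e e' : Expert E}
    (h : e' ∈ (updateExpert sub p x f e).support O) :
    ∃ s ∈ (sub.subgrad (4 * len p.ε e.lvl) e.y).support O,
      ∃ c ∈ (sub.value (4 * len p.ε e.lvl) (nextPoint p e.lvl f e.y s)).support O,
        e' = ⟨e.birth, e.lvl, c⁻¹ • nextPoint p e.lvl f e.y s, nextPoint p e.lvl f e.y s,
          e.w * weightFactor p e.lvl f x e.x⟩ := by
  simp only [updateExpert, baseStep, mem_support_bind, mem_support_pure] at h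
  obtain ⟨z, ⟨s, hs, c, hc, rfl⟩, rfl⟩ := h
  exact ⟨s, hs, c, hc, rfl⟩

theorem key_of_mem_support_updateExpert {x : E} {f : Loss E} {e e' : Expert E}
    (h : e' ∈ (updateExpert sub p x f e).support O) : e'.key = e.key := by
  obtain ⟨s, -, c, -, rfl⟩ := mem_support_updateExpert h
  rfl

theorem expect_updateExpert_y {x : E} {f : Loss E} {e : Expert E} (F : E → ℝ) :
    (updateExpert sub p x f e).expect O (fun e' => F e'.y) =
      (sub.subgrad (4 * len p.ε e.lvl) e.y).expect O fun s => F (nextPoint p e.lvl f e.y s) := by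
  simp only [updateExpert, baseStep, expect_bind, expect_pure, expect_const]
  rfl

open Classical in
theorem mem_support_round {t : ℕ} {σ σ' : State E}
    (h : σ' ∈ (round sub p adv t σ).support O) :
    ∃ es, List.Forall₂ (fun e e' =>
        e' ∈ (updateExpert sub p (playPoint σ.experts) (σ.loss adv) e).support O) σ.experts es ∧
      σ' = ⟨(es.filter fun e => decide (t + 1 < e.birth + 4 * len p.ε e.lvl)) ++ spawn p (t + 1),
        σ.plays ++ [playPoint σ.experts]⟩ := by
  simp only [round, mem_support_bind, mem_support_pure] at h
  obtain ⟨es, hes, rfl⟩ := h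
  exact ⟨es, forall₂_of_mem_support_traverse hes, rfl⟩

theorem find?_of_mem_support_round {t : ℕ} {σ σ' : State E}
    (h : σ' ∈ (round sub p adv t σ).support O) {κ : ℕ × ℕ}
    (hκ : t + 1 < κ.1 + 4 * len p.ε κ.2) {e : Expert E} (he : σ.find? κ = some e) :
    ∃ e', σ'.find? κ = some e' ∧
      e' ∈ (updateExpert sub p (playPoint σ.experts) (σ.loss adv) e).support O := by
  obtain ⟨es, hes, rfl⟩ := mem_support_round h
  unfold State.find? at he
  obtain ⟨e', he', h'⟩ := exists_find?_of_forall₂ (key := Expert.key) (i := κ)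
    (fun _ _ => key_of_mem_support_updateExpert) hes he
  refine ⟨e', ?_, h'⟩
  unfold State.find?
  exact find?_filter_append (fun e h => decide_eq_true (alive_of_key_eq hκ e h)) he'

/-- The law of the next record of an expert that stays active. -/
theorem expect_round_expert {t : ℕ} {σ : State E} {κ : ℕ × ℕ}
    (hκ : t + 1 < κ.1 + 4 * len p.ε κ.2) {e : Expert E} (he : σ.find? κ = some e)
    (F : Expert E → ℝ) :
    (round sub p adv t σ).expect O (fun σ' => F (σ'.expert κ)) =
      (updateExpert sub p (playPoint σ.experts) (σ.loss adv) e).expect O F := by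
  have h1 := expect_traverse_find? (O := O)
    (f := updateExpert sub p (playPoint σ.experts) (σ.loss adv)) (key := Expert.key)
    (fun a b hb => key_of_mem_support_updateExpert hb) σ.experts κ
    fun o => F (o.getD ⟨0, 0, 0, 0, 0⟩)
  unfold State.find? at he
  rw [he] at h1
  simp only [Option.getD_some] at h1
  rw [← h1]
  simp only [round, expect_bind, expect_pure]
  refine expect_congr fun es hes => ?_
  obtain ⟨e', he', -⟩ := exists_find?_of_forall₂ (key := Expert.key) (i := κ)
    (fun _ _ => key_of_mem_support_updateExpert) (forall₂_of_mem_support_traverse hes) he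
  unfold State.expert State.find?
  dsimp only
  rw [he', find?_filter_append (fun e h => decide_eq_true (alive_of_key_eq hκ e h)) he']

end Experts

end ProjFree

namespace ProjFree

open OracleComp

/-! ### Standing assumptions and the invariants of all reachable states. -/

section Invariants

variable {E : Type} [NormedAddCommGroup E] [InnerProductSpace ℝ E]

/-- The standing assumptions of the analysis. -/
structure Setting (sub : Subroutines E) (p : Params E) (adv : Adversary E) (K : Set E)
    (A B : ℝ) : Prop where
  convex : Convex ℝ K
  r_pos : 0 < p.r
  ball : Metric.closedBall 0 p.r ⊆ K
  diam : ∀ x ∈ K, ∀ y ∈ K, dist x y ≤ p.D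
  one_le_D : 1 ≤ p.D
  one_le_G : 1 ≤ p.G
  eps_pos : 0 < p.ε
  three_le_T : 3 ≤ p.T
  x₁_mem : p.x₁ ∈ K
  y₁_mem : p.y₁ ∈ K
  admissible : ∀ h, (adv h).IsAdmissible K p.G
  good : ∀ H : ℕ, 1 ≤ H → sub.IsGood K p.r p.D A B H
  D_le : p.D ≤ A

theorem one_le_len (ε : ℝ) (k : ℕ) : 1 ≤ len ε k := Nat.le_add_left _ _

theorem len_pos (ε : ℝ) (k : ℕ) : (0 : ℝ) < len ε k := by exact_mod_cast one_le_len ε k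

theorem rate_pos {T : ℕ} (hT : 3 ≤ T) (ε : ℝ) (k : ℕ) : 0 < rate ε T k := by
  have h1 : (1 : ℝ) < T := by exact_mod_cast (by omega : 1 < T)
  have h2 := len_pos ε k
  have h3 := Real.log_pos h1
  exact lt_min (by norm_num) (Real.sqrt_pos.2 (by positivity))

theorem rate_le_half (ε : ℝ) (T k : ℕ) : rate ε T k ≤ 1 / 2 := min_le_left _ _

theorem nodup_levels (ε : ℝ) (T : ℕ) : (levels ε T).Nodup := List.nodup_range.filter _

theorem mem_spawn {E : Type} {p : Params E} {j : ℕ} {e : Expert E} :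
    e ∈ spawn p j ↔ ∃ k ∈ levels p.ε p.T, len p.ε k ∣ j - 1 ∧
      e = ⟨j, k, p.x₁, p.y₁, rate p.ε p.T k⟩ := by
  simp only [spawn, List.mem_map, List.mem_filter, decide_eq_true_eq, and_assoc, @eq_comm _ _ e]

theorem length_spawn_le {E : Type} (p : Params E) (j : ℕ) : (spawn p j).length ≤ (levels p.ε p.T).length := by
  simp only [spawn, List.length_map]
  exact List.length_filter_le _ _

theorem nodup_spawn_keys {E : Type} (p : Params E) (j : ℕ) : ((spawn p j).map Expert.key).Nodup := by
  simp only [spawn, List.map_map]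
  refine ((nodup_levels p.ε p.T).filter _).map fun k k' h => ?_
  simpa [Expert.key] using h

theorem playPoint_eq (es : List (Expert E)) :
    playPoint es = (es.map fun e => e.w).sum⁻¹ • (es.map fun e => e.w • e.x).sum := by
  rw [playPoint, List.smul_sum, List.map_map]
  congr 1
  refine List.map_congr_left fun e _ => ?_
  simp [smul_smul, div_eq_inv_mul]

theorem sum_weights_pos {E : Type} {es : List (Expert E)} (hes : es ≠ []) (hw : ∀ e ∈ es, 0 < e.w) :
    0 < (es.map fun e => e.w).sum := by
  refine List.sum_pos _ (fun w h => ?_) (by simpa)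
  obtain ⟨e, he, rfl⟩ := List.mem_map.1 h
  exact hw e he

theorem playPoint_mem {K : Set E} (hK : Convex ℝ K) (h0 : (0 : E) ∈ K) {es : List (Expert E)}
    (hw : ∀ e ∈ es, 0 < e.w) (hx : ∀ e ∈ es, e.x ∈ K) : playPoint es ∈ K := by
  rw [playPoint_eq]
  induction es with
  | nil => simpa
  | cons e es ih =>
    have hw0 := hw e List.mem_cons_self
    have hx0 : e.w⁻¹ • e.w • e.x ∈ K := by
      rw [smul_smul, inv_mul_cancel₀ hw0.ne', one_smul]
      exact hx e List.mem_cons_self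
    rw [List.map_cons, List.map_cons, List.sum_cons, List.sum_cons]
    by_cases hes : es = []
    · subst hes
      simpa using hx0
    have hw' : ∀ e ∈ es, 0 < e.w := fun a ha => hw a (List.mem_cons_of_mem _ ha)
    exact combo_inv_smul_mem hK hw0 (sum_weights_pos hes hw') hx0
      (ih hw' fun a ha => hx a (List.mem_cons_of_mem _ ha))

/-- The played point does at least as well as the average expert. -/
theorem sum_weight_mul_sub_le {f : Loss E} {K : Set E} {G : ℝ} (hf : f.IsAdmissible K G)
    {es : List (Expert E)} (hw : ∀ e ∈ es, 0 < e.w) :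
    (es.map fun e => e.w * (f.val (playPoint es) - f.val e.x)).sum ≤ 0 := by
  rcases eq_or_ne es [] with rfl | hes
  · simp
  have hW := sum_weights_pos hes hw
  set x := playPoint es with hx
  have h1 : (es.map fun e => e.w * (f.val x - f.val e.x)).sum ≤
      (es.map fun e => inner ℝ (f.grad x) (e.w • (x - e.x))).sum := by
    refine List.sum_le_sum fun e he => ?_
    have h := hf.subgradient x e.x
    rw [← neg_sub x e.x, inner_neg_right] at h
    rw [real_inner_smul_right]
    exact mul_le_mul_of_nonneg_left (by linarith) (hw e he).le
  refine h1.trans_eq ?_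
  have h2 : ∀ l : List (Expert E), (l.map fun e => inner ℝ (f.grad x) (e.w • (x - e.x))).sum =
      inner ℝ (f.grad x) ((l.map fun e => e.w).sum • x - (l.map fun e => e.w • e.x).sum) := by
    intro l
    induction l with
    | nil => simp
    | cons e l ih =>
      simp only [List.map_cons, List.sum_cons, ih, ← inner_add_right]
      congr 1
      module
  -- The weighted deviations from the weighted mean sum to zero.
  rw [h2, hx, playPoint_eq, smul_smul, mul_inv_cancel₀ hW.ne', one_smul, sub_self,
    inner_zero_right]

variable {sub : Subroutines E} {p : Params E} {adv : Adversary E} {K : Set E} {A B : ℝ}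

namespace Setting

theorem zero_mem (S : Setting sub p adv K A B) : (0 : E) ∈ K :=
  S.ball (by simp [S.r_pos.le])

theorem D_pos (S : Setting sub p adv K A B) : 0 < p.D := by linarith [S.one_le_D]

theorem G_pos (S : Setting sub p adv K A B) : 0 < p.G := by linarith [S.one_le_G]

theorem A_pos (S : Setting sub p adv K A B) : 0 < A := S.D_pos.trans_le S.D_le

theorem norm_sub_le (S : Setting sub p adv K A B) {x y : E} (hx : x ∈ K) (hy : y ∈ K) :
    ‖x - y‖ ≤ p.D := by
  rw [← dist_eq_norm]
  exact S.diam x hx y hy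

theorem norm_le (S : Setting sub p adv K A B) {x : E} (hx : x ∈ K) : ‖x‖ ≤ p.D := by
  simpa using S.norm_sub_le hx S.zero_mem

theorem loss_sub_le (S : Setting sub p adv K A B) (h : List E) {x y : E} (hx : x ∈ K)
    (hy : y ∈ K) : |(adv h).val x - (adv h).val y| ≤ p.G * p.D :=
  ((S.admissible h).lipschitz x y).trans
    (mul_le_mul_of_nonneg_left (S.norm_sub_le hx hy) S.G_pos.le)

theorem norm_grad_le (S : Setting sub p adv K A B) (h : List E) (y : E) :
    ‖(adv h).grad y‖ ≤ p.G :=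
  norm_le_of_subgradient S.G_pos.le (S.admissible h).lipschitz ((S.admissible h).subgradient y)

theorem abs_scaled_loss_le (S : Setting sub p adv K A B) (h : List E) {x y : E} (hx : x ∈ K)
    (hy : y ∈ K) : |((adv h).val x - (adv h).val y) / (p.G * p.D)| ≤ 1 := by
  have hGD : 0 < p.G * p.D := mul_pos S.G_pos S.D_pos
  rw [abs_div, abs_of_pos hGD, div_le_one hGD]
  exact S.loss_sub_le h hx hy

theorem weightFactor_pos (S : Setting sub p adv K A B) (h : List E) {x y : E} (hx : x ∈ K)
    (hy : y ∈ K) (k : ℕ) : 0 < weightFactor p k (adv h) x y := by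
  have h1 := abs_le.1 (S.abs_scaled_loss_le h hx hy)
  have h2 := rate_pos S.three_le_T p.ε k
  have h3 := rate_le_half p.ε p.T k
  unfold weightFactor
  nlinarith

theorem stepSize_pos (S : Setting sub p adv K A B) (k : ℕ) : 0 < stepSize p k := by
  have := S.r_pos
  have := S.G_pos
  have := len_pos p.ε k
  unfold stepSize
  positivity

/-- The step size turns the gradient bound `G(1 + 3D‖s‖)` into `r(1 + 3D‖s‖)/(2√l)`, in which `G`
has cancelled. Hence the speed, and with it the precision needed, depends on neither `G` nor the
level. -/
theorem norm_nextPoint_sub_le (S : Setting sub p adv K A B) (k : ℕ) (h : List E) {y s : E}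
    (hs : s ∈ (sub.subgrad (4 * len p.ε k) y).support (memOracle K)) :
    ‖nextPoint p k (adv h) y s - y‖ ≤ A := by
  have hl : (1 : ℝ) ≤ √(len p.ε k) := Real.one_le_sqrt.2 (by exact_mod_cast one_le_len p.ε k)
  have hlen := one_le_len p.ε k
  have h1 := (S.good (4 * len p.ε k) (by omega)).norm_le y s hs
  have hG := S.G_pos
  have hD := S.D_pos
  have hr := S.r_pos
  rw [nextPoint, sub_sub_cancel_left, norm_neg, norm_smul,
    Real.norm_of_nonneg (S.stepSize_pos k).le]
  have h2 : ‖(adv h).grad y + (3 * p.G * p.D) • s‖ ≤ p.G + 3 * p.G * p.D * ‖s‖ := by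
    refine (norm_add_le _ _).trans (add_le_add (S.norm_grad_le h y) ?_)
    rw [norm_smul, Real.norm_of_nonneg (by positivity)]
  calc _ ≤ stepSize p k * (p.G + 3 * p.G * p.D * ‖s‖) := by
        gcongr
        exact (S.stepSize_pos k).le
    _ = p.r * (1 + 3 * p.D * ‖s‖) / (2 * √(len p.ε k)) := by
        unfold stepSize
        field_simp
    _ ≤ p.r * (1 + 3 * p.D * ‖s‖) := by
        apply div_le_self (by positivity)
        linarith
    _ ≤ A := h1

end Setting

/-- What holds for all states after `i` rounds. -/
structure StateInv (p : Params E) (K : Set E) (A : ℝ) (i : ℕ) (σ : State E) : Prop where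
  one_le_birth : ∀ e ∈ σ.experts, 1 ≤ e.birth
  birth_le : ∀ e ∈ σ.experts, e.birth ≤ i + 1
  alive : ∀ e ∈ σ.experts, i + 1 < e.birth + 4 * len p.ε e.lvl
  lvl_mem : ∀ e ∈ σ.experts, e.lvl ∈ levels p.ε p.T
  dvd : ∀ e ∈ σ.experts, len p.ε e.lvl ∣ e.birth - 1
  w_pos : ∀ e ∈ σ.experts, 0 < e.w
  x_mem : ∀ e ∈ σ.experts, e.x ∈ K
  norm_y_le : ∀ e ∈ σ.experts, ‖e.y‖ ≤ p.D + ((i : ℝ) + 1 - e.birth) * A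
  nodup : (σ.experts.map Expert.key).Nodup
  plays_mem : ∀ x ∈ σ.plays, x ∈ K
  plays_length : σ.plays.length = i

theorem StateInv.playPoint_mem {i : ℕ} {σ : State E} (h : StateInv p K A i σ) (hK : Convex ℝ K)
    (h0 : (0 : E) ∈ K) : playPoint σ.experts ∈ K :=
  ProjFree.playPoint_mem hK h0 h.w_pos h.x_mem

namespace Setting

theorem stateInv_init (S : Setting sub p adv K A B) : StateInv p K A 0 (initState p) := by
  have hl := fun k => one_le_len p.ε k
  constructor
  case nodup => exact nodup_spawn_keys p 1
  case plays_mem => simp [initState]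
  case plays_length => rfl
  all_goals
    intro e he
    obtain ⟨k, hk, hdvd, rfl⟩ := mem_spawn.1 he
  · exact le_rfl
  · exact le_rfl
  · have := hl k
    simp only
    omega
  · exact hk
  · exact hdvd
  · exact rate_pos S.three_le_T _ _
  · exact S.x₁_mem
  · simpa using S.norm_le S.y₁_mem

theorem stateInv_round (S : Setting sub p adv K A B) {i : ℕ} {σ σ' : State E}
    (hσ : StateInv p K A i σ)
    (h : σ' ∈ (round sub p adv (i + 1) σ).support (memOracle K)) : StateInv p K A (i + 1) σ' := by
  obtain ⟨es, hes, rfl⟩ := mem_support_round h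
  have hx := hσ.playPoint_mem S.convex S.zero_mem
  have hkeys : es.map Expert.key = σ.experts.map Expert.key :=
    map_eq_map_of_forall₂ (fun a b hab => key_of_mem_support_updateExpert hab) hes
  have hmem : ∀ e' ∈ es, ∃ e ∈ σ.experts, e'.birth = e.birth ∧ e'.lvl = e.lvl ∧ 0 < e'.w ∧
      e'.x ∈ K ∧ ‖e'.y‖ ≤ ‖e.y‖ + A := by
    intro e' he'
    obtain ⟨e, he, hee⟩ := exists_left_of_forall₂ hes he'
    obtain ⟨s, hs, c, hc, rfl⟩ := mem_support_updateExpert hee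
    have hlen := one_le_len p.ε e.lvl
    refine ⟨e, he, rfl, rfl, mul_pos (hσ.w_pos e he)
      (S.weightFactor_pos _ hx (hσ.x_mem e he) _),
      ((S.good _ (by omega)).approx.value_spec _ c hc).2.1, ?_⟩
    have h1 := S.norm_nextPoint_sub_le e.lvl (σ.plays ++ [playPoint σ.experts]) hs
    have h2 := norm_le_norm_add_norm_sub'
      (nextPoint p e.lvl (σ.loss adv) e.y s) e.y
    unfold State.loss at h2 ⊢
    linarith
  have hbirth : ∀ e' ∈ es, 1 ≤ e'.birth ∧ e'.birth ≤ i + 1 := by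
    intro e' he'
    obtain ⟨e, he, h1, -⟩ := hmem e' he'
    rw [h1]
    exact ⟨hσ.one_le_birth e he, hσ.birth_le e he⟩
  constructor
  case nodup =>
    simp only [List.map_append]
    rw [List.nodup_append]
    refine ⟨(hkeys ▸ hσ.nodup).sublist ((List.filter_sublist).map _), nodup_spawn_keys p _,
      fun a ha b hb hab => ?_⟩
    obtain ⟨e, he, rfl⟩ := List.mem_map.1 ha
    obtain ⟨e', he', rfl⟩ := List.mem_map.1 hb
    obtain ⟨k, hk, hdvd, rfl⟩ := mem_spawn.1 he'
    have h1 := (hbirth e (List.mem_filter.1 he).1).2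
    have h2 : e.birth = i + 1 + 1 := congrArg Prod.fst hab
    omega
  case plays_mem =>
    intro x hx'
    rcases List.mem_append.1 hx' with hx' | hx'
    · exact hσ.plays_mem x hx'
    · rw [List.mem_singleton.1 hx']
      exact hx
  case plays_length => simp [hσ.plays_length]
  -- Every remaining field splits into two goals, first for a surviving expert and then for a
  -- newborn one; the bullets below alternate accordingly.
  all_goals
    intro e' he'
    rcases List.mem_append.1 he' with he' | he'
    on_goal 1 =>
      obtain ⟨he', halive⟩ := List.mem_filter.1 he'
      obtain ⟨e, he, h1, h2, h3, h4, h5⟩ := hmem e' he'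
    on_goal 2 => obtain ⟨k, hk, hdvd, rfl⟩ := mem_spawn.1 he'
  · rw [h1]
    exact hσ.one_le_birth e he
  · simp only
    omega
  · have := hσ.birth_le e he
    omega
  · exact le_rfl
  · simpa using halive
  · have := one_le_len p.ε k
    simp only
    omega
  · rw [h2]
    exact hσ.lvl_mem e he
  · exact hk
  · rw [h1, h2]
    exact hσ.dvd e he
  · exact hdvd
  · exact h3
  · exact rate_pos S.three_le_T _ _
  · exact h4
  · exact S.x₁_mem
  · have h6 := hσ.norm_y_le e he
    rw [h1]
    push_cast
    linarith
  · have h6 := S.norm_le S.y₁_mem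
    simpa using h6

theorem stateInv_trace (S : Setting sub p adv K A B) {n : ℕ} {h : ℕ → State E}
    (hh : h ∈ (trace sub p adv n).support (memOracle K)) {i : ℕ} (hi : i ≤ n) :
    StateInv p K A i (h i) := by
  induction i with
  | zero =>
    rw [trace_zero_of_mem_support hh]
    exact S.stateInv_init
  | succ i ih => exact S.stateInv_round (ih (by omega)) (trace_succ_of_mem_support hh (by omega))

theorem plays_trace (_S : Setting sub p adv K A B) {n : ℕ} {h : ℕ → State E}
    (hh : h ∈ (trace sub p adv n).support (memOracle K)) {i : ℕ} (hi : i < n) :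
    (h (i + 1)).plays = (h i).plays ++ [playPoint (h i).experts] := by
  obtain ⟨es, -, h2⟩ := mem_support_round (trace_succ_of_mem_support hh hi)
  rw [h2]

end Setting

end Invariants

end ProjFree

namespace ProjFree

open OracleComp

section Meta

variable {E : Type} [NormedAddCommGroup E] [InnerProductSpace ℝ E] {sub : Subroutines E}
  {p : Params E} {adv : Adversary E} {K : Set E} {A B : ℝ}

/-! ### The life of an expert -/

theorem State.mem_of_find? {E : Type} {σ : State E} {κ : ℕ × ℕ} {e : Expert E}
    (h : σ.find? κ = some e) : e ∈ σ.experts ∧ e.key = κ :=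
  ⟨List.mem_of_find?_eq_some h, by simpa using List.find?_some h⟩

theorem State.expert_of_find? {E : Type} [NormedAddCommGroup E] {σ : State E} {κ : ℕ × ℕ} {e : Expert E}
    (h : σ.find? κ = some e) : σ.expert κ = e := by
  rw [State.expert, h, Option.getD_some]

namespace Setting

theorem exists_experts_eq (S : Setting sub p adv K A B) {n : ℕ} {h : ℕ → State E}
    (hh : h ∈ (trace sub p adv n).support (memOracle K)) {i : ℕ} (hi : i ≤ n) :
    ∃ es, (h i).experts = es ++ spawn p (i + 1) ∧ ∀ e ∈ es, e.birth ≤ i := by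
  cases i with
  | zero =>
    refine ⟨[], ?_, by simp⟩
    rw [trace_zero_of_mem_support hh]
    rfl
  | succ i =>
    have hinv := S.stateInv_trace hh (i := i) (by omega)
    obtain ⟨es, hes, h2⟩ := mem_support_round (trace_succ_of_mem_support hh (by omega : i < n))
    refine ⟨_, by rw [h2], fun e' he' => ?_⟩
    obtain ⟨e, he, hee⟩ := exists_left_of_forall₂ hes (List.mem_filter.1 he').1
    have h3 : e'.birth = e.birth := congrArg Prod.fst (key_of_mem_support_updateExpert hee)
    rw [h3]
    exact hinv.birth_le e he

/-- The state after `a` rounds already contains the experts of round `a + 1`, so an expert born in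
round `a + 1` is first seen in `h a`. All later sums over `Finset.Ico a c` use this shift. -/
theorem find?_birth (S : Setting sub p adv K A B) {n : ℕ} {h : ℕ → State E}
    (hh : h ∈ (trace sub p adv n).support (memOracle K)) {a k : ℕ} (ha : a ≤ n)
    (hk : k ∈ levels p.ε p.T) (hdvd : len p.ε k ∣ a) :
    (h a).find? (a + 1, k) = some ⟨a + 1, k, p.x₁, p.y₁, rate p.ε p.T k⟩ := by
  obtain ⟨es, hes, hb⟩ := S.exists_experts_eq hh ha
  have h1 : es.find? (fun e => decide (e.key = (a + 1, k))) = none := by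
    rw [List.find?_eq_none]
    intro e he
    have := hb e he
    simp only [Expert.key, decide_eq_true_eq, Prod.mk.injEq, not_and]
    omega
  have h2 : ((spawn p (a + 1)).find? fun e => decide (e.key = (a + 1, k))).isSome := by
    rw [List.find?_isSome]
    exact ⟨_, mem_spawn.2 ⟨k, hk, by simpa using hdvd, rfl⟩, by simp [Expert.key]⟩
  obtain ⟨e, he⟩ := Option.isSome_iff_exists.1 h2
  have h3 : e.key = (a + 1, k) := by simpa using List.find?_some he
  obtain ⟨k', -, -, rfl⟩ := mem_spawn.1 (List.mem_of_find?_eq_some he)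
  obtain rfl : k' = k := congrArg Prod.snd h3
  rw [State.find?, hes, List.find?_append, h1, he]
  rfl

theorem find?_active (S : Setting sub p adv K A B) {n : ℕ} {h : ℕ → State E}
    (hh : h ∈ (trace sub p adv n).support (memOracle K)) {a k i : ℕ}
    (hk : k ∈ levels p.ε p.T) (hdvd : len p.ε k ∣ a) (hai : a ≤ i)
    (hi : i < a + 4 * len p.ε k) (hin : i ≤ n) :
    (h i).find? (a + 1, k) = some ((h i).expert (a + 1, k)) := by
  induction i, hai using Nat.le_induction with
  | base =>
    have h1 := S.find?_birth hh hin hk hdvd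
    rw [State.expert_of_find? h1, h1]
  | succ i hai ih =>
    obtain ⟨e', he', -⟩ := find?_of_mem_support_round
      (trace_succ_of_mem_support hh (by omega : i < n)) (κ := (a + 1, k))
      (by simp only; omega) (ih (by omega) (by omega))
    rw [State.expert_of_find? he', he']

theorem expert_succ (S : Setting sub p adv K A B) {n : ℕ} {h : ℕ → State E}
    (hh : h ∈ (trace sub p adv n).support (memOracle K)) {a k i : ℕ}
    (hk : k ∈ levels p.ε p.T) (hdvd : len p.ε k ∣ a) (hai : a ≤ i)
    (hi : i + 1 < a + 4 * len p.ε k) (hin : i + 1 ≤ n) :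
    (h (i + 1)).expert (a + 1, k) ∈ (updateExpert sub p (playPoint (h i).experts)
      ((h i).loss adv) ((h i).expert (a + 1, k))).support (memOracle K) := by
  obtain ⟨e', he', h'⟩ := find?_of_mem_support_round
    (trace_succ_of_mem_support hh (by omega : i < n)) (κ := (a + 1, k))
    (by simp only; omega) (S.find?_active hh hk hdvd hai (by omega) (by omega))
  rwa [State.expert_of_find? he']

theorem expert_lvl (S : Setting sub p adv K A B) {n : ℕ} {h : ℕ → State E}
    (hh : h ∈ (trace sub p adv n).support (memOracle K)) {a k i : ℕ}
    (hk : k ∈ levels p.ε p.T) (hdvd : len p.ε k ∣ a) (hai : a ≤ i)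
    (hi : i < a + 4 * len p.ε k) (hin : i ≤ n) : ((h i).expert (a + 1, k)).lvl = k :=
  congrArg Prod.snd (State.mem_of_find? (S.find?_active hh hk hdvd hai hi hin)).2

theorem expert_birth (S : Setting sub p adv K A B) {n : ℕ} {h : ℕ → State E}
    (hh : h ∈ (trace sub p adv n).support (memOracle K)) {a k i : ℕ}
    (hk : k ∈ levels p.ε p.T) (hdvd : len p.ε k ∣ a) (hai : a ≤ i)
    (hi : i < a + 4 * len p.ε k) (hin : i ≤ n) : ((h i).expert (a + 1, k)).birth = a + 1 :=
  congrArg Prod.fst (State.mem_of_find? (S.find?_active hh hk hdvd hai hi hin)).2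

theorem expert_mem (S : Setting sub p adv K A B) {n : ℕ} {h : ℕ → State E}
    (hh : h ∈ (trace sub p adv n).support (memOracle K)) {a k i : ℕ}
    (hk : k ∈ levels p.ε p.T) (hdvd : len p.ε k ∣ a) (hai : a ≤ i)
    (hi : i < a + 4 * len p.ε k) (hin : i ≤ n) :
    (h i).expert (a + 1, k) ∈ (h i).experts :=
  (State.mem_of_find? (S.find?_active hh hk hdvd hai hi hin)).1

/-! ### The potential of the meta-algorithm -/

end Setting

/-- The sum of the weights relative to the initial weights. -/
noncomputable def potential (p : Params E) (es : List (Expert E)) : ℝ :=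
  (es.map fun e => e.w / rate p.ε p.T e.lvl).sum

namespace Setting

/-- Dividing by the learning rate makes the total update proportional to the sum of the weights
times the advantages of the experts, which is nonpositive by convexity. Expiry only removes
nonnegative terms, and every newborn expert adds exactly 1. -/
theorem potential_round (S : Setting sub p adv K A B) {i : ℕ} {σ σ' : State E}
    (hσ : StateInv p K A i σ)
    (h : σ' ∈ (round sub p adv (i + 1) σ).support (memOracle K)) :
    potential p σ'.experts ≤ potential p σ.experts + (levels p.ε p.T).length := by
  have hinv' := S.stateInv_round hσ h
  obtain ⟨es, hes, rfl⟩ := mem_support_round h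
  have hx := hσ.playPoint_mem S.convex S.zero_mem
  have hρ := rate_pos S.three_le_T p.ε
  have hGD : 0 < p.G * p.D := mul_pos S.G_pos S.D_pos
  have hspawn : potential p (spawn p (i + 1 + 1)) ≤ (levels p.ε p.T).length := by
    have h1 : potential p (spawn p (i + 1 + 1)) = (spawn p (i + 1 + 1)).length := by
      have h2 : (spawn p (i + 1 + 1)).map (fun e => e.w / rate p.ε p.T e.lvl) =
          (spawn p (i + 1 + 1)).map fun _ => (1 : ℝ) := by
        refine List.map_congr_left fun e he => ?_
        obtain ⟨k, -, -, rfl⟩ := mem_spawn.1 he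
        exact div_self (hρ k).ne'
      rw [potential, h2]
      simp
    rw [h1]
    exact_mod_cast length_spawn_le p _
  have hnonneg : ∀ e' ∈ es, 0 ≤ e'.w / rate p.ε p.T e'.lvl := by
    intro e' he'
    obtain ⟨e, he, hee⟩ := exists_left_of_forall₂ hes he'
    obtain ⟨s, -, c, -, rfl⟩ := mem_support_updateExpert hee
    exact div_nonneg (mul_nonneg (hσ.w_pos e he).le
      (S.weightFactor_pos _ hx (hσ.x_mem e he) _).le) (hρ _).le
  have hfilter : ∀ q : Expert E → Bool, potential p (es.filter q) ≤ potential p es := by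
    intro q
    refine List.Sublist.sum_le_sum ((List.filter_sublist).map _) fun w hw => ?_
    obtain ⟨e, he, rfl⟩ := List.mem_map.1 hw
    exact hnonneg e he
  have hes' : potential p es = potential p σ.experts + (p.G * p.D)⁻¹ *
      (σ.experts.map fun e => e.w *
        ((σ.loss adv).val (playPoint σ.experts) - (σ.loss adv).val e.x)).sum := by
    have h1 : es.map (fun e => e.w / rate p.ε p.T e.lvl) = σ.experts.map fun e =>
        e.w / rate p.ε p.T e.lvl + (p.G * p.D)⁻¹ * (e.w *
        ((σ.loss adv).val (playPoint σ.experts) - (σ.loss adv).val e.x)) := by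
      refine map_eq_map_of_forall₂ (fun e e' hee => ?_) hes
      obtain ⟨s, -, c, -, rfl⟩ := mem_support_updateExpert hee
      have := (hρ e.lvl).ne'
      simp only [weightFactor]
      field_simp
    rw [potential, potential, h1, List.sum_map_add, List.sum_map_mul_left]
  have hneg := sum_weight_mul_sub_le (S.admissible (σ.plays ++ [playPoint σ.experts])) hσ.w_pos
  have h2 : (p.G * p.D)⁻¹ * (σ.experts.map fun e => e.w *
        ((σ.loss adv).val (playPoint σ.experts) - (σ.loss adv).val e.x)).sum ≤ 0 :=
    mul_nonpos_of_nonneg_of_nonpos (by positivity) hneg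
  have h3 : ∀ l l' : List (Expert E), potential p (l ++ l') = potential p l + potential p l' := by
    intro l l'
    simp [potential]
  rw [h3]
  have h4 := hfilter fun e => decide (i + 1 + 1 < e.birth + 4 * len p.ε e.lvl)
  linarith

theorem potential_init_le (S : Setting sub p adv K A B) :
    potential p (initState p).experts ≤ (levels p.ε p.T).length := by
  have h2 : (spawn p 1).map (fun e => e.w / rate p.ε p.T e.lvl) =
      (spawn p 1).map fun _ => (1 : ℝ) := by
    refine List.map_congr_left fun e he => ?_
    obtain ⟨k, -, -, rfl⟩ := mem_spawn.1 he
    exact div_self (rate_pos S.three_le_T p.ε k).ne'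
  simp only [potential, initState]
  rw [h2]
  simp only [List.map_const', List.sum_replicate, nsmul_eq_mul, mul_one]
  exact_mod_cast length_spawn_le p 1

theorem potential_trace_le (S : Setting sub p adv K A B) {n : ℕ} {h : ℕ → State E}
    (hh : h ∈ (trace sub p adv n).support (memOracle K)) {i : ℕ} (hi : i ≤ n) :
    potential p (h i).experts ≤ (i + 1) * (levels p.ε p.T).length := by
  induction i with
  | zero =>
    rw [trace_zero_of_mem_support hh]
    simpa using S.potential_init_le
  | succ i ih =>
    have h1 := S.potential_round (S.stateInv_trace hh (by omega))
      (trace_succ_of_mem_support hh (by omega : i < n))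
    have h2 := ih (by omega)
    push_cast
    linarith

end Setting

theorem sub_two_mul_sq_le_log {x : ℝ} (hx : |x| ≤ 1 / 2) : x - 2 * x ^ 2 ≤ Real.log (1 + x) := by
  have h := abs_le.1 hx
  have h1 : 0 < 1 + x := by linarith
  refine le_trans ?_ (Real.one_sub_inv_le_log_of_pos h1)
  have h2 : 1 - (1 + x)⁻¹ = x / (1 + x) := by
    field_simp
    ring
  rw [h2, le_div_iff₀ h1]
  nlinarith [sq_nonneg x]

namespace Setting

/-- The advantage of an expert over the meta-algorithm is controlled by its weight. -/
theorem sum_loss_sub_le_log (S : Setting sub p adv K A B) {n : ℕ} {h : ℕ → State E}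
    (hh : h ∈ (trace sub p adv n).support (memOracle K)) {a k c : ℕ}
    (hk : k ∈ levels p.ε p.T) (hdvd : len p.ε k ∣ a) (hac : a ≤ c)
    (hc : c < a + 4 * len p.ε k) (hcn : c ≤ n) :
    rate p.ε p.T k * ((∑ i ∈ Finset.Ico a c, (((h i).loss adv).val (playPoint (h i).experts) -
      ((h i).loss adv).val ((h i).expert (a + 1, k)).x)) / (p.G * p.D)) -
        2 * rate p.ε p.T k ^ 2 * (c - a) ≤
      Real.log (((h c).expert (a + 1, k)).w / rate p.ε p.T k) := by
  have hρ := rate_pos S.three_le_T p.ε k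
  have hρ2 := rate_le_half p.ε p.T k
  induction c, hac using Nat.le_induction with
  | base =>
    rw [State.expert_of_find? (S.find?_birth hh hcn hk hdvd)]
    simp [hρ.ne']
  | succ c hac ih =>
    have ih := ih (by omega) (by omega)
    have hmem := S.expert_mem hh hk hdvd hac (by omega) (by omega : c ≤ n)
    have hinv := S.stateInv_trace hh (by omega : c ≤ n)
    have hlvl := S.expert_lvl hh hk hdvd hac (by omega) (by omega : c ≤ n)
    obtain ⟨s, -, c', -, he⟩ := mem_support_updateExpert (S.expert_succ hh hk hdvd hac hc hcn)
    have hx := hinv.playPoint_mem S.convex S.zero_mem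
    have hx' := hinv.x_mem _ hmem
    have hw := hinv.w_pos _ hmem
    have hwf : 0 < weightFactor p k ((h c).loss adv) (playPoint (h c).experts)
        ((h c).expert (a + 1, k)).x := S.weightFactor_pos ((h c).plays ++ [playPoint (h c).experts]) hx hx' k
    have hm := S.abs_scaled_loss_le ((h c).plays ++ [playPoint (h c).experts]) hx hx'
    set m := (((h c).loss adv).val (playPoint (h c).experts) -
      ((h c).loss adv).val ((h c).expert (a + 1, k)).x) / (p.G * p.D) with hmdef
    have hm' : |m| ≤ 1 := hm
    have h1 : Real.log (((h (c + 1)).expert (a + 1, k)).w / rate p.ε p.T k) =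
        Real.log (((h c).expert (a + 1, k)).w / rate p.ε p.T k) +
          Real.log (1 + rate p.ε p.T k * m) := by
      rw [he, hlvl]
      simp only
      rw [mul_div_right_comm, Real.log_mul (div_pos hw hρ).ne' hwf.ne']
      rfl
    -- The learning rate is at most `1/2` and `|m| ≤ 1`, so the argument is in the range where the
    -- quadratic lower bound for the logarithm holds.
    have h2 : rate p.ε p.T k * m - 2 * (rate p.ε p.T k * m) ^ 2 ≤
        Real.log (1 + rate p.ε p.T k * m) := by
      apply sub_two_mul_sq_le_log
      rw [abs_mul, abs_of_pos hρ]
      have := abs_nonneg m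
      nlinarith
    have h3 : (rate p.ε p.T k * m) ^ 2 ≤ rate p.ε p.T k ^ 2 := by
      rw [mul_pow]
      have : m ^ 2 ≤ 1 := (sq_le_one_iff_abs_le_one m).2 hm'
      have := sq_nonneg (rate p.ε p.T k)
      nlinarith
    rw [h1, Finset.sum_Ico_succ_top hac, add_div, mul_add]
    rw [← hmdef]
    push_cast
    linarith

/-- On average over a set of experts of the same length, the meta-algorithm does almost as well as
the experts. -/
theorem sum_sum_loss_sub_le (S : Setting sub p adv K A B) {n : ℕ} {h : ℕ → State E}
    (hh : h ∈ (trace sub p adv n).support (memOracle K)) {a k₀ c : ℕ} {Q : Finset ℕ}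
    (hQ : ∀ k ∈ Q, k ∈ levels p.ε p.T ∧ len p.ε k = len p.ε k₀) (hdvd : len p.ε k₀ ∣ a)
    (hac : a ≤ c) (hc : c < a + 4 * len p.ε k₀) (hcn : c ≤ n) {α : ℝ} (hα : 0 < α)
    (hV : ((c : ℝ) + 1) * (levels p.ε p.T).length ≤ α * Q.card) :
    ∑ k ∈ Q, ∑ i ∈ Finset.Ico a c, (((h i).loss adv).val (playPoint (h i).experts) -
      ((h i).loss adv).val ((h i).expert (a + 1, k)).x) ≤
      Q.card * (p.G * p.D * ((1 + Real.log α) / rate p.ε p.T k₀ +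
        2 * rate p.ε p.T k₀ * (c - a))) := by
  have hρ := rate_pos S.three_le_T p.ε k₀
  have hGD : 0 < p.G * p.D := mul_pos S.G_pos S.D_pos
  have hrate : ∀ k ∈ Q, rate p.ε p.T k = rate p.ε p.T k₀ := by
    intro k hk
    rw [rate, rate, (hQ k hk).2]
  have hinv := S.stateInv_trace hh hcn
  have hdvd' : ∀ k ∈ Q, len p.ε k ∣ a := fun k hk => by rw [(hQ k hk).2]; exact hdvd
  have hc' : ∀ k ∈ Q, c < a + 4 * len p.ε k := fun k hk => by rw [(hQ k hk).2]; exact hc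
  have hfind := fun k hk => S.find?_active hh (hQ k hk).1 (hdvd' k hk) hac (hc' k hk) hcn
  have hpot : ∑ k ∈ Q, ((h c).expert (a + 1, k)).w / rate p.ε p.T k₀ ≤ α * Q.card := by
    refine le_trans ?_ ((S.potential_trace_le hh hcn).trans hV)
    have h1 := sum_find?_le (key := Expert.key) (g := fun e => e.w / rate p.ε p.T e.lvl)
      (⟨0, 0, 0, 0, 0⟩ : Expert E) (l := (h c).experts)
      (fun e he => div_nonneg (hinv.w_pos e he).le (rate_pos S.three_le_T p.ε _).le)
      (Q.map ⟨fun k => (a + 1, k), fun k k' hkk => congrArg Prod.snd hkk⟩) (by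
        intro κ hκ
        obtain ⟨k, hk, rfl⟩ := Finset.mem_map.1 hκ
        exact Option.isSome_iff_exists.2 ⟨_, hfind k hk⟩)
    rw [Finset.sum_map] at h1
    refine le_trans (Finset.sum_congr rfl fun k hk => ?_).le h1
    have h2 := S.expert_lvl hh (hQ k hk).1 (hdvd' k hk) hac (hc' k hk) hcn
    change _ = ((h c).expert (a + 1, k)).w / rate p.ε p.T ((h c).expert (a + 1, k)).lvl
    rw [h2, hrate k hk]
  have hlog : ∑ k ∈ Q, Real.log (((h c).expert (a + 1, k)).w / rate p.ε p.T k₀) ≤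
      Q.card * (1 + Real.log α) := by
    -- The tangent line of the logarithm at `α` replaces Jensen's inequality: the mean of the
    -- relative weights is at most `α`, so the mean of their logarithms is at most `1 + log α`.
    calc _ ≤ ∑ k ∈ Q, (((h c).expert (a + 1, k)).w / rate p.ε p.T k₀ / α + Real.log α) := by
          refine Finset.sum_le_sum fun k hk => ?_
          have hw := hinv.w_pos _
            (S.expert_mem hh (hQ k hk).1 (hdvd' k hk) hac (hc' k hk) hcn)
          have hv : 0 < ((h c).expert (a + 1, k)).w / rate p.ε p.T k₀ := div_pos hw hρ
          have h1 := Real.log_le_sub_one_of_pos (div_pos hv hα)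
          rw [Real.log_div hv.ne' hα.ne'] at h1
          linarith
      _ = (∑ k ∈ Q, ((h c).expert (a + 1, k)).w / rate p.ε p.T k₀) / α +
          Q.card * Real.log α := by
          rw [Finset.sum_add_distrib, Finset.sum_div, Finset.sum_const, nsmul_eq_mul]
      _ ≤ α * Q.card / α + Q.card * Real.log α := by gcongr
      _ = _ := by
          field_simp
  have hsum := Finset.sum_le_sum fun k hk =>
    S.sum_loss_sub_le_log hh (hQ k hk).1 (hdvd' k hk) hac (hc' k hk) hcn
  have hsum' : ∑ k ∈ Q, (rate p.ε p.T k₀ * ((∑ i ∈ Finset.Ico a c,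
      (((h i).loss adv).val (playPoint (h i).experts) -
      ((h i).loss adv).val ((h i).expert (a + 1, k)).x)) / (p.G * p.D)) -
        2 * rate p.ε p.T k₀ ^ 2 * (c - a)) ≤ Q.card * (1 + Real.log α) := by
    refine le_trans ?_ hlog
    refine le_trans (Finset.sum_congr rfl fun k hk => ?_).le
      (hsum.trans (Finset.sum_congr rfl fun k hk => ?_).le) <;> rw [hrate k hk]
  rw [Finset.sum_sub_distrib, ← Finset.mul_sum, ← Finset.sum_div, Finset.sum_const,
    nsmul_eq_mul] at hsum'
  set X := ∑ k ∈ Q, ∑ i ∈ Finset.Ico a c, (((h i).loss adv).val (playPoint (h i).experts) -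
      ((h i).loss adv).val ((h i).expert (a + 1, k)).x)
  set ρ := rate p.ε p.T k₀
  have h5 : ρ * (X / (p.G * p.D)) ≤ Q.card * (1 + Real.log α + 2 * ρ ^ 2 * (c - a)) := by
    linarith
  rw [← mul_div_assoc, div_le_iff₀ hGD, mul_comm, ← le_div_iff₀ hρ] at h5
  refine h5.trans_eq ?_
  field_simp

end Setting

end Meta

end ProjFree

namespace ProjFree

open OracleComp

/-! ### Expected regret of one expert against an adaptive adversary. -/

section BaseRegret

variable {E : Type} [NormedAddCommGroup E] [InnerProductSpace ℝ E] {sub : Subroutines E}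
  {p : Params E} {adv : Adversary E} {K : Set E} {A B : ℝ}

/-- The expected value of a random vector. -/
noncomputable def OracleComp.mean (O : E → Bool) : OracleComp E E → E
  | .pure a => a
  | .query x k => (k (O x)).mean O
  | .rand n k => ((n : ℝ) + 1)⁻¹ • ∑ i, (k i).mean O

theorem OracleComp.expect_inner (O : E → Bool) (m : OracleComp E E) (w : E) :
    m.expect O (fun s => inner ℝ w s) = inner ℝ w (m.mean O) := by
  induction m with
  | pure a => rfl
  | query x k ih => exact ih _
  | rand n k ih =>
    simp only [expect, mean, ih, real_inner_smul_right, inner_sum]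
    rw [div_eq_inv_mul]

/-- The expected step of the expert `κ` in the round after the state `σ`. -/
noncomputable def meanStep (sub : Subroutines E) (p : Params E) (adv : Adversary E) (K : Set E)
    (κ : ℕ × ℕ) (σ : State E) : E :=
  stepSize p κ.2 • ((σ.loss adv).grad (σ.expert κ).y + (3 * p.G * p.D) •
    (sub.subgrad (4 * len p.ε κ.2) (σ.expert κ).y).mean (memOracle K))

/-- The deviation of a step of the expert `κ` from the expected step. -/
noncomputable def noise (sub : Subroutines E) (p : Params E) (adv : Adversary E) (K : Set E)
    (κ : ℕ × ℕ) (h : ℕ → State E) (i : ℕ) : E :=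
  meanStep sub p adv K κ (h i) - (((h i).expert κ).y - ((h (i + 1)).expert κ).y)

namespace Setting

theorem expect_round_y (S : Setting sub p adv K A B) {n : ℕ} {h : ℕ → State E}
    (hh : h ∈ (trace sub p adv n).support (memOracle K)) {a k i : ℕ}
    (hk : k ∈ levels p.ε p.T) (hdvd : len p.ε k ∣ a) (hai : a ≤ i)
    (hi : i + 1 < a + 4 * len p.ε k) (hin : i + 1 ≤ n) (F : E → ℝ) :
    (round sub p adv (i + 1) (h i)).expect (memOracle K)
        (fun σ => F (σ.expert (a + 1, k)).y) =
      (sub.subgrad (4 * len p.ε k) ((h i).expert (a + 1, k)).y).expect (memOracle K) fun s =>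
        F (nextPoint p k ((h i).loss adv) ((h i).expert (a + 1, k)).y s) := by
  rw [expect_round_expert (κ := (a + 1, k)) (by simp only; omega)
    (S.find?_active hh hk hdvd hai (by omega) (by omega)) fun e => F e.y,
    expect_updateExpert_y, S.expert_lvl hh hk hdvd hai (by omega) (by omega)]

/-- The noise is orthogonal to everything that was known before. -/
theorem expect_inner_noise (S : Setting sub p adv K A B) {n a k i : ℕ}
    (hk : k ∈ levels p.ε p.T) (hdvd : len p.ε k ∣ a) (hai : a ≤ i)
    (hi : i + 1 < a + 4 * len p.ε k) (hin : i + 1 ≤ n) {W : (ℕ → State E) → E}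
    (hW : ∀ h j σ, i < j → W (Function.update h j σ) = W h) :
    (trace sub p adv n).expect (memOracle K)
      (fun h => inner ℝ (W h) (noise sub p adv K (a + 1, k) h i)) = 0 := by
  have h1 := expect_trace_succ (sub := sub) (p := p) (adv := adv) (O := memOracle K)
    (by omega : i < n) (Φ := fun h σ => inner ℝ (W h) (meanStep sub p adv K (a + 1, k) (h i) -
      (((h i).expert (a + 1, k)).y - (σ.expert (a + 1, k)).y))) (by
        intro h j τ σ hj
        rw [hW h j τ hj, Function.update_of_ne (by omega)])
  refine h1.trans ((expect_congr fun h hh => ?_).trans (expect_const _ 0))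
  rw [S.expect_round_y hh hk hdvd hai hi hin fun y => inner ℝ (W h)
    (meanStep sub p adv K (a + 1, k) (h i) - (((h i).expert (a + 1, k)).y - y))]
  simp only [nextPoint, sub_sub_cancel, meanStep, ← smul_sub, add_sub_add_left_eq_sub,
    real_inner_smul_right, inner_sub_right]
  rw [expect_const_mul, expect_const_mul, expect_sub, expect_const, OracleComp.expect_inner]
  simp

theorem expect_norm_step_sq_le (S : Setting sub p adv K A B) (hrD : p.r ≤ p.D) {n a k i : ℕ}
    (hk : k ∈ levels p.ε p.T) (hdvd : len p.ε k ∣ a) (hai : a ≤ i)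
    (hi : i + 1 < a + 4 * len p.ε k) (hin : i + 1 ≤ n) :
    (trace sub p adv n).expect (memOracle K)
      (fun h => ‖((h i).expert (a + 1, k)).y - ((h (i + 1)).expert (a + 1, k)).y‖ ^ 2) ≤
      stepSize p k ^ 2 * (38 * p.G ^ 2 * p.D ^ 2 / p.r ^ 2) := by
  have hG := S.G_pos
  have hD := S.D_pos
  have hr := S.r_pos
  have hlen := one_le_len p.ε k
  have h1 := expect_trace_succ (sub := sub) (p := p) (adv := adv) (O := memOracle K)
    (by omega : i < n) (Φ := fun h σ =>
      ‖((h i).expert (a + 1, k)).y - (σ.expert (a + 1, k)).y‖ ^ 2) (by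
        intro h j τ σ hj
        rw [Function.update_of_ne (by omega)])
  refine h1.trans_le (expect_le_const fun h hh => ?_)
  rw [S.expect_round_y hh hk hdvd hai hi hin fun y => ‖((h i).expert (a + 1, k)).y - y‖ ^ 2]
  set y := ((h i).expert (a + 1, k)).y
  have h2 := (S.good (4 * len p.ε k) (by omega)).approx.subgrad_sq y
  have h3 : ∀ s : E, ‖y - nextPoint p k ((h i).loss adv) y s‖ ^ 2 ≤
      stepSize p k ^ 2 * (2 * p.G ^ 2 + 18 * p.G ^ 2 * p.D ^ 2 * ‖s‖ ^ 2) := by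
    intro s
    rw [nextPoint, sub_sub_cancel, norm_smul, mul_pow, Real.norm_of_nonneg (S.stepSize_pos k).le]
    gcongr
    have h4 : ‖((h i).loss adv).grad y + (3 * p.G * p.D) • s‖ ≤
        p.G + 3 * p.G * p.D * ‖s‖ := by
      refine (norm_add_le _ _).trans (add_le_add (S.norm_grad_le _ y) ?_)
      rw [norm_smul, Real.norm_of_nonneg (by positivity)]
    calc _ ≤ (p.G + 3 * p.G * p.D * ‖s‖) ^ 2 := by gcongr
      _ ≤ _ := by nlinarith [sq_nonneg (p.G - 3 * p.G * p.D * ‖s‖)]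
  refine (expect_mono fun s _ => h3 s).trans ?_
  rw [expect_const_mul, expect_add, expect_const, expect_const_mul]
  gcongr
  -- The constant is `38 = 2 + 18 · 2`; the first summand is absorbed by `r ≤ D`.
  calc _ ≤ 2 * p.G ^ 2 + 18 * p.G ^ 2 * p.D ^ 2 * (2 / p.r ^ 2) := by gcongr
    _ ≤ 2 * p.G ^ 2 * (p.D ^ 2 / p.r ^ 2) + 18 * p.G ^ 2 * p.D ^ 2 * (2 / p.r ^ 2) := by
        refine add_le_add_left (le_mul_of_one_le_right (by positivity) ?_) _
        rw [one_le_div (by positivity)]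
        gcongr
    _ = _ := by ring

/-- A variance is at most the second moment: the cross term with the mean step vanishes in
expectation, since the mean step is known before the round. -/
theorem expect_norm_noise_sq_le (S : Setting sub p adv K A B) (hrD : p.r ≤ p.D) {n a k i : ℕ}
    (hk : k ∈ levels p.ε p.T) (hdvd : len p.ε k ∣ a) (hai : a ≤ i)
    (hi : i + 1 < a + 4 * len p.ε k) (hin : i + 1 ≤ n) :
    (trace sub p adv n).expect (memOracle K)
      (fun h => ‖noise sub p adv K (a + 1, k) h i‖ ^ 2) ≤
      stepSize p k ^ 2 * (38 * p.G ^ 2 * p.D ^ 2 / p.r ^ 2) := by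
  refine le_trans ?_ (S.expect_norm_step_sq_le hrD hk hdvd hai hi hin)
  have h1 := S.expect_inner_noise hk hdvd hai hi hin
    (W := fun h => meanStep sub p adv K (a + 1, k) (h i)) (by
      intro h j σ hj
      rw [Function.update_of_ne (by omega)])
  have h2 : ∀ h : ℕ → State E, ‖noise sub p adv K (a + 1, k) h i‖ ^ 2 ≤
      ‖((h i).expert (a + 1, k)).y - ((h (i + 1)).expert (a + 1, k)).y‖ ^ 2 +
        2 * inner ℝ (meanStep sub p adv K (a + 1, k) (h i))
          (noise sub p adv K (a + 1, k) h i) := by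
    intro h
    have h3 : ((h i).expert (a + 1, k)).y - ((h (i + 1)).expert (a + 1, k)).y =
        meanStep sub p adv K (a + 1, k) (h i) - noise sub p adv K (a + 1, k) h i := by
      rw [noise, sub_sub_cancel]
    rw [h3, norm_sub_sq_real]
    have := sq_nonneg ‖meanStep sub p adv K (a + 1, k) (h i)‖
    linarith
  refine (expect_mono fun h _ => h2 h).trans_eq ?_
  rw [expect_add, expect_const_mul, h1, mul_zero, add_zero]

theorem noise_update (κ : ℕ × ℕ) (h : ℕ → State E) {i j : ℕ} (σ : State E) (hij : i + 1 < j) :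
    noise sub p adv K κ (Function.update h j σ) i = noise sub p adv K κ h i := by
  rw [noise, noise, Function.update_of_ne (by omega), Function.update_of_ne (by omega)]

/-- Each noise term is orthogonal to the sum of the earlier ones, so the squared norms add up. -/
theorem expect_norm_sum_noise_sq_le (S : Setting sub p adv K A B) (hrD : p.r ≤ p.D)
    {n a k c : ℕ} (hk : k ∈ levels p.ε p.T) (hdvd : len p.ε k ∣ a) (hac : a ≤ c)
    (hc : c < a + 4 * len p.ε k) (hcn : c ≤ n) :
    (trace sub p adv n).expect (memOracle K)
      (fun h => ‖∑ i ∈ Finset.Ico a c, noise sub p adv K (a + 1, k) h i‖ ^ 2) ≤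
      (c - a) * (stepSize p k ^ 2 * (38 * p.G ^ 2 * p.D ^ 2 / p.r ^ 2)) := by
  induction c, hac using Nat.le_induction with
  | base => simp
  | succ c hac ih =>
    have h1 := ih (by omega) (by omega)
    have h2 := S.expect_norm_noise_sq_le hrD hk hdvd hac hc hcn
    have h3 := S.expect_inner_noise hk hdvd hac hc hcn
      (W := fun h => ∑ i ∈ Finset.Ico a c, noise sub p adv K (a + 1, k) h i) (by
        intro h j σ hj
        refine Finset.sum_congr rfl fun i hi => noise_update _ h σ ?_
        have := (Finset.mem_Ico.1 hi).2
        omega)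
    simp only [Finset.sum_Ico_succ_top hac, norm_add_sq_real]
    rw [expect_add, expect_add, expect_const_mul, h3]
    push_cast
    linarith

end Setting

/-- The telescoping sum of gradient descent, with an additional noise. -/
theorem sum_inner_le_of_descent {y e : ℕ → E} {u : E} {a c : ℕ} (hac : a ≤ c) {D : ℝ}
    (hu : ‖y a - u‖ ≤ D) :
    ∑ i ∈ Finset.Ico a c, inner ℝ (e i) (y i - u) ≤
      D ^ 2 + 1 / 2 * ∑ i ∈ Finset.Ico a c, ‖y i - y (i + 1)‖ ^ 2 +
        1 / 2 * ‖∑ i ∈ Finset.Ico a c, (e i - (y i - y (i + 1)))‖ ^ 2 +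
        ∑ i ∈ Finset.Ico a c, inner ℝ (y i - y a) (e i - (y i - y (i + 1))) := by
  have h1 : ∑ i ∈ Finset.Ico a c, inner ℝ (y i - y (i + 1)) (y i - u) =
      1 / 2 * (‖y a - u‖ ^ 2 - ‖y c - u‖ ^ 2 +
        ∑ i ∈ Finset.Ico a c, ‖y i - y (i + 1)‖ ^ 2) := by
    induction c, hac using Nat.le_induction with
    | base => simp
    | succ c hac ih =>
      rw [Finset.sum_Ico_succ_top hac, Finset.sum_Ico_succ_top hac, ih]
      have h2 : y (c + 1) - u = (y c - u) - (y c - y (c + 1)) := by abel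
      rw [h2, norm_sub_sq_real (y c - u), real_inner_comm]
      ring
  have h2 : ∑ i ∈ Finset.Ico a c, inner ℝ (e i) (y i - u) =
      ∑ i ∈ Finset.Ico a c, inner ℝ (y i - y (i + 1)) (y i - u) +
      ∑ i ∈ Finset.Ico a c, inner ℝ (y i - y a) (e i - (y i - y (i + 1))) +
      inner ℝ (∑ i ∈ Finset.Ico a c, (e i - (y i - y (i + 1)))) (y a - u) := by
    rw [sum_inner, ← Finset.sum_add_distrib, ← Finset.sum_add_distrib]
    refine Finset.sum_congr rfl fun i _ => ?_
    rw [← sub_add_sub_cancel (y i) (y a) u, real_inner_comm (e i - (y i - y (i + 1))) (y i - y a)]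
    simp only [inner_sub_left, inner_add_right]
    ring
  -- The comparator meets the noise only in this term, and Young's inequality removes it. The
  -- resulting bound is uniform in `u`, so `u` may be chosen after all random choices.
  have h3 : inner ℝ (∑ i ∈ Finset.Ico a c, (e i - (y i - y (i + 1)))) (y a - u) ≤
      1 / 2 * ‖∑ i ∈ Finset.Ico a c, (e i - (y i - y (i + 1)))‖ ^ 2 + 1 / 2 * D ^ 2 := by
    refine (real_inner_le_norm _ _).trans ?_
    have h4 := norm_nonneg (∑ i ∈ Finset.Ico a c, (e i - (y i - y (i + 1))))
    nlinarith [sq_nonneg (‖∑ i ∈ Finset.Ico a c, (e i - (y i - y (i + 1)))‖ - D)]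
  have h4 : ‖y a - u‖ ^ 2 ≤ D ^ 2 := by gcongr
  have h5 := sq_nonneg ‖y c - u‖
  rw [h2, h1]
  linarith

namespace Setting

/-- The loss of the prediction is at most the regularized loss of the iterate, up to a small
error. -/
theorem loss_x_le (S : Setting sub p adv K A B) {n : ℕ} {h : ℕ → State E}
    (hh : h ∈ (trace sub p adv n).support (memOracle K)) {a k i : ℕ}
    (hk : k ∈ levels p.ε p.T) (hdvd : len p.ε k ∣ a) (hai : a ≤ i)
    (hi : i < a + 4 * len p.ε k) (hin : i ≤ n) :
    ((h i).loss adv).val ((h i).expert (a + 1, k)).x ≤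
      ((h i).loss adv).val ((h i).expert (a + 1, k)).y +
        3 * p.G * p.D * (gauge1 K ((h i).expert (a + 1, k)).y - 1) +
        p.G * p.D * (1 / ((4 * len p.ε k : ℕ) : ℝ) ^ 2) + if i = a then p.G * p.D else 0 := by
  have hG := S.G_pos
  have hD := S.D_pos
  have hadm := S.admissible ((h i).plays ++ [playPoint (h i).experts])
  have hlen := one_le_len p.ε k
  have herr : 0 ≤ p.G * p.D * (1 / ((4 * len p.ε k : ℕ) : ℝ) ^ 2) := by positivity
  have hγ := one_le_gauge1 S.r_pos S.ball ((h i).expert (a + 1, k)).y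
  have hγ' : 0 ≤ p.G * p.D * (gauge1 K ((h i).expert (a + 1, k)).y - 1) :=
    mul_nonneg (by positivity) (by linarith)
  -- In the round of birth the two starting points are unrelated points of `K`, which costs at most
  -- `GD` once; afterwards `x` is the scaled `y`.
  by_cases hia : i = a
  · subst hia
    rw [State.expert_of_find? (S.find?_birth hh hin hk hdvd)] at hγ' ⊢
    have h1 := (le_abs_self _).trans
      (S.loss_sub_le ((h i).plays ++ [playPoint (h i).experts]) S.x₁_mem S.y₁_mem)
    simp only [if_true] at hγ' ⊢
    unfold State.loss
    linarith
  · obtain ⟨j, rfl⟩ : ∃ j, i = j + 1 := ⟨i - 1, by omega⟩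
    have hlvl := S.expert_lvl hh hk hdvd (by omega : a ≤ j) (by omega) (by omega)
    obtain ⟨s, -, c, hc, he⟩ := mem_support_updateExpert
      (S.expert_succ hh hk hdvd (by omega : a ≤ j) hi hin)
    set e := (h (j + 1)).expert (a + 1, k)
    rw [hlvl] at hc
    obtain ⟨hc1, hcK, hcγ⟩ := (S.good (4 * len p.ε k) (by omega)).approx.value_spec _ c hc
    have hey : nextPoint p k ((h j).loss adv) ((h j).expert (a + 1, k)).y s = e.y := by
      rw [he, hlvl]
    have hex : e.x = c⁻¹ • e.y := by rw [he]
    rw [hey] at hcK hcγ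
    rw [← hex] at hcK
    have h1 := (le_abs_self _).trans (hadm.lipschitz e.x e.y)
    have h2 : ‖e.x - e.y‖ ≤ (c - 1) * p.D := by
      have h3 : e.y = c • e.x := by
        rw [hex, smul_smul, mul_inv_cancel₀ (by linarith), one_smul]
      have h4 : e.x - e.y = -((c - 1) • e.x) := by
        rw [h3]
        module
      rw [h4, norm_neg, norm_smul, Real.norm_of_nonneg (by linarith)]
      exact mul_le_mul_of_nonneg_left (S.norm_le hcK) (by linarith)
    have h5 : p.G * ‖e.x - e.y‖ ≤ p.G * p.D * (gauge1 K e.y - 1) +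
        p.G * p.D * (1 / ((4 * len p.ε k : ℕ) : ℝ) ^ 2) := by
      calc p.G * ‖e.x - e.y‖ ≤ p.G * ((c - 1) * p.D) := by gcongr
        _ = p.G * p.D * (c - 1) := by ring
        _ ≤ p.G * p.D * (gauge1 K e.y - 1 + 1 / ((4 * len p.ε k : ℕ) : ℝ) ^ 2) := by
            gcongr
            linarith [(abs_le.1 hcγ).2]
        _ = _ := by ring
    rw [if_neg hia]
    unfold State.loss
    linarith

/-- This adds the subgradient inequality of the loss to `3GD` times the approximate one of `γ`,
evaluated at a point where `γ` is 1. Dividing by the step size undoes the scaling in `meanStep`. -/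
theorem regularized_loss_sub_le (S : Setting sub p adv K A B) (σ : State E) (κ : ℕ × ℕ)
    {u : E} (hu : u ∈ K) :
    (σ.loss adv).val (σ.expert κ).y + 3 * p.G * p.D * (gauge1 K (σ.expert κ).y - 1) -
        (σ.loss adv).val u ≤
      (stepSize p κ.2)⁻¹ * inner ℝ (meanStep sub p adv K κ σ) ((σ.expert κ).y - u) +
        3 * p.G * p.D * (1 / (((4 * len p.ε κ.2 : ℕ) : ℝ) ^ 2 * (1 + A)) *
          (1 + ‖u - (σ.expert κ).y‖)) := by
  have hG := S.G_pos
  have hD := S.D_pos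
  have hlen := one_le_len p.ε κ.2
  set y := (σ.expert κ).y with hy
  have h1 := (S.admissible (σ.plays ++ [playPoint σ.experts])).subgradient y u
  have h2 := (S.good (4 * len p.ε κ.2) (by omega)).subgrad_spec y u
  simp only [real_inner_comm (u - y)] at h2
  rw [OracleComp.expect_inner, gauge1_of_mem S.r_pos S.ball hu] at h2
  rw [meanStep, ← hy, real_inner_smul_left, inv_mul_cancel_left₀ (S.stepSize_pos κ.2).ne',
    inner_add_left, real_inner_smul_left, ← neg_sub u y, inner_neg_right, inner_neg_right,
    real_inner_comm (u - y) (OracleComp.mean _ _)]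
  have h3 := mul_le_mul_of_nonneg_left h2 (by positivity : 0 ≤ 3 * p.G * p.D)
  unfold State.loss
  linarith

/-- The regret of an expert on a path, in terms of linear losses. -/
theorem sum_loss_sub_le (S : Setting sub p adv K A B) {n : ℕ} {h : ℕ → State E}
    (hh : h ∈ (trace sub p adv n).support (memOracle K)) {a k c : ℕ}
    (hk : k ∈ levels p.ε p.T) (hdvd : len p.ε k ∣ a)
    (hc : c < a + 4 * len p.ε k) (hcn : c ≤ n) {u : E} (hu : u ∈ K) :
    ∑ i ∈ Finset.Ico a c, ((h i).loss adv).val ((h i).expert (a + 1, k)).x -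
      ∑ i ∈ Finset.Ico a c, ((h i).loss adv).val u ≤
    (stepSize p k)⁻¹ * ∑ i ∈ Finset.Ico a c, inner ℝ (meanStep sub p adv K (a + 1, k) (h i))
      (((h i).expert (a + 1, k)).y - u) + 8 * (p.G * p.D) := by
  have hG := S.G_pos
  have hD := S.D_pos
  have hA := S.A_pos
  have hlen := one_le_len p.ε k
  set H : ℕ := 4 * len p.ε k with hH
  have hH1 : (1 : ℝ) ≤ H := by exact_mod_cast (by omega : 1 ≤ H)
  have hpt : ∀ i ∈ Finset.Ico a c, ((h i).loss adv).val ((h i).expert (a + 1, k)).x -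
      ((h i).loss adv).val u ≤ (stepSize p k)⁻¹ *
        inner ℝ (meanStep sub p adv K (a + 1, k) (h i)) (((h i).expert (a + 1, k)).y - u) +
        (7 * (p.G * p.D) / H + if i = a then p.G * p.D else 0) := by
    intro i hi
    obtain ⟨hai, hic⟩ := Finset.mem_Ico.1 hi
    have h1 := S.loss_x_le hh hk hdvd hai (by omega) (by omega)
    have h2 := S.regularized_loss_sub_le (h i) (a + 1, k) hu
    have h3 := (S.stateInv_trace hh (by omega : i ≤ n)).norm_y_le _
      (S.expert_mem hh hk hdvd hai (by omega) (by omega))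
    rw [S.expert_birth hh hk hdvd hai (by omega) (by omega)] at h3
    simp only [← hH] at h1 h2
    -- The iterate starts in `K` and has moved by at most `A` in each of at most `H - 1` rounds.
    have h4 : 1 + ‖u - ((h i).expert (a + 1, k)).y‖ ≤ 2 * H * (1 + A) := by
      have h5 := (_root_.norm_sub_le u ((h i).expert (a + 1, k)).y).trans
        (add_le_add (S.norm_le hu) h3)
      have h6 : (i : ℝ) + 1 - ((a + 1 : ℕ) : ℝ) ≤ H - 1 := by
        have : (i : ℝ) + 1 ≤ a + H := by exact_mod_cast (by omega : i + 1 ≤ a + H)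
        push_cast
        linarith
      have h7 : ((i : ℝ) + 1 - ((a + 1 : ℕ) : ℝ)) * A ≤ (H - 1) * A := by gcongr
      have h8 := S.D_le
      nlinarith
    have h5 : 1 / ((H : ℝ) ^ 2 * (1 + A)) * (1 + ‖u - ((h i).expert (a + 1, k)).y‖) ≤ 2 / H := by
      calc _ ≤ 1 / ((H : ℝ) ^ 2 * (1 + A)) * (2 * H * (1 + A)) := by gcongr
        _ = _ := by field_simp
    have h6 : 1 / (H : ℝ) ^ 2 ≤ 1 / H := by
      apply one_div_le_one_div_of_le (by positivity)
      nlinarith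
    have h7 : 3 * p.G * p.D * (1 / ((H : ℝ) ^ 2 * (1 + A)) *
        (1 + ‖u - ((h i).expert (a + 1, k)).y‖)) ≤ 3 * p.G * p.D * (2 / H) := by gcongr
    have h8 : p.G * p.D * (1 / (H : ℝ) ^ 2) ≤ p.G * p.D * (1 / H) := by gcongr
    have h9 : 7 * (p.G * p.D) / H = 3 * p.G * p.D * (2 / H) + p.G * p.D * (1 / H) := by ring
    rw [h9]
    linarith
  rw [← Finset.sum_sub_distrib]
  refine (Finset.sum_le_sum hpt).trans ?_
  rw [Finset.sum_add_distrib, ← Finset.mul_sum, Finset.sum_add_distrib, Finset.sum_const,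
    Nat.card_Ico, nsmul_eq_mul]
  -- The errors per round, `6GD/H` from the subgradients and `GD/H` from the scaling, add up to
  -- `7GD` over at most `H` rounds; the round of birth adds one more `GD`.
  have h1 : ((c - a : ℕ) : ℝ) * (7 * (p.G * p.D) / H) ≤ 7 * (p.G * p.D) := by
    have h2 : ((c - a : ℕ) : ℝ) ≤ H := by exact_mod_cast (by omega : c - a ≤ H)
    calc _ ≤ (H : ℝ) * (7 * (p.G * p.D) / H) := by gcongr
      _ = _ := by field_simp
  have h2 : ∑ i ∈ Finset.Ico a c, (if i = a then p.G * p.D else 0) ≤ p.G * p.D := by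
    rw [Finset.sum_ite_eq']
    split
    · exact le_rfl
    · positivity
  linarith

/-- The expected regret of an expert from its birth on. -/
theorem expect_expert_regret_le (S : Setting sub p adv K A B) (hrD : p.r ≤ p.D)
    {n a k c : ℕ} (hk : k ∈ levels p.ε p.T) (hdvd : len p.ε k ∣ a) (hac : a ≤ c)
    (hc : c < a + 4 * len p.ε k) (hcn : c ≤ n) :
    (trace sub p adv n).expect (memOracle K) (fun h =>
      ∑ i ∈ Finset.Ico a c, ((h i).loss adv).val ((h i).expert (a + 1, k)).x -
        ⨅ u : K, ∑ i ∈ Finset.Ico a c, ((h i).loss adv).val u) ≤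
      86 * √(len p.ε k) * (p.G * p.D ^ 2 / p.r) := by
  have hG := S.G_pos
  have hD := S.D_pos
  have hr := S.r_pos
  have hη := S.stepSize_pos k
  have hl := len_pos p.ε k
  have hl1 : (1 : ℝ) ≤ √(len p.ε k) := Real.one_le_sqrt.2 (by exact_mod_cast one_le_len p.ε k)
  have : Nonempty K := ⟨⟨0, S.zero_mem⟩⟩
  set q := stepSize p k ^ 2 * (38 * p.G ^ 2 * p.D ^ 2 / p.r ^ 2) with hq
  let Y : (ℕ → State E) → ℕ → E := fun h i => ((h i).expert (a + 1, k)).y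
  let Z : (ℕ → State E) → ℝ := fun h =>
    (p.D ^ 2 + 1 / 2 * ∑ i ∈ Finset.Ico a c, ‖Y h i - Y h (i + 1)‖ ^ 2 +
      1 / 2 * ‖∑ i ∈ Finset.Ico a c, noise sub p adv K (a + 1, k) h i‖ ^ 2 +
      ∑ i ∈ Finset.Ico a c, inner ℝ (Y h i - Y h a) (noise sub p adv K (a + 1, k) h i))
  have hpath : ∀ h ∈ (trace sub p adv n).support (memOracle K),
      ∑ i ∈ Finset.Ico a c, ((h i).loss adv).val ((h i).expert (a + 1, k)).x -
        ⨅ u : K, ∑ i ∈ Finset.Ico a c, ((h i).loss adv).val u ≤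
      (stepSize p k)⁻¹ * Z h + 8 * (p.G * p.D) := by
    intro h hh
    -- The infimum is removed on each path, before taking expectations; this is allowed because `Z`
    -- does not involve `u`.
    rw [sub_le_comm]
    refine le_ciInf fun u => ?_
    have h1 := S.sum_loss_sub_le hh hk hdvd hc hcn u.2
    have h2 := sum_inner_le_of_descent (y := Y h)
      (e := fun i => meanStep sub p adv K (a + 1, k) (h i)) (u := u) hac (D := p.D) (by
        simp only [Y]
        rw [State.expert_of_find? (S.find?_birth hh (by omega) hk hdvd)]
        exact S.norm_sub_le S.y₁_mem u.2)
    have h3 := mul_le_mul_of_nonneg_left h2 (inv_pos.2 hη).le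
    change _ ≤ (stepSize p k)⁻¹ * Z h at h3
    linarith
  refine (expect_mono hpath).trans ?_
  rw [expect_add, expect_const, expect_const_mul]
  have hZ : (trace sub p adv n).expect (memOracle K) Z ≤ p.D ^ 2 + (c - a) * q := by
    simp only [Z]
    rw [expect_add, expect_add, expect_add, expect_const, expect_const_mul, expect_const_mul,
      expect_sum, expect_sum]
    have h1 := S.expect_norm_sum_noise_sq_le hrD hk hdvd hac hc hcn
    have h2 : ∑ i ∈ Finset.Ico a c, (trace sub p adv n).expect (memOracle K)
        (fun h => ‖Y h i - Y h (i + 1)‖ ^ 2) ≤ (c - a) * q := by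
      calc _ ≤ ∑ i ∈ Finset.Ico a c, q := by
            refine Finset.sum_le_sum fun i hi => ?_
            obtain ⟨hai, hic⟩ := Finset.mem_Ico.1 hi
            exact S.expect_norm_step_sq_le hrD hk hdvd hai (by omega) (by omega)
        _ = _ := by
            rw [Finset.sum_const, Nat.card_Ico, nsmul_eq_mul, Nat.cast_sub hac]
    have h3 : ∑ i ∈ Finset.Ico a c, (trace sub p adv n).expect (memOracle K)
        (fun h => inner ℝ (Y h i - Y h a) (noise sub p adv K (a + 1, k) h i)) = 0 := by
      refine Finset.sum_eq_zero fun i hi => ?_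
      obtain ⟨hai, hic⟩ := Finset.mem_Ico.1 hi
      refine S.expect_inner_noise hk hdvd hai (by omega) (by omega) ?_
      intro h j σ hj
      simp only [Y]
      rw [Function.update_of_ne (by omega), Function.update_of_ne (by omega)]
    linarith
  have hn : ((c : ℝ) - a) ≤ 4 * len p.ε k := by
    have : (c : ℝ) ≤ a + 4 * len p.ε k := by exact_mod_cast hc.le
    linarith
  have hq0 : 0 ≤ q := by positivity
  calc _ ≤ (stepSize p k)⁻¹ * (p.D ^ 2 + 4 * len p.ε k * q) + 8 * (p.G * p.D) := by
        have := mul_le_mul_of_nonneg_right hn hq0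
        gcongr
        linarith
    -- With `1/η = 2√l G/r` the term `D²/η` contributes 2, and the term `η · 4l · 38G²D²/r²`
    -- contributes 76.
    _ = 78 * √(len p.ε k) * (p.G * p.D ^ 2 / p.r) + 8 * (p.G * p.D) := by
        have hs : (len p.ε k : ℝ) = √(len p.ε k) * √(len p.ε k) :=
          (Real.mul_self_sqrt hl.le).symm
        have hs0 : 0 < √(len p.ε k : ℝ) := by positivity
        rw [hq, stepSize]
        generalize √(len p.ε k : ℝ) = w at *
        rw [hs]
        field_simp
        ring
    _ ≤ 78 * √(len p.ε k) * (p.G * p.D ^ 2 / p.r) +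
        8 * √(len p.ε k) * (p.G * p.D ^ 2 / p.r) := by
        refine add_le_add_right ?_ _
        have h1 : p.G * p.D ≤ p.G * p.D ^ 2 / p.r := by
          rw [le_div_iff₀ hr, sq, ← mul_assoc]
          gcongr
        calc 8 * (p.G * p.D) ≤ 8 * 1 * (p.G * p.D ^ 2 / p.r) := by linarith
          _ ≤ _ := by gcongr
    _ = _ := by ring

end Setting

end BaseRegret

end ProjFree

namespace ProjFree

/-! ### The lengths of the levels -/

section Lengths

variable {ε : ℝ}

theorem lt_len (ε : ℝ) (k : ℕ) : (2 : ℝ) ^ ((1 + ε) ^ k) / 2 < len ε k := by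
  have := Nat.lt_floor_add_one ((2 : ℝ) ^ ((1 + ε) ^ k) / 2)
  unfold len
  exact_mod_cast this

theorem len_le (ε : ℝ) (k : ℕ) : (len ε k : ℝ) ≤ (2 : ℝ) ^ ((1 + ε) ^ k) / 2 + 1 := by
  have := Nat.floor_le (a := (2 : ℝ) ^ ((1 + ε) ^ k) / 2) (by positivity)
  unfold len
  push_cast
  linarith

theorem len_mono (hε : 0 < ε) {k k' : ℕ} (h : k ≤ k') : len ε k ≤ len ε k' := by
  unfold len
  gcongr
  · norm_num
  · linarith

theorem two_le_pow (hε : 0 < ε) (k : ℕ) : (2 : ℝ) ≤ (2 : ℝ) ^ ((1 + ε) ^ k) := by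
  conv_lhs => rw [← Real.rpow_one 2]
  exact Real.rpow_le_rpow_of_exponent_le (by norm_num) (one_le_pow₀ (by linarith))

theorem two_le_len (hε : 0 < ε) (k : ℕ) : 2 ≤ len ε k := by
  have h1 := lt_len ε k
  have h2 := two_le_pow hε k
  have h3 : (1 : ℝ) < len ε k := by linarith
  exact_mod_cast h3

theorem len_one (hε : 0 < ε) (hε1 : ε < 1) : len ε 1 = 2 := by
  refine le_antisymm ?_ (two_le_len hε 1)
  have h1 : (2 : ℝ) ^ (1 + ε) < 2 ^ (2 : ℝ) :=
    Real.rpow_lt_rpow_of_exponent_lt (by norm_num) (by linarith)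
  have h2 := len_le ε 1
  rw [pow_one] at h2
  have h3 : (len ε 1 : ℝ) < 3 := by
    norm_num at h1
    linarith
  have : len ε 1 < 3 := by exact_mod_cast h3
  omega

theorem mem_levels_of_len_le (hε : 0 < ε) {T k : ℕ} (hk : 1 ≤ k) (h : len ε k ≤ T) :
    k ∈ levels ε T := by
  rw [mem_levels hε]
  have h1 : (len ε k : ℝ) ≤ T := by exact_mod_cast h
  exact ⟨hk, by linarith [lt_len ε k]⟩

theorem length_levels_le (hε : 0 < ε) (T : ℕ) :
    ((levels ε T).length : ℝ) ≤ 2 * T / ε + 2 := by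
  have h1 : (levels ε T).length ≤ ⌈2 * (T : ℝ) / ε⌉₊ + 1 := by
    refine (List.length_filter_le _ _).trans_eq ?_
    rw [List.length_range]
  have h2 := Nat.ceil_lt_add_one (a := 2 * (T : ℝ) / ε) (by positivity)
  have h3 : ((levels ε T).length : ℝ) ≤ ⌈2 * (T : ℝ) / ε⌉₊ + 1 := by exact_mod_cast h1
  linarith

/-- The level that is used for intervals of length `m`. -/
theorem exists_level (hε : 0 < ε) (hε1 : ε < 1) {m : ℕ} (hm : 4 ≤ m) :
    ∃ k, 1 ≤ k ∧ 2 * len ε k ≤ m ∧ m < 2 * len ε (k + 1) := by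
  classical
  have hex : ∃ k, m < 2 * len ε (k + 1) := by
    by_contra! hcon
    have h1 : ∀ k, k + 1 ∈ levels ε m := fun k =>
      mem_levels_of_len_le hε (by omega) (by have := hcon k; omega)
    have h2 : (Set.range fun k : ℕ => k + 1) ⊆ ((levels ε m).toFinset : Set ℕ) := by
      rintro _ ⟨k, rfl⟩
      simpa using h1 k
    exact Set.infinite_range_of_injective (add_left_injective 1)
      ((Finset.finite_toSet _).subset h2)
  have hspec := Nat.find_spec hex
  have hpos : Nat.find hex ≠ 0 := by
    intro h0
    rw [h0, zero_add, len_one hε hε1] at hspec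
    omega
  obtain ⟨k, hk⟩ := Nat.exists_eq_succ_of_ne_zero hpos
  have hmin := Nat.find_min hex (m := k) (by omega)
  rw [hk] at hspec
  exact ⟨k + 1, by omega, by omega, hspec⟩

theorem pow_succ_eq (ε : ℝ) (k : ℕ) :
    (2 : ℝ) ^ ((1 + ε) ^ (k + 1)) = ((2 : ℝ) ^ ((1 + ε) ^ k)) ^ (1 + ε) := by
  rw [pow_succ, Real.rpow_mul (by norm_num)]

/-- Consecutive lengths differ by at most a power `1 + ε`. -/
theorem div_sqrt_len_le (hε : 0 < ε) (hε1 : ε ≤ 1 / 2) {m k : ℕ} (hm : 1 ≤ m)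
    (h : m < 2 * len ε (k + 1)) :
    (m : ℝ) / √(len ε k) ≤ 2 * (m : ℝ) ^ (1 / 2 + ε) := by
  have hl := len_pos ε k
  have hm' : (1 : ℝ) ≤ m := by exact_mod_cast hm
  have h1 : (m : ℝ) ≤ (4 * len ε k : ℝ) ^ (1 + ε) := by
    have h2 : (m : ℝ) ≤ 2 * len ε (k + 1) := by exact_mod_cast h.le
    have h3 := len_le ε (k + 1)
    have h4 := two_le_pow hε (k + 1)
    have h5 : (m : ℝ) ≤ 2 * (2 : ℝ) ^ ((1 + ε) ^ (k + 1)) := by linarith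
    rw [pow_succ_eq] at h5
    have h6 : ((2 : ℝ) ^ ((1 + ε) ^ k)) ^ (1 + ε) ≤ (2 * len ε k : ℝ) ^ (1 + ε) := by
      have := lt_len ε k
      gcongr
      linarith
    have h7 : (4 * len ε k : ℝ) ^ (1 + ε) = 2 ^ (1 + ε) * (2 * len ε k : ℝ) ^ (1 + ε) := by
      rw [← Real.mul_rpow (by norm_num) (by positivity)]
      ring_nf
    have h8 : (2 : ℝ) ≤ 2 ^ (1 + ε) := by
      conv_lhs => rw [← Real.rpow_one 2]
      exact Real.rpow_le_rpow_of_exponent_le (by norm_num) (by linarith)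
    rw [h7]
    have h9 : 0 ≤ (2 * len ε k : ℝ) ^ (1 + ε) := by positivity
    nlinarith
  -- Raising to the power `1 + ε` reduces this to `h1`, since `(1 - 2ε)(1 + ε) ≤ 1`.
  have h2 : (m : ℝ) ^ (1 - 2 * ε) ≤ 4 * len ε k := by
    rw [← Real.rpow_le_rpow_iff (z := 1 + ε) (by positivity) (by positivity) (by linarith)]
    refine le_trans ?_ h1
    rw [← Real.rpow_mul (by positivity)]
    conv_rhs => rw [← Real.rpow_one (m : ℝ)]
    exact Real.rpow_le_rpow_of_exponent_le hm' (by nlinarith)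
  rw [div_le_iff₀ (Real.sqrt_pos.2 hl)]
  have h3 : (m : ℝ) ^ (1 / 2 - ε) ≤ 2 * √(len ε k) := by
    have h4 : (m : ℝ) ^ (1 / 2 - ε) = √((m : ℝ) ^ (1 - 2 * ε)) := by
      rw [Real.sqrt_eq_rpow, ← Real.rpow_mul (by positivity)]
      ring_nf
    rw [h4]
    refine (Real.sqrt_le_sqrt h2).trans_eq ?_
    rw [show (4 : ℝ) = 2 ^ 2 by norm_num, Real.sqrt_mul (by norm_num),
      Real.sqrt_sq (by norm_num)]
  calc (m : ℝ) = (m : ℝ) ^ (1 / 2 + ε) * (m : ℝ) ^ (1 / 2 - ε) := by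
        rw [← Real.rpow_add (by positivity)]
        norm_num
    _ ≤ (m : ℝ) ^ (1 / 2 + ε) * (2 * √(len ε k)) := by gcongr
    _ = _ := by ring

/-- The levels with the same length as the level `k`. -/
noncomputable def sameLen (ε : ℝ) (T k : ℕ) : Finset ℕ :=
  (levels ε T).toFinset.filter fun k' => len ε k' = len ε k

theorem mem_sameLen {T k k' : ℕ} :
    k' ∈ sameLen ε T k ↔ k' ∈ levels ε T ∧ len ε k' = len ε k := by
  simp [sameLen]

/-- As the floor jumps after level `k`, the unrounded value at `k + 1` is at least `2 l_k`. Going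
back `i` levels from there shrinks its logarithm by a factor of at least `1 - iε`, hence lowers `2
l_k` by at most `2 l_k · iε log(2 l_k) ≤ iεT² ≤ 1`, which rounding does not notice. -/
theorem two_mul_len_sub_two_lt (hε : 0 < ε) {T k i : ℕ} (hT : 2 * len ε k ≤ T)
    (hlt : len ε k < len ε (k + 1)) (hik : i ≤ k + 1) (hi : i * (ε * T ^ 2) ≤ 1) :
    2 * (len ε k : ℝ) - 2 < (2 : ℝ) ^ ((1 + ε) ^ (k + 1 - i)) := by
  have hl := len_pos ε k
  set l : ℝ := (len ε k : ℝ) with hldef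
  have hT' : 2 * l ≤ T := by
    rw [hldef]
    exact_mod_cast hT
  have h1 : 2 * l ≤ (2 : ℝ) ^ ((1 + ε) ^ (k + 1)) := by
    have h2 : ⌊(2 : ℝ) ^ ((1 + ε) ^ k) / 2⌋₊ + 1 ≤ ⌊(2 : ℝ) ^ ((1 + ε) ^ (k + 1)) / 2⌋₊ := by
      unfold len at hlt
      omega
    have h3 := Nat.floor_le (a := (2 : ℝ) ^ ((1 + ε) ^ (k + 1)) / 2) (by positivity)
    have h4 : l ≤ ⌊(2 : ℝ) ^ ((1 + ε) ^ (k + 1)) / 2⌋₊ := by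
      rw [hldef, len]
      exact_mod_cast h2
    linarith
  have h2 : Real.log (2 * l) ≤ (1 + ε) ^ (k + 1) * Real.log 2 := by
    have := Real.log_le_log (by positivity) h1
    rwa [Real.log_rpow (by norm_num)] at this
  have h3 : (1 + ε) ^ (k + 1) = (1 + ε) ^ (k + 1 - i) * (1 + ε) ^ i := by
    rw [← pow_add]
    congr 1
    omega
  have hl1 : (1 : ℝ) ≤ l := by
    rw [hldef]
    exact_mod_cast one_le_len ε k
  have hlog0 : 0 ≤ Real.log (2 * l) := Real.log_nonneg (by linarith)
  have hlogT : Real.log (2 * l) ≤ T := by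
    have := Real.log_le_sub_one_of_pos (show 0 < 2 * l by positivity)
    linarith
  have h4 : Real.log (2 * l) * (1 - i * ε) ≤ (1 + ε) ^ (k + 1 - i) * Real.log 2 := by
    have h5 : (1 - i * ε) * (1 + ε) ^ i ≤ 1 := by
      have hb := one_add_mul_le_pow (a := -(ε / (1 + ε))) (by
        have : ε / (1 + ε) ≤ 1 := by
          rw [div_le_one (by linarith)]
          linarith
        linarith) i
      have h6 : 1 + -(ε / (1 + ε)) = (1 + ε)⁻¹ := by
        field_simp
        ring
      rw [h6, inv_pow] at hb
      have h7 : ε / (1 + ε) ≤ ε := div_le_self hε.le (by linarith)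
      have h8 : 1 - i * ε ≤ ((1 + ε) ^ i)⁻¹ := by
        have : (i : ℝ) * (ε / (1 + ε)) ≤ i * ε := by gcongr
        linarith
      have h9 : 0 < (1 + ε) ^ i := by positivity
      calc _ ≤ ((1 + ε) ^ i)⁻¹ * (1 + ε) ^ i := by gcongr
        _ = 1 := inv_mul_cancel₀ h9.ne'
    have h9 : 0 < (1 + ε) ^ i := by positivity
    refine le_of_mul_le_mul_right ?_ h9
    calc Real.log (2 * l) * (1 - i * ε) * (1 + ε) ^ i
        = Real.log (2 * l) * ((1 - i * ε) * (1 + ε) ^ i) := by ring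
      _ ≤ Real.log (2 * l) * 1 := by gcongr
      _ ≤ (1 + ε) ^ (k + 1) * Real.log 2 := by linarith
      _ = _ := by rw [h3]; ring
  have h5 : (2 : ℝ) ^ ((1 + ε) ^ (k + 1 - i)) =
      Real.exp ((1 + ε) ^ (k + 1 - i) * Real.log 2) := by
    rw [Real.rpow_def_of_pos (by norm_num), mul_comm]
  have h6 : 2 * l * (1 - i * ε * Real.log (2 * l)) ≤ (2 : ℝ) ^ ((1 + ε) ^ (k + 1 - i)) := by
    rw [h5]
    refine le_trans ?_ (Real.exp_le_exp.2 h4)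
    rw [show Real.log (2 * l) * (1 - i * ε) = Real.log (2 * l) + -(Real.log (2 * l) * (i * ε)) by
      ring, Real.exp_add, Real.exp_log (by positivity)]
    gcongr
    have := Real.add_one_le_exp (-(Real.log (2 * l) * (i * ε)))
    linarith
  have h7 : l * (i * ε * Real.log (2 * l)) ≤ 1 / 2 := by
    calc l * (i * ε * Real.log (2 * l)) ≤ (T / 2) * (i * ε * T) := by
          gcongr
          linarith
      _ = (i * (ε * T ^ 2)) / 2 := by ring
      _ ≤ _ := by linarith
  linarith

/-- For small `ε` there are many levels of the same length. -/
theorem length_levels_le_card_sameLen (hε : 0 < ε) {T k : ℕ} (hT3 : 3 ≤ T) (hk : 1 ≤ k)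
    (hT : 2 * len ε k ≤ T) (hlt : len ε k < len ε (k + 1)) :
    (T : ℝ) * (levels ε T).length ≤ T ^ 6 * (sameLen ε T k).card := by
  have hT0 : (3 : ℝ) ≤ T := by exact_mod_cast hT3
  have hkQ : k ∈ sameLen ε T k :=
    mem_sameLen.2 ⟨mem_levels_of_len_le hε hk (by omega), rfl⟩
  have hcard1 : 1 ≤ (sameLen ε T k).card := Finset.card_pos.2 ⟨k, hkQ⟩
  have hl2 := two_le_len hε k
  set i₀ := ⌊1 / (ε * (T : ℝ) ^ 2)⌋₊ with hi₀
  have hεT : 0 < ε * (T : ℝ) ^ 2 := by positivity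
  have hsmall : ∀ i ≤ i₀, (i : ℝ) * (ε * T ^ 2) ≤ 1 := by
    intro i hi
    have h1 := Nat.floor_le (a := 1 / (ε * (T : ℝ) ^ 2)) (by positivity)
    have h2 : (i : ℝ) ≤ 1 / (ε * (T : ℝ) ^ 2) := (Nat.cast_le.2 hi).trans h1
    rwa [le_div_iff₀ hεT] at h2
  -- Otherwise one could go back to exponent `(1 + ε)^0 = 1`, and `2 l_k - 2 < 2` would contradict
  -- `l_k ≥ 2`.
  have hne : i₀ ≤ k := by
    by_contra! hcon
    have h1 := two_mul_len_sub_two_lt hε hT hlt (i := k + 1) le_rfl (hsmall _ hcon)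
    have h2 : (2 : ℝ) ≤ len ε k := by exact_mod_cast hl2
    simp at h1
    linarith
  have hcard : i₀ ≤ (sameLen ε T k).card := by
    -- The levels `k, k - 1, …, k + 1 - i₀` all have the length of level `k`: monotonicity gives one
    -- inequality, the preceding lemma the other.
    have h1 : (Finset.Icc 1 i₀).image (fun i => k + 1 - i) ⊆ sameLen ε T k := by
      intro k' hk'
      obtain ⟨i, hi, rfl⟩ := Finset.mem_image.1 hk'
      obtain ⟨hi1, hi2⟩ := Finset.mem_Icc.1 hi
      have h2 := two_mul_len_sub_two_lt hε hT hlt (i := i) (by omega) (hsmall i hi2)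
      have h3 := lt_len ε (k + 1 - i)
      have h4 : (len ε k : ℝ) < len ε (k + 1 - i) + 1 := by linarith
      have h5 : len ε k < len ε (k + 1 - i) + 1 := by exact_mod_cast h4
      have h6 := len_mono hε (by omega : k + 1 - i ≤ k)
      exact mem_sameLen.2 ⟨mem_levels_of_len_le hε (by omega) (by omega), by omega⟩
    have h2 := Finset.card_le_card h1
    rw [Finset.card_image_of_injOn] at h2
    · simpa using h2
    · intro i hi j hj hij
      have := (Finset.mem_Icc.1 hi).2
      have := (Finset.mem_Icc.1 hj).2
      simp only at hij
      omega
  have h1 : 1 / (ε * (T : ℝ) ^ 2) ≤ 2 * (sameLen ε T k).card := by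
    have h2 := Nat.lt_floor_add_one (1 / (ε * (T : ℝ) ^ 2))
    have h3 : (i₀ : ℝ) ≤ (sameLen ε T k).card := by exact_mod_cast hcard
    have h4 : (1 : ℝ) ≤ (sameLen ε T k).card := by exact_mod_cast hcard1
    linarith
  have h2 : 1 / ε ≤ 2 * T ^ 2 * (sameLen ε T k).card := by
    have h3 : 1 / ε = 1 / (ε * (T : ℝ) ^ 2) * T ^ 2 := by field_simp
    rw [h3]
    have : (0 : ℝ) ≤ (T : ℝ) ^ 2 := by positivity
    nlinarith
  have h3 := length_levels_le hε T
  have h4 : (1 : ℝ) ≤ (sameLen ε T k).card := by exact_mod_cast hcard1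
  have h5 : 2 * (T : ℝ) / ε = 2 * T * (1 / ε) := by ring
  rw [h5] at h3
  set Q : ℝ := ((sameLen ε T k).card : ℝ)
  calc (T : ℝ) * (levels ε T).length ≤ T * (2 * T * (2 * T ^ 2 * Q) + 2) := by
        gcongr
        refine h3.trans ?_
        gcongr
    _ = 4 * T ^ 4 * Q + 2 * T * 1 * 1 := by ring
    _ ≤ 4 * T ^ 4 * Q + 2 * T * T ^ 3 * Q := by
        gcongr
        exact one_le_pow₀ (by linarith)
    _ = 6 * T ^ 4 * Q := by ring
    _ ≤ 3 ^ 2 * T ^ 4 * Q := by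
        gcongr
        norm_num
    _ ≤ T ^ 2 * T ^ 4 * Q := by gcongr
    _ = _ := by ring

end Lengths

end ProjFree

namespace ProjFree

open OracleComp

/-! ### From expert regret to the regret on arbitrary intervals. -/

section Regret

variable {E : Type} [NormedAddCommGroup E] [InnerProductSpace ℝ E] {sub : Subroutines E}
  {p : Params E} {adv : Adversary E} {K : Set E} {A B : ℝ}

/-- The regret on the rounds `a + 1, …, b`. -/
noncomputable def pathRegret (adv : Adversary E) (K : Set E) (h : ℕ → State E) (a b : ℕ) : ℝ :=
  ∑ i ∈ Finset.Ico a b, ((h i).loss adv).val (playPoint (h i).experts) -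
    ⨅ u : K, ∑ i ∈ Finset.Ico a b, ((h i).loss adv).val u

theorem pathRegret_self [Nonempty K] (h : ℕ → State E) (a : ℕ) : pathRegret adv K h a a = 0 := by
  simp [pathRegret]

namespace Setting

theorem bddBelow_losses (S : Setting sub p adv K A B) (h : ℕ → State E) (a b : ℕ) :
    BddBelow (Set.range fun u : K => ∑ i ∈ Finset.Ico a b, ((h i).loss adv).val u) := by
  refine ⟨0, ?_⟩
  rintro _ ⟨u, rfl⟩
  exact Finset.sum_nonneg fun i _ => (S.admissible _).nonneg u u.2

/-- Infima are superadditive: separate comparators on the two pieces do at least as well as a common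
one. Nonnegativity of the losses on `K` makes the infima finite. -/
theorem pathRegret_le_add (S : Setting sub p adv K A B) (h : ℕ → State E) {a b c : ℕ}
    (hab : a ≤ b) (hbc : b ≤ c) :
    pathRegret adv K h a c ≤ pathRegret adv K h a b + pathRegret adv K h b c := by
  have : Nonempty K := ⟨⟨0, S.zero_mem⟩⟩
  have h1 : (⨅ u : K, ∑ i ∈ Finset.Ico a b, ((h i).loss adv).val u) +
      (⨅ u : K, ∑ i ∈ Finset.Ico b c, ((h i).loss adv).val u) ≤
      ⨅ u : K, ∑ i ∈ Finset.Ico a c, ((h i).loss adv).val u := by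
    refine le_ciInf fun u => ?_
    rw [← Finset.sum_Ico_consecutive _ hab hbc]
    exact add_le_add (ciInf_le (S.bddBelow_losses h a b) u) (ciInf_le (S.bddBelow_losses h b c) u)
  unfold pathRegret
  rw [← Finset.sum_Ico_consecutive (fun i => ((h i).loss adv).val (playPoint (h i).experts))
    hab hbc]
  linarith

theorem pathRegret_le (S : Setting sub p adv K A B) {n : ℕ} {h : ℕ → State E}
    (hh : h ∈ (trace sub p adv n).support (memOracle K)) {a b : ℕ} (hab : a ≤ b) (hb : b ≤ n) :
    pathRegret adv K h a b ≤ (b - a) * (p.G * p.D) := by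
  have : Nonempty K := ⟨⟨0, S.zero_mem⟩⟩
  unfold pathRegret
  rw [sub_le_comm]
  refine le_ciInf fun u => ?_
  rw [sub_le_iff_le_add, ← sub_le_iff_le_add', ← Finset.sum_sub_distrib]
  calc _ ≤ ∑ i ∈ Finset.Ico a b, p.G * p.D := by
        refine Finset.sum_le_sum fun i hi => ?_
        have hi' := (Finset.mem_Ico.1 hi).2
        exact (le_abs_self _).trans (S.loss_sub_le _
          ((S.stateInv_trace hh (by omega : i ≤ n)).playPoint_mem S.convex S.zero_mem) u.2)
    _ = _ := by rw [Finset.sum_const, Nat.card_Ico, nsmul_eq_mul, Nat.cast_sub hab]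

theorem take_plays (S : Setting sub p adv K A B) {n : ℕ} {h : ℕ → State E}
    (hh : h ∈ (trace sub p adv n).support (memOracle K)) {i m : ℕ} (him : i ≤ m) (hm : m ≤ n) :
    (h m).plays.take i = (h i).plays := by
  induction m, him using Nat.le_induction with
  | base =>
    rw [List.take_of_length_le]
    rw [(S.stateInv_trace hh hm).plays_length]
  | succ m him ih =>
    rw [S.plays_trace hh (by omega), List.take_append_of_le_length]
    · exact ih (by omega)
    · rw [(S.stateInv_trace hh (by omega)).plays_length]
      exact him

theorem regret_eq_pathRegret (S : Setting sub p adv K A B) {n : ℕ} {h : ℕ → State E}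
    (hh : h ∈ (trace sub p adv n).support (memOracle K)) (a : ℕ) {t : ℕ} (ht : t ≤ n) :
    regret K adv (h n).plays (a + 1) t = pathRegret adv K h a t := by
  have hloss : ∀ i ∈ Finset.Ico a t, adv ((h n).plays.take (i + 1)) = (h i).loss adv := by
    intro i hi
    have := (Finset.mem_Ico.1 hi).2
    rw [S.take_plays hh (by omega : i + 1 ≤ n) le_rfl, S.plays_trace hh (by omega)]
    rfl
  have hplay : ∀ i ∈ Finset.Ico a t, (h n).plays.getD (i + 1 - 1) 0 =
      playPoint (h i).experts := by
    intro i hi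
    have := (Finset.mem_Ico.1 hi).2
    have h1 : (h n).plays.getD i 0 = ((h n).plays.take (i + 1)).getD i 0 := by
      simp [List.getD_eq_getElem?_getD]
    have h2 := (S.stateInv_trace hh (by omega : i ≤ n)).plays_length
    rw [Nat.add_sub_cancel, h1, S.take_plays hh (by omega : i + 1 ≤ n) le_rfl,
      S.plays_trace hh (by omega)]
    simp [List.getD_eq_getElem?_getD, h2]
  have hsum : ∀ F : ℕ → ℝ, ∑ i ∈ Finset.Icc (a + 1) t, F i = ∑ i ∈ Finset.Ico a t, F (i + 1) := by
    intro F
    rw [Finset.sum_Ico_add' F a t 1]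
    rfl
  unfold regret pathRegret
  simp only [hsum]
  congr 1
  · exact Finset.sum_congr rfl fun i hi => by rw [hloss i hi, hplay i hi]
  · congr 1
    ext u
    exact Finset.sum_congr rfl fun i hi => by rw [hloss i hi]

theorem expectedRegret_eq (S : Setting sub p adv K A B) (a : ℕ) {t : ℕ} (ht : t ≤ p.T) :
    expectedRegret sub p adv K (a + 1) t =
      (trace sub p adv p.T).expect (memOracle K) fun h => pathRegret adv K h a t := by
  rw [expectedRegret, expect_run]
  exact expect_congr fun h hh => S.regret_eq_pathRegret hh a ht

theorem one_le_log_T (S : Setting sub p adv K A B) : 1 ≤ Real.log p.T := by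
  have h1 : (3 : ℝ) ≤ p.T := by exact_mod_cast S.three_le_T
  rw [Real.le_log_iff_exp_le (by linarith)]
  linarith [Real.exp_one_lt_d9]

theorem GD_le (S : Setting sub p adv K A B) (hrD : p.r ≤ p.D) :
    p.G * p.D ≤ √(Real.log p.T) * (p.G * p.D ^ 2 / p.r) := by
  have hG := S.G_pos
  have hD := S.D_pos
  have hr := S.r_pos
  have h1 : 1 ≤ √(Real.log p.T) := Real.one_le_sqrt.2 S.one_le_log_T
  have h2 : p.G * p.D ≤ p.G * p.D ^ 2 / p.r := by
    rw [le_div_iff₀ hr, sq, ← mul_assoc]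
    gcongr
  have h3 : 0 ≤ p.G * p.D ^ 2 / p.r := by positivity
  nlinarith

/-- The expected regret of the meta-algorithm in the lifetime of an expert. -/
theorem expect_block_regret_le (S : Setting sub p adv K A B) (hrD : p.r ≤ p.D) {a b k : ℕ}
    (hk : k ∈ levels p.ε p.T) (hdvd : len p.ε k ∣ a) (hab : a ≤ b)
    (hb : b ≤ a + 4 * len p.ε k) (hbT : b ≤ p.T)
    (hV : (p.T : ℝ) * (levels p.ε p.T).length ≤ p.T ^ 6 * (sameLen p.ε p.T k).card) :
    (trace sub p adv p.T).expect (memOracle K) (fun h => pathRegret adv K h a b) ≤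
      102 * √(len p.ε k) * (√(Real.log p.T) * (p.G * p.D ^ 2 / p.r)) := by
  have hG := S.G_pos
  have hD := S.D_pos
  have hr := S.r_pos
  have hl := len_pos p.ε k
  have hlen := one_le_len p.ε k
  have hlog := S.one_le_log_T
  have hGDW := S.GD_le hrD
  have : Nonempty K := ⟨⟨0, S.zero_mem⟩⟩
  set W := √(Real.log p.T) * (p.G * p.D ^ 2 / p.r) with hW
  have hW0 : 0 ≤ W := by positivity
  have hs1 : (1 : ℝ) ≤ √(len p.ε k) := Real.one_le_sqrt.2 (by exact_mod_cast hlen)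
  have hss : √(len p.ε k : ℝ) * √(len p.ε k) = len p.ε k := Real.mul_self_sqrt hl.le
  have hLL : √(Real.log p.T) * √(Real.log p.T) = Real.log p.T := Real.mul_self_sqrt (by linarith)
  have hL1 : 1 ≤ √(Real.log p.T) := Real.one_le_sqrt.2 hlog
  rcases Nat.eq_or_lt_of_le hab with rfl | hab'
  · simp only [pathRegret_self, expect_const]
    positivity
  have hba : (b : ℝ) - a ≤ 4 * len p.ε k := by
    have : (b : ℝ) ≤ a + 4 * len p.ε k := by exact_mod_cast hb
    linarith
  -- For short lengths the learning rate may be capped at `1/2`, but then the trivial bound `4lGD`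
  -- is already of order `√l √(log T)`. Otherwise the square root attains the minimum.
  by_cases hsmall : (len p.ε k : ℝ) ≤ 4 * Real.log p.T
  · refine (expect_le_const fun h hh => S.pathRegret_le hh hab hbT).trans ?_
    have h1 : √(len p.ε k : ℝ) ≤ 2 * √(Real.log p.T) := by
      refine (Real.sqrt_le_sqrt hsmall).trans_eq ?_
      rw [show (4 : ℝ) = 2 ^ 2 by norm_num, Real.sqrt_mul (by norm_num),
        Real.sqrt_sq (by norm_num)]
    have h2 : p.G * p.D ≤ p.G * p.D ^ 2 / p.r := by
      rw [le_div_iff₀ hr, sq, ← mul_assoc]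
      gcongr
    calc ((b : ℝ) - a) * (p.G * p.D)
        ≤ 4 * (√(len p.ε k) * √(len p.ε k)) * (p.G * p.D ^ 2 / p.r) := by
          rw [hss]
          gcongr
      _ ≤ 4 * (√(len p.ε k) * (2 * √(Real.log p.T))) * (p.G * p.D ^ 2 / p.r) := by gcongr
      _ = 8 * √(len p.ε k) * W := by
          rw [hW]
          ring
      _ ≤ _ := by
          gcongr
          norm_num
  push Not at hsmall
  -- An expert is removed at the end of its last round, so its final weight is not available in the
  -- state. The last round of the block is therefore split off and paid for by `GD`.
  obtain ⟨c, rfl⟩ : ∃ c, b = c + 1 := ⟨b - 1, by omega⟩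
  set Q := sameLen p.ε p.T k with hQ
  have hQc : 0 < (Q.card : ℝ) := by
    exact_mod_cast Finset.card_pos.2 ⟨k, mem_sameLen.2 ⟨hk, rfl⟩⟩
  have hT0 : (0 : ℝ) < p.T := by
    have := S.three_le_T
    exact_mod_cast (by omega : 0 < p.T)
  have hρ : rate p.ε p.T k = √(Real.log p.T) / √(len p.ε k) := by
    rw [rate, Real.sqrt_div (by linarith), min_eq_right]
    rw [div_le_div_iff₀ (by positivity) (by norm_num), mul_comm, one_mul]
    rw [show (2 : ℝ) = √(2 ^ 2) from (Real.sqrt_sq (by norm_num)).symm,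
      ← Real.sqrt_mul (by norm_num)]
    exact Real.sqrt_le_sqrt (by linarith)
  have hmeta : ∀ h ∈ (trace sub p adv p.T).support (memOracle K),
      Q.card * pathRegret adv K h a c ≤ Q.card * (p.G * p.D * (15 * (√(Real.log p.T) *
        √(len p.ε k)))) + ∑ k' ∈ Q, (∑ i ∈ Finset.Ico a c,
          ((h i).loss adv).val ((h i).expert (a + 1, k')).x -
          ⨅ u : K, ∑ i ∈ Finset.Ico a c, ((h i).loss adv).val u) := by
    intro h hh
    have h1 := S.sum_sum_loss_sub_le hh (Q := Q) (k₀ := k) (c := c)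
      (fun k' hk' => mem_sameLen.1 hk') hdvd (by omega) (by omega) (by omega)
      (α := (p.T : ℝ) ^ 6) (by positivity) (by
        refine le_trans ?_ hV
        gcongr
        exact_mod_cast hbT)
    -- The potential contributes 7, from `1 + 6 log T ≤ 7 log T`, and the quadratic terms of at most
    -- `4l` rounds contribute 8.
    have h2 : (1 + Real.log ((p.T : ℝ) ^ 6)) / rate p.ε p.T k +
        2 * rate p.ε p.T k * (c - a) ≤ 15 * (√(Real.log p.T) * √(len p.ε k)) := by
      rw [Real.log_pow, hρ]
      have h3 : (1 + (6 : ℕ) * Real.log p.T) / (√(Real.log p.T) / √(len p.ε k)) ≤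
          7 * (√(Real.log p.T) * √(len p.ε k)) := by
        rw [div_le_iff₀ (by positivity)]
        have h4 : 7 * (√(Real.log p.T) * √(len p.ε k)) * (√(Real.log p.T) / √(len p.ε k)) =
            7 * (√(Real.log p.T) * √(Real.log p.T)) := by
          field_simp
        rw [h4, hLL]
        push_cast
        linarith
      have h5 : 2 * (√(Real.log p.T) / √(len p.ε k)) * ((c : ℝ) - a) ≤
          8 * (√(Real.log p.T) * √(len p.ε k)) := by
        calc _ ≤ 2 * (√(Real.log p.T) / √(len p.ε k)) *
              (4 * (√(len p.ε k) * √(len p.ε k))) := by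
              rw [hss]
              push_cast at hba
              gcongr
              linarith
          _ = _ := by field_simp; ring
      linarith
    have h3 : Q.card * (p.G * p.D * ((1 + Real.log ((p.T : ℝ) ^ 6)) / rate p.ε p.T k +
        2 * rate p.ε p.T k * (c - a))) ≤
        Q.card * (p.G * p.D * (15 * (√(Real.log p.T) * √(len p.ε k)))) := by gcongr
    have h4 : (Q.card : ℝ) * pathRegret adv K h a c =
        ∑ k' ∈ Q, ∑ i ∈ Finset.Ico a c, (((h i).loss adv).val (playPoint (h i).experts) -
          ((h i).loss adv).val ((h i).expert (a + 1, k')).x) +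
        ∑ k' ∈ Q, (∑ i ∈ Finset.Ico a c,
          ((h i).loss adv).val ((h i).expert (a + 1, k')).x -
          ⨅ u : K, ∑ i ∈ Finset.Ico a c, ((h i).loss adv).val u) := by
      rw [← Finset.sum_add_distrib, ← nsmul_eq_mul, ← Finset.sum_const]
      refine Finset.sum_congr rfl fun k' _ => ?_
      rw [Finset.sum_sub_distrib, pathRegret]
      ring
    rw [h4]
    linarith
  have hEc : (trace sub p adv p.T).expect (memOracle K) (fun h => pathRegret adv K h a c) ≤
      p.G * p.D * (15 * (√(Real.log p.T) * √(len p.ε k))) +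
        86 * √(len p.ε k) * (p.G * p.D ^ 2 / p.r) := by
    refine le_of_mul_le_mul_left ?_ hQc
    rw [← expect_const_mul]
    refine (expect_mono hmeta).trans ?_
    rw [expect_add, expect_const, expect_sum, mul_add]
    gcongr
    rw [← nsmul_eq_mul, ← Finset.sum_const]
    refine Finset.sum_le_sum fun k' hk' => ?_
    obtain ⟨hk1, hk2⟩ := mem_sameLen.1 hk'
    rw [← hk2]
    exact S.expect_expert_regret_le hrD hk1 (by rwa [hk2]) (by omega) (by rw [hk2]; omega)
      (by omega)
  have hE : (trace sub p adv p.T).expect (memOracle K)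
      (fun h => pathRegret adv K h a (c + 1)) ≤
      (trace sub p adv p.T).expect (memOracle K) (fun h => pathRegret adv K h a c) +
        p.G * p.D := by
    have h1 := expect_mono (O := memOracle K) (m := trace sub p adv p.T)
      (F := fun h => pathRegret adv K h a (c + 1))
      (F' := fun h => pathRegret adv K h a c + p.G * p.D) (fun h hh => by
        have h2 := S.pathRegret_le_add h (by omega : a ≤ c) (Nat.le_succ c)
        have h3 := S.pathRegret_le hh (Nat.le_succ c) hbT
        push_cast at h3
        simp only [add_sub_cancel_left, one_mul, Nat.succ_eq_add_one] at h2 h3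
        linarith)
    rwa [expect_add, expect_const] at h1
  have hD2 : p.G * p.D ≤ p.G * p.D ^ 2 / p.r := by
    rw [le_div_iff₀ hr, sq, ← mul_assoc]
    gcongr
  have hX0 : 0 ≤ p.G * p.D ^ 2 / p.r := by positivity
  calc _ ≤ p.G * p.D * (15 * (√(Real.log p.T) * √(len p.ε k))) +
        86 * √(len p.ε k) * (p.G * p.D ^ 2 / p.r) + p.G * p.D := by linarith
    _ ≤ p.G * p.D ^ 2 / p.r * (15 * (√(Real.log p.T) * √(len p.ε k))) +
        86 * √(len p.ε k) * W + 1 * W := by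
        refine add_le_add (add_le_add (by gcongr) ?_) (by rwa [one_mul])
        gcongr
        exact le_mul_of_one_le_left hX0 hL1
    _ ≤ p.G * p.D ^ 2 / p.r * (15 * (√(Real.log p.T) * √(len p.ε k))) +
        86 * √(len p.ε k) * W + √(len p.ε k) * W := by gcongr
    _ = _ := by
        rw [hW]
        ring

theorem expect_pathRegret_le_add (S : Setting sub p adv K A B) {a b c : ℕ} (hab : a ≤ b)
    (hbc : b ≤ c) :
    (trace sub p adv p.T).expect (memOracle K) (fun h => pathRegret adv K h a c) ≤
      (trace sub p adv p.T).expect (memOracle K) (fun h => pathRegret adv K h a b) +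
        (trace sub p adv p.T).expect (memOracle K) (fun h => pathRegret adv K h b c) := by
  rw [← expect_add]
  exact expect_mono fun h _ => S.pathRegret_le_add h hab hbc

/-- The expected regret from the birth of an expert on. -/
theorem expect_blocks_regret_le (S : Setting sub p adv K A B) (hrD : p.r ≤ p.D) {k : ℕ}
    (hk : k ∈ levels p.ε p.T)
    (hV : (p.T : ℝ) * (levels p.ε p.T).length ≤ p.T ^ 6 * (sameLen p.ε p.T k).card)
    (m a : ℕ) (hdvd : len p.ε k ∣ a) (hT : a + m ≤ p.T) :
    (trace sub p adv p.T).expect (memOracle K) (fun h => pathRegret adv K h a (a + m)) ≤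
      ((m : ℝ) / (4 * len p.ε k) + 1) *
        (102 * √(len p.ε k) * (√(Real.log p.T) * (p.G * p.D ^ 2 / p.r))) := by
  have hG := S.G_pos
  have hr := S.r_pos
  have hl := len_pos p.ε k
  have hlen := one_le_len p.ε k
  set P := 102 * √(len p.ε k) * (√(Real.log p.T) * (p.G * p.D ^ 2 / p.r)) with hP
  have hP0 : 0 ≤ P := by positivity
  induction m using Nat.strong_induction_on generalizing a with
  | _ m ih =>
    by_cases hm : m ≤ 4 * len p.ε k
    · refine (S.expect_block_regret_le hrD hk hdvd (by omega) (by omega) hT hV).trans ?_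
      refine le_mul_of_one_le_left hP0 ?_
      have : (0 : ℝ) ≤ (m : ℝ) / (4 * len p.ε k) := by positivity
      linarith
    · push Not at hm
      obtain ⟨m', rfl⟩ := Nat.exists_eq_add_of_lt hm
      have h1 := S.expect_pathRegret_le_add (a := a) (b := a + 4 * len p.ε k)
        (c := a + (4 * len p.ε k + m' + 1)) (by omega) (by omega)
      have h2 := S.expect_block_regret_le hrD hk hdvd (by omega) le_rfl (by omega) hV
      have h3 := ih (m' + 1) (by omega) (a + 4 * len p.ε k)
        (hdvd.add (Dvd.intro_left 4 rfl)) (by omega)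
      have h4 : ((4 * len p.ε k + m' + 1 : ℕ) : ℝ) / (4 * len p.ε k) =
          1 + ((m' + 1 : ℕ) : ℝ) / (4 * len p.ε k) := by
        push_cast
        field_simp
        ring
      rw [show a + (4 * len p.ε k + m' + 1) = a + 4 * len p.ε k + (m' + 1) by ring] at h1 ⊢
      rw [h4]
      linarith

/-- The expected regret on an arbitrary interval. -/
theorem expect_regret_le (S : Setting sub p adv K A B) (hrD : p.r ≤ p.D) (hε : p.ε ≤ 1 / 2)
    (m a : ℕ) (hT : a + m ≤ p.T) :
    (trace sub p adv p.T).expect (memOracle K) (fun h => pathRegret adv K h a (a + m)) ≤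
      612 * (m : ℝ) ^ (1 / 2 + p.ε) * (√(Real.log p.T) * (p.G * p.D ^ 2 / p.r)) := by
  have hG := S.G_pos
  have hr := S.r_pos
  have hε0 := S.eps_pos
  have hGDW := S.GD_le hrD
  have : Nonempty K := ⟨⟨0, S.zero_mem⟩⟩
  set W := √(Real.log p.T) * (p.G * p.D ^ 2 / p.r) with hW
  have hW0 : 0 ≤ W := by positivity
  induction m using Nat.strong_induction_on generalizing a with
  | _ m ih =>
    rcases Nat.eq_zero_or_pos m with rfl | hm
    · simp only [Nat.add_zero, pathRegret_self, expect_const]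
      positivity
    have hm1 : (1 : ℝ) ≤ m := by exact_mod_cast hm
    have hpow1 : 1 ≤ (m : ℝ) ^ (1 / 2 + p.ε) := Real.one_le_rpow hm1 (by linarith)
    by_cases hm4 : m < 4
    · refine (expect_le_const fun h hh => S.pathRegret_le hh (Nat.le_add_right a m) hT).trans ?_
      have h1 : ((a + m : ℕ) : ℝ) - a ≤ 4 := by
        push_cast
        have : (m : ℝ) ≤ 4 := by exact_mod_cast hm4.le
        linarith
      have h2 : 0 ≤ ((a + m : ℕ) : ℝ) - a := by
        push_cast
        linarith
      have hGD0 : 0 ≤ p.G * p.D := (mul_pos S.G_pos S.D_pos).le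
      calc _ ≤ 4 * W := by gcongr
        _ ≤ 612 * 1 * W := by
            gcongr
            norm_num
        _ ≤ _ := by gcongr
    push Not at hm4
    obtain ⟨k, hk1, hk2, hk3⟩ := exists_level hε0 (by linarith) hm4
    have hl := len_pos p.ε k
    have hlen := two_le_len hε0 k
    have hk : k ∈ levels p.ε p.T := mem_levels_of_len_le hε0 hk1 (by omega)
    have hV := length_levels_le_card_sameLen hε0 S.three_le_T hk1 (by omega : 2 * len p.ε k ≤ p.T)
      (by omega)
    -- the first multiple of the length after `a`
    obtain ⟨m', hm', hdvd⟩ : ∃ m' < len p.ε k, len p.ε k ∣ a + m' := by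
      refine ⟨(len p.ε k - a % len p.ε k) % len p.ε k, Nat.mod_lt _ (by omega), ?_⟩
      have h1 := Nat.mod_lt a (by omega : len p.ε k > 0)
      rw [Nat.dvd_iff_mod_eq_zero, Nat.add_mod, Nat.mod_mod, ← Nat.add_mod, Nat.add_mod,
        ← Nat.mod_mod a, ← Nat.add_mod, Nat.mod_mod]
      rw [Nat.add_sub_cancel' h1.le, Nat.mod_self]
    obtain ⟨q, rfl⟩ := Nat.exists_eq_add_of_le (by omega : m' ≤ m)
    have h1 := S.expect_pathRegret_le_add (a := a) (b := a + m') (c := a + (m' + q)) (by omega)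
      (by omega)
    have h2 := ih m' (by omega) a (by omega)
    have h3 := S.expect_blocks_regret_le hrD hk hV q (a + m') hdvd (by omega)
    rw [← hW] at h3
    rw [add_assoc] at h3
    have h4 := div_sqrt_len_le hε0 hε hm hk3
    have hsl : √(len p.ε k : ℝ) ≤ ((m' + q : ℕ) : ℝ) ^ (1 / 2 + p.ε) := by
      rw [Real.sqrt_eq_rpow]
      calc (len p.ε k : ℝ) ^ (1 / 2 : ℝ) ≤ ((m' + q : ℕ) : ℝ) ^ (1 / 2 : ℝ) := by
            gcongr
            omega
        _ ≤ _ := Real.rpow_le_rpow_of_exponent_le hm1 (by linarith)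
    -- The constant is `153 = 102 · (2/4 + 1)`. Together with the factor `3/4` for the first piece
    -- the induction closes, since `612 = 3/4 · 612 + 153`.
    have h5 : ((q : ℝ) / (4 * len p.ε k) + 1) * (102 * √(len p.ε k) * W) ≤
        153 * ((m' + q : ℕ) : ℝ) ^ (1 / 2 + p.ε) * W := by
      have h6 : ((q : ℝ) / (4 * len p.ε k) + 1) * (102 * √(len p.ε k) * W) =
          102 * ((q : ℝ) / √(len p.ε k) / 4 + √(len p.ε k)) * W := by
        have hs : (len p.ε k : ℝ) = √(len p.ε k) * √(len p.ε k) :=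
          (Real.mul_self_sqrt hl.le).symm
        have hs0 : 0 < √(len p.ε k : ℝ) := by positivity
        generalize √(len p.ε k : ℝ) = w at *
        rw [hs]
        field_simp
      have h7 : (q : ℝ) / √(len p.ε k) ≤ ((m' + q : ℕ) : ℝ) / √(len p.ε k) := by
        gcongr
        omega
      rw [h6]
      refine mul_le_mul_of_nonneg_right ?_ hW0
      linarith
    have h6 : (m' : ℝ) ^ (1 / 2 + p.ε) ≤ 3 / 4 * ((m' + q : ℕ) : ℝ) ^ (1 / 2 + p.ε) := by
      have h7 : (m' : ℝ) ≤ 1 / 2 * ((m' + q : ℕ) : ℝ) := by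
        have : 2 * (m' : ℝ) ≤ ((m' + q : ℕ) : ℝ) := by exact_mod_cast (by omega)
        linarith
      calc (m' : ℝ) ^ (1 / 2 + p.ε) ≤ (1 / 2 * ((m' + q : ℕ) : ℝ)) ^ (1 / 2 + p.ε) := by gcongr
        _ = (1 / 2 : ℝ) ^ (1 / 2 + p.ε) * ((m' + q : ℕ) : ℝ) ^ (1 / 2 + p.ε) :=
            Real.mul_rpow (by norm_num) (by positivity)
        _ ≤ _ := by
            gcongr
            calc (1 / 2 : ℝ) ^ (1 / 2 + p.ε) ≤ (1 / 2 : ℝ) ^ (1 / 2 : ℝ) :=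
                  Real.rpow_le_rpow_of_exponent_ge (by norm_num) (by norm_num) (by linarith)
              _ ≤ 3 / 4 := by
                  rw [← Real.sqrt_eq_rpow, Real.sqrt_le_left (by norm_num)]
                  norm_num
    have h7 := mul_le_mul_of_nonneg_right h6 hW0
    linarith

end Setting

end Regret

end ProjFree

namespace ProjFree

open OracleComp

/-! ### Counting levels, active experts and membership calls. -/

section Calls

/-- For `T ≥ 3` the iterated logarithm is bounded away from 0, so additive constants can be absorbed
into it. -/
theorem thirty_mul_log_log_ge {T : ℝ} (hT : 3 ≤ T) : 1 ≤ 30 * Real.log (Real.log T) := by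
  have h2 := Real.log_two_gt_d9
  have h3 : 6 * Real.log 2 ≤ 4 * Real.log 3 := by
    have h : Real.log ((2 : ℝ) ^ 6) ≤ Real.log ((3 : ℝ) ^ 4) :=
      Real.log_le_log (by norm_num) (by norm_num)
    rw [Real.log_pow, Real.log_pow] at h
    exact_mod_cast h
  have h4 : 1.039 ≤ Real.log T := by
    have := Real.log_le_log (by norm_num) hT
    linarith
  have h5 := Real.one_sub_inv_le_log_of_pos (by linarith : 0 < Real.log T)
  have h6 : (Real.log T)⁻¹ ≤ (1.039 : ℝ)⁻¹ := inv_anti₀ (by norm_num) h4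
  norm_num at h6
  linarith

theorem min_one_le_two_mul_log {ε : ℝ} (hε : 0 < ε) : min ε 1 ≤ 2 * Real.log (1 + ε) := by
  have hm : 0 < min ε 1 := lt_min hε one_pos
  have h1 := Real.one_sub_inv_le_log_of_pos (by linarith : 0 < 1 + min ε 1)
  have h2 : Real.log (1 + min ε 1) ≤ Real.log (1 + ε) :=
    Real.log_le_log (by linarith) (by linarith [min_le_left ε 1])
  have h3 : min ε 1 / 2 ≤ 1 - (1 + min ε 1)⁻¹ := by
    have h4 := min_le_right ε 1
    have h5 : (1 + min ε 1)⁻¹ * (1 + min ε 1) = 1 := inv_mul_cancel₀ (by linarith)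
    nlinarith
  linarith

theorem level_mul_le {ε : ℝ} (hε : 0 < ε) {T k : ℕ} (hT : 3 ≤ T) (hk : k ∈ levels ε T) :
    (k : ℝ) * min ε 1 ≤ 122 * Real.log (Real.log T) := by
  have hT3 : (3 : ℝ) ≤ T := by exact_mod_cast hT
  have hL := thirty_mul_log_log_ge hT3
  have hlog : 1 ≤ Real.log T := by
    rw [Real.le_log_iff_exp_le (by linarith)]
    linarith [Real.exp_one_lt_d9]
  have h1 := ((mem_levels hε T k).1 hk).2
  have h2 : (1 + ε) ^ k * Real.log 2 ≤ Real.log 2 + Real.log T := by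
    rw [← Real.log_mul (by norm_num) (by linarith), ← Real.log_rpow (by norm_num)]
    exact Real.log_le_log (by positivity) (by linarith)
  have h3 : (1 + ε) ^ k ≤ 3 * Real.log T := by
    have h4 := Real.log_two_gt_d9
    have h5 := Real.log_two_lt_d9
    have h6 : 0 ≤ (1 + ε) ^ k := by positivity
    nlinarith
  have h4 : k * Real.log (1 + ε) ≤ Real.log 3 + Real.log (Real.log T) := by
    rw [← Real.log_mul (by norm_num) (by linarith), ← Real.log_pow]
    exact Real.log_le_log (by positivity) h3
  have h5 : Real.log 3 ≤ 2 := by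
    linarith [Real.log_le_sub_one_of_pos (by norm_num : (0 : ℝ) < 3)]
  -- Doubling `h4` gives `4 + 2 log log T`, and `4 ≤ 120 log log T`; hence 122.
  have h6 := mul_le_mul_of_nonneg_left (min_one_le_two_mul_log hε) (Nat.cast_nonneg (α := ℝ) k)
  linarith

theorem length_levels_mul_le {ε : ℝ} (hε : 0 < ε) {T : ℕ} (hT : 3 ≤ T) :
    ((levels ε T).length : ℝ) ≤ 122 * Real.log (Real.log T) / min ε 1 := by
  have hm : 0 < min ε 1 := lt_min hε one_pos
  have hL := thirty_mul_log_log_ge (T := T) (by exact_mod_cast hT)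
  have h0 : 0 ≤ 122 * Real.log (Real.log T) / min ε 1 := div_nonneg (by linarith) hm.le
  have h1 : (levels ε T).toFinset ⊆ Finset.Icc 1 ⌊122 * Real.log (Real.log T) / min ε 1⌋₊ := by
    intro k hk
    rw [List.mem_toFinset] at hk
    rw [Finset.mem_Icc, Nat.le_floor_iff h0, le_div_iff₀ hm]
    exact ⟨((mem_levels hε T k).1 hk).1, level_mul_le hε hT hk⟩
  have h2 := Finset.card_le_card h1
  rw [List.toFinset_card_of_nodup (nodup_levels ε T), Nat.card_Icc, Nat.add_sub_cancel,
    Nat.le_floor_iff h0] at h2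
  exact h2

theorem one_add_log_horizon_le {ε : ℝ} (hε : 0 < ε) {T k : ℕ} (hT : 3 ≤ T)
    (hk : k ∈ levels ε T) : 1 + Real.log ((4 * len ε k : ℕ) : ℝ) ≤ 4 * Real.log T := by
  have hT3 : (3 : ℝ) ≤ T := by exact_mod_cast hT
  have hlog : 1 ≤ Real.log T := by
    rw [Real.le_log_iff_exp_le (by linarith)]
    linarith [Real.exp_one_lt_d9]
  have h1 := ((mem_levels hε T k).1 hk).2
  have h2 := len_le ε k
  have h3 := len_pos ε k
  have h4 : Real.log ((4 * len ε k : ℕ) : ℝ) ≤ Real.log ((T : ℝ) ^ 3) := by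
    push_cast
    refine Real.log_le_log (by positivity) ?_
    have h5 : (3 : ℝ) ^ 2 * T ≤ T ^ 2 * T := by gcongr
    linarith
  rw [Real.log_pow] at h4
  push_cast at h4 ⊢
  linarith

variable {E : Type} [NormedAddCommGroup E] [InnerProductSpace ℝ E]
variable {sub : Subroutines E} {p : Params E} {adv : Adversary E} {K : Set E} {A B : ℝ}

/-- Births at a level happen at multiples of its length, and a lifetime spans four of them. Level
and age, counted in multiples of the length, therefore identify an active expert, and the age takes
at most four values. -/
theorem StateInv.length_experts_le {E : Type} [NormedAddCommGroup E] {p : Params E} {K : Set E}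
    {A : ℝ} {i : ℕ} {σ : State E} (hσ : StateInv p K A i σ) :
    σ.experts.length ≤ (levels p.ε p.T).length * 4 := by
  have h1 : σ.experts.length = (σ.experts.map Expert.key).toFinset.card := by
    rw [List.toFinset_card_of_nodup hσ.nodup, List.length_map]
  have h2 : (levels p.ε p.T).length * 4 =
      ((levels p.ε p.T).toFinset ×ˢ Finset.range 4).card := by
    rw [Finset.card_product, List.toFinset_card_of_nodup (nodup_levels _ _), Finset.card_range]
  have hkey : ∀ κ ∈ (σ.experts.map Expert.key).toFinset, κ.2 ∈ levels p.ε p.T ∧ 1 ≤ κ.1 ∧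
      len p.ε κ.2 ∣ κ.1 - 1 ∧ (κ.1 - 1) / len p.ε κ.2 ≤ i / len p.ε κ.2 ∧
      i / len p.ε κ.2 < (κ.1 - 1) / len p.ε κ.2 + 4 := by
    intro κ hκ
    obtain ⟨e, he, rfl⟩ := List.mem_map.1 (List.mem_toFinset.1 hκ)
    have h3 := hσ.birth_le e he
    have h4 := hσ.one_le_birth e he
    have h5 := hσ.alive e he
    refine ⟨hσ.lvl_mem e he, h4, hσ.dvd e he, Nat.div_le_div_right ?_, ?_⟩
    · simp only [Expert.key]
      omega
    change i / len p.ε e.lvl < (e.birth - 1) / len p.ε e.lvl + 4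
    rw [Nat.div_lt_iff_lt_mul (one_le_len _ _), add_mul, Nat.div_mul_cancel (hσ.dvd e he)]
    omega
  rw [h1, h2]
  refine Finset.card_le_card_of_injOn
    (fun κ => (κ.2, i / len p.ε κ.2 - (κ.1 - 1) / len p.ε κ.2)) (fun κ hκ => ?_) ?_
  · obtain ⟨h3, -, -, h4, h5⟩ := hkey κ hκ
    simp only [Finset.coe_product, Set.mem_prod, Finset.mem_coe, List.mem_toFinset,
      Finset.mem_range]
    exact ⟨h3, by omega⟩
  · rintro ⟨j, k⟩ hκ ⟨j', k'⟩ hκ' h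
    obtain ⟨-, h3, h4, h5, -⟩ := hkey _ hκ
    obtain ⟨-, h3', h4', h5', -⟩ := hkey _ hκ'
    simp only [Prod.mk.injEq] at h
    obtain ⟨rfl, h⟩ := h
    simp only at *
    have h6 : (j - 1) / len p.ε k = (j' - 1) / len p.ε k := by omega
    have h7 := Nat.div_mul_cancel h4
    have h8 := Nat.div_mul_cancel h4'
    rw [h6, h8] at h7
    rw [show j = j' by omega]

namespace Setting

theorem maxCalls_updateExpert_le (S : Setting sub p adv K A B) {i : ℕ} {σ : State E}
    (hσ : StateInv p K A i σ) {e : Expert E} (he : e ∈ σ.experts) (hB : 0 ≤ B) (x : E)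
    (h : List E) : (updateExpert sub p x (adv h) e).maxCalls (memOracle K) ≤
      2 * ⌊B * (4 * Real.log p.T)⌋₊ := by
  have hA := S.A_pos
  have hl := one_le_len p.ε e.lvl
  have good := S.good (4 * len p.ε e.lvl) (by omega)
  have hlog := one_add_log_horizon_le S.eps_pos S.three_le_T (hσ.lvl_mem e he)
  -- The summand `A` leaves room for one more step, as the value is queried at the new iterate.
  have hy : ‖e.y‖ + A ≤ 2 * A * (4 * len p.ε e.lvl : ℕ) := by
    have h1 := hσ.norm_y_le e he
    have h2 : (i : ℝ) + 1 - e.birth ≤ (4 * len p.ε e.lvl : ℕ) := by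
      have h3 : ((i + 1 : ℕ) : ℝ) ≤ (e.birth + 4 * len p.ε e.lvl : ℕ) := by
        exact_mod_cast (hσ.alive e he).le
      push_cast at h3 ⊢
      linarith
    have h3 : (2 : ℝ) ≤ (4 * len p.ε e.lvl : ℕ) := by exact_mod_cast (by omega)
    have h4 := S.D_le
    nlinarith
  have hcalls : ∀ {n : ℕ}, (n : ℝ) ≤ B * (1 + Real.log ((4 * len p.ε e.lvl : ℕ) : ℝ)) →
      n ≤ ⌊B * (4 * Real.log p.T)⌋₊ := fun hn =>
    Nat.le_floor (hn.trans (mul_le_mul_of_nonneg_left hlog hB))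
  have hstep : (baseStep sub (4 * len p.ε e.lvl) (p.r / (2 * √(len p.ε e.lvl) * p.G)) p.G p.D
      (adv h) e.y).maxCalls (memOracle K) ≤
        ⌊B * (4 * Real.log p.T)⌋₊ + (⌊B * (4 * Real.log p.T)⌋₊ + 0) := by
    refine maxCalls_bind_le (hcalls (good.calls_subgrad _ (by linarith))) fun s hs => ?_
    refine maxCalls_bind_le (hcalls (good.calls_value _ ?_)) fun c _ => le_rfl
    have h1 := S.norm_nextPoint_sub_le e.lvl h hs
    have h2 := norm_le_norm_add_norm_sub' (nextPoint p e.lvl (adv h) e.y s) e.y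
    unfold nextPoint stepSize at h1 h2
    linarith
  refine (maxCalls_bind_le (b := 0) hstep fun z _ => le_rfl).trans (by omega)

/-- The number of membership calls in one round. -/
theorem maxCalls_round_le (S : Setting sub p adv K A B) {i : ℕ} {σ : State E}
    (hσ : StateInv p K A i σ) (hB : 0 ≤ B) (t : ℕ) :
    ((round sub p adv t σ).maxCalls (memOracle K) : ℝ) ≤
      3904 * B * (Real.log p.T * Real.log (Real.log p.T) / min p.ε 1) := by
  have hm : 0 < min p.ε 1 := lt_min S.eps_pos one_pos
  have hlog := S.one_le_log_T
  have h1 : (round sub p adv t σ).maxCalls (memOracle K) ≤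
      σ.experts.length * (2 * ⌊B * (4 * Real.log p.T)⌋₊) + 0 :=
    maxCalls_bind_le (maxCalls_traverse_le fun e he => S.maxCalls_updateExpert_le hσ he hB _ _)
      fun es _ => le_rfl
  have h2 : (⌊B * (4 * Real.log p.T)⌋₊ : ℝ) ≤ B * (4 * Real.log p.T) :=
    Nat.floor_le (by positivity)
  have h3 : (σ.experts.length : ℝ) ≤ (levels p.ε p.T).length * 4 := by
    exact_mod_cast hσ.length_experts_le
  have h4 := length_levels_mul_le S.eps_pos S.three_le_T
  have h5 : (σ.experts.length : ℝ) ≤ 122 * Real.log (Real.log p.T) / min p.ε 1 * 4 := by linarith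
  calc ((round sub p adv t σ).maxCalls (memOracle K) : ℝ)
      ≤ σ.experts.length * (2 * ⌊B * (4 * Real.log p.T)⌋₊) := by exact_mod_cast h1
    _ ≤ (122 * Real.log (Real.log p.T) / min p.ε 1 * 4) * (2 * (B * (4 * Real.log p.T))) := by
        exact mul_le_mul h5 (by linarith) (by positivity) ((Nat.cast_nonneg _).trans h5)
    _ = _ := by ring

end Setting

end Calls

end ProjFree

namespace ProjFree

open OracleComp

/-! ### The final bounds on plays, calls and regret. -/

section Interval

variable {E : Type} [NormedAddCommGroup E] [InnerProductSpace ℝ E]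
variable {sub : Subroutines E} {p : Params E} {adv : Adversary E} {K : Set E} {A B : ℝ}

theorem regret_nonpos_of_subsingleton {E : Type} [NormedAddCommGroup E] [Subsingleton E]
    (adv : Adversary E) (K : Set E) [Nonempty K] (plays : List E) (s t : ℕ) :
    regret K adv plays s t ≤ 0 := by
  rw [regret, sub_nonpos]
  refine le_ciInf fun u => (Finset.sum_congr rfl fun i _ => ?_).le
  rw [Subsingleton.elim (u : E)]

namespace Setting

theorem plays_mem_of_mem_support_run (S : Setting sub p adv K A B) {n : ℕ} {σ : State E}
    (hσ : σ ∈ (run sub p adv n).support (memOracle K)) : ∀ x ∈ σ.plays, x ∈ K := by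
  obtain ⟨h, hh, rfl⟩ := exists_trace_of_mem_support_run hσ
  exact (S.stateInv_trace hh le_rfl).plays_mem

theorem maxCalls_round_of_mem_support_run_le (S : Setting sub p adv K A B) (hB : 0 ≤ B) {n t : ℕ}
    {σ : State E} (hσ : σ ∈ (run sub p adv n).support (memOracle K)) :
    ((round sub p adv t σ).maxCalls (memOracle K) : ℝ) ≤
      3904 * B * (Real.log p.T * Real.log (Real.log p.T) / min p.ε 1) := by
  obtain ⟨h, hh, rfl⟩ := exists_trace_of_mem_support_run hσ
  exact S.maxCalls_round_le (S.stateInv_trace hh le_rfl) hB t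

theorem r_le_D [Nontrivial E] (S : Setting sub p adv K A B) : p.r ≤ p.D := by
  obtain ⟨x, hx⟩ := exists_norm_eq E S.r_pos.le
  rw [← hx]
  exact S.norm_le (S.ball (by simp [hx]))

/-- For `ε ≤ 1/2` this is `expect_regret_le`; the interval has `t - s + 1`, hence at most twice the
maximum of 1 and `t - s`, rounds, which doubles the constant. For larger `ε` the exponent exceeds 1
and the trivial linear bound suffices. -/
theorem expectedRegret_le (S : Setting sub p adv K A B) {s t : ℕ} (hs : 1 ≤ s) (hst : s ≤ t)
    (ht : t ≤ p.T) : expectedRegret sub p adv K s t ≤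
      1224 * (p.D ^ 2 * p.G * √(Real.log p.T) * (max 1 ((t : ℝ) - s)) ^ (1 / 2 + p.ε) / p.r) := by
  have hG := S.G_pos
  have hD := S.D_pos
  have hr := S.r_pos
  have hε := S.eps_pos
  set x : ℝ := max 1 ((t : ℝ) - s) with hx
  have hx1 : 1 ≤ x := le_max_left _ _
  -- In dimension 0 the inequality `r ≤ D` may fail, but there is only one point to play and the
  -- regret is at most 0.
  rcases subsingleton_or_nontrivial E with hE | hE
  · have : Nonempty K := ⟨⟨0, S.zero_mem⟩⟩
    exact (expect_le_const fun σ _ => regret_nonpos_of_subsingleton adv K _ s t).trans (by positivity)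
  have hrD := S.r_le_D
  have hGDW := S.GD_le hrD
  obtain ⟨a, rfl⟩ := Nat.exists_eq_add_of_le' hs
  obtain ⟨m, rfl⟩ := Nat.exists_eq_add_of_le (by omega : a ≤ t)
  have hm : (m : ℝ) ≤ 2 * x := by
    have h1 : ((a + m : ℕ) : ℝ) - (a + 1 : ℕ) ≤ x := le_max_right _ _
    push_cast at h1
    linarith
  have hW : 1224 * (p.D ^ 2 * p.G * √(Real.log p.T) * x ^ (1 / 2 + p.ε) / p.r) =
      1224 * x ^ (1 / 2 + p.ε) * (√(Real.log p.T) * (p.G * p.D ^ 2 / p.r)) := by ring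
  rw [S.expectedRegret_eq a ht, hW]
  by_cases hε2 : p.ε ≤ 1 / 2
  · refine (S.expect_regret_le hrD hε2 m a ht).trans ?_
    have h1 : (m : ℝ) ^ (1 / 2 + p.ε) ≤ 2 * x ^ (1 / 2 + p.ε) := by
      calc (m : ℝ) ^ (1 / 2 + p.ε) ≤ (2 * x) ^ (1 / 2 + p.ε) := by gcongr
        _ = 2 ^ (1 / 2 + p.ε) * x ^ (1 / 2 + p.ε) :=
            Real.mul_rpow (by norm_num) (by linarith)
        _ ≤ 2 ^ (1 : ℝ) * x ^ (1 / 2 + p.ε) := by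
            gcongr
            · norm_num
            · linarith
        _ = _ := by rw [Real.rpow_one]
    refine mul_le_mul_of_nonneg_right ?_ (by positivity)
    linarith
  · push Not at hε2
    refine (expect_le_const fun h hh => S.pathRegret_le hh (Nat.le_add_right a m) ht).trans ?_
    have h1 : x ≤ x ^ (1 / 2 + p.ε) := Real.self_le_rpow_of_one_le hx1 (by linarith)
    refine mul_le_mul ?_ hGDW (by positivity) (by positivity)
    push_cast
    linarith

/-- The interval length is at most `T`, so its power `1 / log T` is at most `e < 3`; this multiplies
the general constant by 3. -/
theorem expectedRegret_le_sqrt (S : Setting sub p adv K A B) (hε : p.ε = 1 / Real.log p.T)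
    {s t : ℕ} (hs : 1 ≤ s) (hst : s ≤ t) (ht : t ≤ p.T) : expectedRegret sub p adv K s t ≤
      3672 * (p.D ^ 2 * p.G * √(Real.log p.T) * √(max 1 ((t : ℝ) - s)) / p.r) := by
  have hG := S.G_pos
  have hr := S.r_pos
  have hlog := S.one_le_log_T
  refine (S.expectedRegret_le hs hst ht).trans ?_
  have hT3 : (3 : ℝ) ≤ p.T := by exact_mod_cast S.three_le_T
  set x : ℝ := max 1 ((t : ℝ) - s) with hx
  have hx1 : 1 ≤ x := le_max_left _ _
  have hxT : x ≤ p.T := by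
    refine max_le (by linarith) ?_
    have : (t : ℝ) ≤ p.T := by exact_mod_cast ht
    linarith [Nat.cast_nonneg (α := ℝ) s]
  have h1 : x ^ p.ε ≤ 3 := by
    calc x ^ p.ε ≤ (p.T : ℝ) ^ p.ε := Real.rpow_le_rpow (by linarith) hxT S.eps_pos.le
      _ = Real.exp 1 := by
          rw [Real.rpow_def_of_pos (by linarith), hε, mul_one_div_cancel (by linarith)]
      _ ≤ 3 := by linarith [Real.exp_one_lt_d9]
  have h2 : x ^ (1 / 2 + p.ε) ≤ 3 * √x := by
    rw [Real.rpow_add (by linarith), ← Real.sqrt_eq_rpow, mul_comm]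
    gcongr
  calc _ ≤ 1224 * (p.D ^ 2 * p.G * √(Real.log p.T) * (3 * √x) / p.r) := by gcongr
    _ = _ := by ring

end Setting

end Interval

end ProjFree

theorem mainTheorem4 :
    ∃ C : ℝ, 0 < C ∧ ∀ (d : ℕ) (r D : ℝ), 0 < r → 1 ≤ D →
      ∃ (B : ℝ) (sub : ProjFree.Subroutines (EuclideanSpace ℝ (Fin d))),
        ∀ K : Set (EuclideanSpace ℝ (Fin d)), Convex ℝ K → Metric.closedBall 0 r ⊆ K →
          (∀ x ∈ K, ∀ y ∈ K, dist x y ≤ D) →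
          (∀ H : ℕ, 1 ≤ H → sub.IsApprox K r H (1 / (H : ℝ) ^ 2)) ∧
          ∀ (p : ProjFree.Params (EuclideanSpace ℝ (Fin d)))
            (adv : ProjFree.Adversary (EuclideanSpace ℝ (Fin d))),
            p.r = r → p.D = D → 1 ≤ p.G → 0 < p.ε → 3 ≤ p.T → p.x₁ ∈ K → p.y₁ ∈ K →
            (∀ h, (adv h).IsAdmissible K p.G) →
            -- all played points lie in the domain
            (∀ σ ∈ (ProjFree.run sub p adv p.T).support (ProjFree.memOracle K),
              ∀ x ∈ σ.plays, x ∈ K) ∧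
            -- the number of membership calls in each round
            (∀ t : ℕ, 1 ≤ t → t ≤ p.T →
              ∀ σ ∈ (ProjFree.run sub p adv (t - 1)).support (ProjFree.memOracle K),
                ((ProjFree.round sub p adv t σ).maxCalls (ProjFree.memOracle K) : ℝ) ≤
                  B * (Real.log p.T * Real.log (Real.log p.T) / min p.ε 1)) ∧
            -- the regret on every interval
            (∀ s t : ℕ, 1 ≤ s → s ≤ t → t ≤ p.T →
              ProjFree.expectedRegret sub p adv K s t ≤
                C * (D ^ 2 * p.G * √(Real.log p.T) *
                  (max 1 ((t : ℝ) - s)) ^ (1 / 2 + p.ε) / r)) ∧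
            -- the choice `ε = 1 / log T`
            (p.ε = 1 / Real.log p.T → ∀ s t : ℕ, 1 ≤ s → s ≤ t → t ≤ p.T →
              ProjFree.expectedRegret sub p adv K s t ≤
                C * (D ^ 2 * p.G * √(Real.log p.T) * √(max 1 ((t : ℝ) - s)) / r)) := by
  refine ⟨3672, by norm_num, fun d r D hr hD => ?_⟩
  -- This value of `A` dominates both the speed bound `r + 6dD` and `D`.
  have hA : r + 6 * d * D ≤ D + r + 6 * d * D := by linarith
  obtain ⟨B, hB, good⟩ := ProjFree.gridSubroutines_isGood d hr (by linarith : 0 ≤ D) hA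
  refine ⟨3904 * B, ProjFree.gridSubroutines d r (D + r + 6 * d * D),
    fun K hK hball hdiam => ⟨fun H hH => (good K hK hball H hH).approx, ?_⟩⟩
  rintro p adv rfl rfl hG hε hT hx hy hadv
  have S : ProjFree.Setting (ProjFree.gridSubroutines d p.r (p.D + p.r + 6 * d * p.D)) p adv K
      (p.D + p.r + 6 * d * p.D) B :=
    { convex := hK
      r_pos := hr
      ball := hball
      diam := hdiam
      one_le_D := hD
      one_le_G := hG
      eps_pos := hε
      three_le_T := hT
      x₁_mem := hx
      y₁_mem := hy
      admissible := hadv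
      good := good K hK hball
      D_le := by
        have : 0 ≤ 6 * d * p.D := by positivity
        linarith }
  refine ⟨fun σ hσ => S.plays_mem_of_mem_support_run hσ,
    fun t _ _ σ hσ => S.maxCalls_round_of_mem_support_run_le hB hσ,
    fun s t hs hst ht => (S.expectedRegret_le hs hst ht).trans ?_,
    fun hε' s t hs hst ht => S.expectedRegret_le_sqrt hε' hs hst ht⟩
  have hG0 := S.G_pos
  gcongr
  norm_num
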